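/- Let $n\ge 2$, and let $M$ be a compact connected oriented smooth $n$-manifold with a volume form $\omega$ (inducing the orientation), whose boundary $i\colon\partial M\hookrightarrow M$ is diffeomorphic to $S^{n-1}$. Let $\Omega^l(M,\partial M)=\{\alpha\in\Omega^l(M) : i^*\alpha=0\}$, and assume that the complex $\Omega^*(M,\partial M)$ has cohomology $\mathrm H^l(M,\partial M)=0$ for all $l<n$. Let $\mathrm{Diff}_{\omega,0}(M)$ be the identity component (in the $C^\infty$ topology) of the group of $\omega$-preserving diffeomorphisms of $M$, let $\mathrm{Diff}_{\omega,0}(M,\partial M)$ be the identity component of its subgroup of elements fixing $\partial M$ pointwise, and let $\mathrm{Diff}_0(\partial M)$ be the identity component of $\mathrm{Diff}(\partial M)$. Let $j\colon \mathrm{Diff}_{\omega,0}(M,\partial M)\to \mathrm{Diff}_{\omega,0}(M)$ be the inclusion and $r\colon \mathrm{Diff}_{\omega,0}(M)\to\mathrm{Diff}_0(\partial M)$ the restriction to the boundary. For a group $G$ of diffeomorphisms of $M$ let $\mathscr A^{k,l}(MG)$ be the space of maps $c\colon G^k\to\Omega^l(M)$, with $d''=(-1)^k d_{\mathrm{dR}}$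 and $$\delta c(g_1,\dots,g_{k+1})=c(g_2,\dots,g_{k+1})+\sum_{a=1}^{k}(-1)^a c(g_1,\dots,g_ag_{a+1},\dots,g_{k+1})+(-1)^{k+1}g_{k+1}^*\,c(g_1,\dots,g_k),$$ and let $d=\delta+d''$ on the total complex $\mathscr A^m(MG)=\bigoplus_{k+l=m}\mathscr A^{k,l}(MG)$; for $\phi\in\mathscr A^m(MG)$ write $\phi^{(l)}$ for its component in $\mathscr A^{m-l,l}(MG)$. For any group $G$, $\mathrm H^*(BG^\delta)$ is the cohomology of the complex of real cochains $G^k\to\mathbb R$, with the same formula for the differential (trivial action); a real cochain is regarded as an element of $\mathscr A^{k,0}(MG)$ with constant functions as values. Let $\omega^{(n)}$ denote $\omega$ regarded as an element of $\mathscr A^{0,n}$ for $G=\mathrm{Diff}_{\omega,0}(M,\partial M)$, and $\overline\omega^{(n)}$ the same for $G=\mathrm{Diff}_{\omega,0}(M)$. For $c\in\mathscr A^{k,0}(MG)$ the cochain $\int_M c\wedge\omega^{(n)}$ is $(g_1,\dots,g_k)\mapsto\int_M c(g_1,\dots,g_k)\,\omega$, and likewise for $\overline\omega^{(n)}$. The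 class $c(M)\in \mathrm H^{n-1}(B\mathrm{Diff}_{\omega,0}(M,\partial M)^\delta)$ is the class of $\int_M\phi^{(0)}\wedge\omega^{(n)}$, for any $\phi\in\mathscr A^{n-1}(M\,\mathrm{Diff}_{\omega,0}(M,\partial M))$ with $d\phi=\omega^{(n)}$ and with $\phi^{(l)}$ taking values in $\Omega^l(M,\partial M)$ for $l\le n-2$. **Theorem (transgression formula).** Let $\overline\phi\in\mathscr A^{n-1}(M\,\mathrm{Diff}_{\omega,0}(M))$ satisfy 1. $d\overline\phi=\overline\omega^{(n)}+\delta\overline\phi^{(0)}$; 2. $\overline\phi^{(l)}(g_1,\dots,g_{n-l-1})\in\Omega^l(M,\partial M)$ for all $l<n-1$ and all $g_a\in\mathrm{Diff}_{\omega,0}(M,\partial M)$; 3. for all $l<n-1$, $i^*\overline\phi^{(l)}(g_1,\dots,g_{n-l-1})=i^*\overline\phi^{(l)}(h_1,\dots,h_{n-l-1})$ whenever $g_a,h_a\in\mathrm{Diff}_{\omega,0}(M)$ and $g_a|_{\partial M}=h_a|_{\partial M}$ for every $a$. Let $\chi$ be a real $n$-cocycle of $\mathrm{Diff}_0(\partial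 M)$ with $r^*\chi=\delta\overline\phi^{(0)}$, and let $u=\int_M\overline\phi^{(0)}\wedge\overline\omega^{(n)}$, a real $(n-1)$-cochain of $\mathrm{Diff}_{\omega,0}(M)$. Then $j^*u$ is a cocycle and $$[j^*u]=c(M)\quad\text{and}\quad du=\mathrm{vol}(M)\cdot r^*\chi ,$$ where $\mathrm{vol}(M)=\int_M\omega$. In particular, for the fibration $B\mathrm{Diff}_{\omega,0}(M,\partial M)^\delta\xrightarrow{j}B\mathrm{Diff}_{\omega,0}(M)^\delta\xrightarrow{r}B\mathrm{Diff}_0(\partial M)^\delta$, the class $c(M)$ transgresses to $\mathrm{vol}(M)\cdot[\chi]$: there are an $(n-1)$-cochain $u'$ of $\mathrm{Diff}_{\omega,0}(M)$ and an $n$-cocycle $v$ of $\mathrm{Diff}_0(\partial M)$ representing $\mathrm{vol}(M)\cdot[\chi]$ with $du'=r^*v$ and $[j^*u']=c(M)$. -/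

import Mathlib

open scoped Manifold ContDiff Topology

namespace VolDiff

noncomputable section

/-! ## Diffeomorphism groups, their smooth topology, and identity components -/

section Diffeomorphisms

variable {E H : Type*} [NormedAddCommGroup E] [NormedSpace ℝ E] [TopologicalSpace H]
  (I : ModelWithCorners ℝ E H) (M : Type*) [TopologicalSpace M] [ChartedSpace H M]

/-- The set `Diff(M)` of smooth diffeomorphisms of `M`. -/
abbrev Diff : Type _ := M ≃ₘ⟮I, I⟯ M

/-- `Diff(M)` is a group under composition: `(g * h) x = g (h x)`. -/
instance instGroupDiff : Group (Diff I M) where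
  mul g h := h.trans g
  one := Diffeomorph.refl I M ∞
  inv g := g.symm
  mul_assoc _ _ _ := rfl
  one_mul _ := rfl
  mul_one _ := rfl
  inv_mul_cancel g := Diffeomorph.self_trans_symm g

variable {I M}

theorem Diff.mul_apply (g h : Diff I M) (x : M) : (g * h) x = g (h x) := rfl

theorem Diff.one_apply (x : M) : (1 : Diff I M) x = x := rfl

/-- The `k`-th derivative of a smooth real function on a closed half-space, as a continuous map. -/
def jet (d k : ℕ)
    (h : C^∞⟮𝓡∂ (d + 1), EuclideanHalfSpace (d + 1); 𝓘(ℝ, ℝ), ℝ⟯) :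
    C(EuclideanHalfSpace (d + 1), EuclideanSpace ℝ (Fin (d + 1)) [×k]→L[ℝ] ℝ) where
  toFun x := iteratedFDerivWithin ℝ k (h ∘ (𝓡∂ (d + 1)).symm) (Set.range (𝓡∂ (d + 1)))
    ((𝓡∂ (d + 1)) x)
  continuous_toFun := by
    have h1 : ContMDiffOn 𝓘(ℝ, EuclideanSpace ℝ (Fin (d + 1))) 𝓘(ℝ, ℝ) ∞
        (h ∘ (𝓡∂ (d + 1)).symm) (Set.range (𝓡∂ (d + 1))) :=
      h.contMDiff.comp_contMDiffOn (ModelWithCorners.contMDiffOn_symm (𝓡∂ (d + 1)))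
    have h2 := (contMDiffOn_iff_contDiffOn.1 h1).continuousOn_iteratedFDerivWithin
      (m := k) (by exact_mod_cast le_top) (ModelWithCorners.uniqueDiffOn _)
    exact h2.comp_continuous (ModelWithCorners.continuous _) fun x => Set.mem_range_self x

/-- The `C^∞` topology on `Diff(M)` (`M` compact), i.e. the topology of uniform convergence of all
derivatives on compact sets: `g` varies continuously if and only if, for every smooth real
function `f` on `M` and every smooth map `c` from a closed half-space of any positive dimension
to `M`, every derivative of `f ∘ g ∘ c` varies continuously, uniformly on compact sets. (Local
coordinates on the target extend to such functions `f`, and local parametrizations of the source,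
also around boundary points, extend to such maps `c`.) -/
instance instTopologicalSpaceDiff : TopologicalSpace (Diff I M) :=
  ⨅ (d : ℕ) (k : ℕ) (f : C^∞⟮I, M; 𝓘(ℝ, ℝ), ℝ⟯)
    (c : C^∞⟮𝓡∂ (d + 1), EuclideanHalfSpace (d + 1); I, M⟯),
    TopologicalSpace.induced
      (fun g : Diff I M => jet d k (f.comp ((g.toContMDiffMap).comp c))) inferInstance

theorem continuous_jet_comp (d k : ℕ) (f : C^∞⟮I, M; 𝓘(ℝ, ℝ), ℝ⟯)
    (c : C^∞⟮𝓡∂ (d + 1), EuclideanHalfSpace (d + 1); I, M⟯) :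
    Continuous (fun g : Diff I M => jet d k (f.comp ((g.toContMDiffMap).comp c))) := by
  rw [continuous_iff_le_induced]
  exact (iInf_le _ d).trans ((iInf_le _ k).trans ((iInf_le _ f).trans (iInf_le _ c)))

theorem continuous_diff_iff {X : Type*} [TopologicalSpace X] {F : X → Diff I M} :
    Continuous F ↔ ∀ (d k : ℕ) (f : C^∞⟮I, M; 𝓘(ℝ, ℝ), ℝ⟯)
      (c : C^∞⟮𝓡∂ (d + 1), EuclideanHalfSpace (d + 1); I, M⟯),
      Continuous (fun x => jet d k (f.comp (((F x).toContMDiffMap).comp c))) := by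
  refine ⟨fun hF d k f c => (continuous_jet_comp d k f c).comp hF, fun hF => ?_⟩
  simp only [continuous_iInf_rng, continuous_induced_rng]
  exact hF

theorem continuous_mul_right_diff (h : Diff I M) : Continuous fun g : Diff I M => g * h :=
  continuous_diff_iff.2 fun d k f c =>
    continuous_jet_comp d k f ((h.toContMDiffMap).comp c)

/-- The identity component of a group `S` of diffeomorphisms: the connected component of the
identity in `S`, for the `C^∞` topology. -/
def identityComponent (S : Subgroup (Diff I M)) : Subgroup (Diff I M) where
  carrier := connectedComponentIn (S : Set (Diff I M)) 1
  one_mem' := mem_connectedComponentIn S.one_mem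
  mul_mem' := by
    intro a b ha hb
    have hbS : b ∈ S := connectedComponentIn_subset _ _ hb
    have hpre : IsPreconnected ((fun g : Diff I M => g * b) '' connectedComponentIn (S : Set _) 1) :=
      isPreconnected_connectedComponentIn.image _ (continuous_mul_right_diff b).continuousOn
    have hsub : (fun g : Diff I M => g * b) '' connectedComponentIn (S : Set _) 1 ⊆ S := by
      rintro _ ⟨g, hg, rfl⟩
      exact S.mul_mem (connectedComponentIn_subset _ _ hg) hbS
    have := hpre.subset_connectedComponentIn
      (⟨1, mem_connectedComponentIn S.one_mem, one_mul b⟩) hsub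
    rw [connectedComponentIn_eq hb]
    exact this ⟨a, ha, rfl⟩
  inv_mem' := by
    intro a ha
    have haS : a ∈ S := connectedComponentIn_subset _ _ ha
    have hpre : IsPreconnected
        ((fun g : Diff I M => g * a⁻¹) '' connectedComponentIn (S : Set _) 1) :=
      isPreconnected_connectedComponentIn.image _ (continuous_mul_right_diff a⁻¹).continuousOn
    have hsub : (fun g : Diff I M => g * a⁻¹) '' connectedComponentIn (S : Set _) 1 ⊆ S := by
      rintro _ ⟨g, hg, rfl⟩
      exact S.mul_mem (connectedComponentIn_subset _ _ hg) (S.inv_mem haS)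
    have := hpre.subset_connectedComponentIn ⟨a, ha, mul_inv_cancel a⟩ hsub
    exact this ⟨1, mem_connectedComponentIn S.one_mem, one_mul _⟩

theorem identityComponent_le (S : Subgroup (Diff I M)) : identityComponent S ≤ S :=
  connectedComponentIn_subset _ _

/-- The group of diffeomorphisms that fix every boundary point. -/
def fixBoundary : Subgroup (Diff I M) where
  carrier := {g | ∀ x ∈ I.boundary M, g x = x}
  one_mem' _ _ := rfl
  mul_mem' := by
    intro a b ha hb x hx
    rw [Diff.mul_apply, hb x hx, ha x hx]
  inv_mem' := by
    intro a ha x hx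
    conv_lhs => rw [← ha x hx]
    exact a.symm_apply_apply x

variable (I M) in
/-- `Diff₀(M)`, the identity component of the group of all diffeomorphisms. -/
def DiffZero : Subgroup (Diff I M) := identityComponent ⊤

end Diffeomorphisms

/-! ## Restriction to the boundary -/

section Boundary

variable {E H M : Type*} [NormedAddCommGroup E] [NormedSpace ℝ E] [TopologicalSpace H]
  {I : ModelWithCorners ℝ E H} [TopologicalSpace M] [ChartedSpace H M]
  {E' H' B : Type*} [NormedAddCommGroup E'] [NormedSpace ℝ E'] [TopologicalSpace H']
  {J : ModelWithCorners ℝ E' H'} [TopologicalSpace B] [ChartedSpace H' B]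

variable (I J) in
/-- `i : B → M` identifies the manifold `B` with the boundary of `M`: it is a smooth embedding whose
image is `∂M`. -/
structure IsBoundaryInclusion (i : B → M) : Prop where
  isSmoothEmbedding : Manifold.IsSmoothEmbedding J I ∞ i
  range_eq : Set.range i = I.boundary M

variable {i : B → M}

theorem IsBoundaryInclusion.exists_restrict [IsManifold I ∞ M] (hi : IsBoundaryInclusion I J i)
    (g : Diff I M) (b : B) : ∃ b' : B, i b' = g (i b) := by
  have h1 : i b ∈ I.boundary M := hi.range_eq ▸ Set.mem_range_self b
  have h2 : g (i b) ∈ I.boundary M := by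
    rw [← Diffeomorph.image_boundary (n := ∞) (by simp) g]
    exact Set.mem_image_of_mem _ h1
  rwa [← hi.range_eq] at h2

theorem IsBoundaryInclusion.contMDiff_of_comp (hi : IsBoundaryInclusion I J i) {f : B → B}
    (hf : ContMDiff J I ∞ (i ∘ f)) : ContMDiff J J ∞ f :=
  (ContMDiff.iff_comp_isImmersion hi.isSmoothEmbedding.isImmersion).2
    ⟨hi.isSmoothEmbedding.isEmbedding.continuous_iff.2 hf.continuous, hf⟩

theorem IsBoundaryInclusion.injective (hi : IsBoundaryInclusion I J i) : Function.Injective i :=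
  hi.isSmoothEmbedding.isEmbedding.injective

variable [IsManifold I ∞ M]

/-- The boundary restriction `g|_{∂M}` as a map. -/
def IsBoundaryInclusion.restrictFun (hi : IsBoundaryInclusion I J i) (g : Diff I M) (b : B) : B :=
  (hi.exists_restrict g b).choose

theorem IsBoundaryInclusion.incl_restrictFun (hi : IsBoundaryInclusion I J i) (g : Diff I M)
    (b : B) : i (hi.restrictFun g b) = g (i b) :=
  (hi.exists_restrict g b).choose_spec

/-- The homomorphism `Diff(M) → Diff(∂M)`, `g ↦ g|_{∂M}`; it is characterized by
`i (hi.restrict g b) = g (i b)`. -/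
def IsBoundaryInclusion.restrict (hi : IsBoundaryInclusion I J i) : Diff I M →* Diff J B where
  toFun g :=
    { toFun := hi.restrictFun g
      invFun := hi.restrictFun g.symm
      left_inv := fun b => hi.injective (by
        rw [hi.incl_restrictFun, hi.incl_restrictFun, Diffeomorph.symm_apply_apply])
      right_inv := fun b => hi.injective (by
        rw [hi.incl_restrictFun, hi.incl_restrictFun, Diffeomorph.apply_symm_apply])
      contMDiff_toFun := hi.contMDiff_of_comp (by
        have : i ∘ hi.restrictFun g = g ∘ i := funext fun b => hi.incl_restrictFun g b
        change ContMDiff J I ∞ (i ∘ hi.restrictFun g)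
        rw [this]
        exact g.contMDiff.comp hi.isSmoothEmbedding.contMDiff)
      contMDiff_invFun := hi.contMDiff_of_comp (by
        have : i ∘ hi.restrictFun g.symm = g.symm ∘ i :=
          funext fun b => hi.incl_restrictFun g.symm b
        change ContMDiff J I ∞ (i ∘ hi.restrictFun g.symm)
        rw [this]
        exact g.symm.contMDiff.comp hi.isSmoothEmbedding.contMDiff) }
  map_one' := Diffeomorph.ext fun b => hi.injective (hi.incl_restrictFun 1 b)
  map_mul' g h := Diffeomorph.ext fun b => hi.injective (by
    change i (hi.restrictFun (g * h) b) = i (hi.restrictFun g (hi.restrictFun h b))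
    rw [hi.incl_restrictFun, hi.incl_restrictFun, hi.incl_restrictFun, Diff.mul_apply])

theorem IsBoundaryInclusion.incl_restrict (hi : IsBoundaryInclusion I J i) (g : Diff I M) (b : B) :
    i (hi.restrict g b) = g (i b) :=
  hi.incl_restrictFun g b

/-- Smooth functions on the boundary extend to smooth functions on `M`. -/
theorem IsBoundaryInclusion.exists_extension [FiniteDimensional ℝ E] [T2Space M]
    [SigmaCompactSpace M] [J.Boundaryless] (hi : IsBoundaryInclusion I J i)
    (f : C^∞⟮J, B; 𝓘(ℝ, ℝ), ℝ⟯) :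
    ∃ F : C^∞⟮I, M; 𝓘(ℝ, ℝ), ℝ⟯, ∀ b, F (i b) = f b := by
  suffices h : ∃ F : C^∞⟮I, M; 𝓘(ℝ, ℝ), ℝ⟯, ∀ x, F x ∈ {y : ℝ | ∀ b, i b = x → y = f b} by
    obtain ⟨F, hF⟩ := h
    exact ⟨F, fun b => hF (i b) b rfl⟩
  refine exists_contMDiffMap_forall_mem_convex_of_local I ?_ ?_
  · intro x y hy z hz a b _ _ hab c hc
    rw [hy c hc, hz c hc, ← add_smul, hab, one_smul]
  · intro x
    by_cases hx : x ∈ I.boundary M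
    · rw [← hi.range_eq] at hx
      obtain ⟨b, rfl⟩ := hx
      have him := hi.isSmoothEmbedding.isImmersion.isImmersionAt b
      obtain ⟨V, hV, hVi⟩ := hi.isSmoothEmbedding.isEmbedding.isInducing.isOpen_iff.1
        him.domChart.open_source
      have hbV : i b ∈ V := by
        have : b ∈ i ⁻¹' V := hVi ▸ him.mem_domChart_source
        exact this
      set ρ : M → E' := fun y => (him.equiv.symm (him.codChart.extend I y)).1 with hρ
      have hρs : ContMDiffOn I 𝓘(ℝ, E') ∞ ρ him.codChart.source := by
        have h1 := him.codChart.contMDiffOn_extend him.codChart_mem_maximalAtlas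
        have h2 : ContMDiff 𝓘(ℝ, E) 𝓘(ℝ, E') ∞ (fun v : E => (him.equiv.symm v).1) :=
          ContDiff.contMDiff (by fun_prop)
        exact h2.comp_contMDiffOn h1
      have hρi : ∀ b' ∈ him.domChart.source, ρ (i b') = him.domChart.extend J b' := by
        intro b' hb'
        have h3 := him.writtenInCharts ((him.domChart.extend J).map_source
          (by rwa [him.domChart.extend_source]))
        simp only [Function.comp_apply] at h3
        rw [him.domChart.extend_left_inv hb'] at h3
        rw [hρ]
        simp only
        rw [h3, ContinuousLinearEquiv.symm_apply_apply]
      have htgt : IsOpen (him.domChart.extend J).target := him.domChart.isOpen_extend_target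
      have hU : IsOpen (him.codChart.source ∩ ρ ⁻¹' (him.domChart.extend J).target) :=
        hρs.continuousOn.isOpen_inter_preimage him.codChart.open_source htgt
      refine ⟨(him.codChart.source ∩ ρ ⁻¹' (him.domChart.extend J).target) ∩ V,
        (hU.inter hV).mem_nhds ⟨⟨him.mem_codChart_source, ?_⟩, hbV⟩,
        fun y => f ((him.domChart.extend J).symm (ρ y)), ?_, ?_⟩
      · rw [Set.mem_preimage, hρi b him.mem_domChart_source]
        exact (him.domChart.extend J).map_source
          (by rw [him.domChart.extend_source]; exact him.mem_domChart_source)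
      · have h4 := contMDiffOn_extend_symm him.domChart_mem_maximalAtlas
        refine f.contMDiff.comp_contMDiffOn (h4.comp (hρs.mono fun y hy => hy.1.1) ?_)
        rintro y ⟨⟨_, hy⟩, _⟩
        rw [← him.domChart.extend_target']
        exact hy
      · rintro _ ⟨_, hy⟩ b' rfl
        have hb' : b' ∈ him.domChart.source := by rw [← hVi]; exact hy
        simp only
        rw [hρi b' hb', him.domChart.extend_left_inv hb']
    · refine ⟨(I.boundary M)ᶜ, (I.isClosed_boundary (n := ∞) (by simp)).isOpen_compl.mem_nhds hx,
        fun _ => 0, contMDiffOn_const, ?_⟩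
      rintro _ hy b rfl
      exact absurd (hi.range_eq ▸ Set.mem_range_self b) hy

theorem IsBoundaryInclusion.continuous_restrict [FiniteDimensional ℝ E] [T2Space M]
    [SigmaCompactSpace M] [J.Boundaryless] (hi : IsBoundaryInclusion I J i) : Continuous hi.restrict := by
  refine continuous_diff_iff.2 fun d k f c => ?_
  obtain ⟨F, hF⟩ := hi.exists_extension f
  have := continuous_jet_comp d k F
    (ContMDiffMap.comp (⟨i, hi.isSmoothEmbedding.contMDiff⟩ : C^∞⟮J, B; I, M⟯) c)
  convert! this using 3 with g
  ext x
  change f (hi.restrict g (c x)) = F (g (i (c x)))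
  rw [← hi.incl_restrict, hF]

/-- The boundary restriction of the identity component of any group `S` of diffeomorphisms of `M`
is contained in `Diff₀(∂M)`, and so defines a homomorphism `r` to `Diff₀(∂M)`. -/
def IsBoundaryInclusion.restrictZero [FiniteDimensional ℝ E] [T2Space M]
    [SigmaCompactSpace M] [J.Boundaryless] (hi : IsBoundaryInclusion I J i) (S : Subgroup (Diff I M)) :
    identityComponent S →* DiffZero J B :=
  (hi.restrict.comp (identityComponent S).subtype).codRestrict (DiffZero J B) (by
    rintro ⟨g, hg⟩
    have hpre : IsPreconnected (hi.restrict '' connectedComponentIn (S : Set _) 1) :=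
      isPreconnected_connectedComponentIn.image _ hi.continuous_restrict.continuousOn
    exact hpre.subset_connectedComponentIn (F := ((⊤ : Subgroup (Diff J B)) : Set (Diff J B)))
      ⟨1, mem_connectedComponentIn S.one_mem, map_one _⟩ (fun _ _ => trivial) ⟨g, hg, rfl⟩)

end Boundary

/-! ## Differential forms on manifolds with boundary -/

section Forms

variable {E H : Type*} [NormedAddCommGroup E] [NormedSpace ℝ E] [TopologicalSpace H]
  (I : ModelWithCorners ℝ E H) (M : Type*) [TopologicalSpace M] [ChartedSpace H M]
  {E' H' : Type*} [NormedAddCommGroup E'] [NormedSpace ℝ E'] [TopologicalSpace H']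
  {J : ModelWithCorners ℝ E' H'} {B : Type*} [TopologicalSpace B] [ChartedSpace H' B]

/-- A (not necessarily smooth) differential `l`-form on `M`. -/
abbrev Form (l : ℕ) : Type _ := ∀ x : M, TangentSpace I x [⋀^Fin l]→L[ℝ] ℝ

variable {I M} {l : ℕ}

/-- The pullback `f^* α` of a form along a (smooth) map. -/
def Form.pullback (J : ModelWithCorners ℝ E' H') (f : B → M) (α : Form I M l) : Form J B l :=
  fun x => (α (f x)).compContinuousLinearMap (mfderiv J I f x)

/-- The coordinate expression of a form in the preferred chart at `x₀`: its pullback by the inverse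
of the chart. It is meaningful on the target of the (extended) chart. -/
def Form.inChart (α : Form I M l) (x₀ : M) : E → E [⋀^Fin l]→L[ℝ] ℝ :=
  fun y => (α ((extChartAt I x₀).symm y)).compContinuousLinearMap
    ((mfderivWithin (modelWithCornersSelf ℝ E) I (extChartAt I x₀).symm (Set.range I) y).comp
      ((NormedSpace.fromTangentSpace (𝕜 := ℝ) y).symm : E →L[ℝ] _))

/-- Smooth forms: all coordinate expressions are smooth (up to the boundary). -/
def Form.IsSmooth (α : Form I M l) : Prop :=
  ∀ x₀ : M, ContDiffOn ℝ ∞ (α.inChart x₀) (extChartAt I x₀).target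

/-- The exterior derivative, computed at `x` in the preferred chart at `x`. -/
def Form.extD (α : Form I M l) : Form I M (l + 1) :=
  fun x => (extDerivWithin (α.inChart x) (Set.range I) (extChartAt I x x)).compContinuousLinearMap
    ((NormedSpace.fromTangentSpace (𝕜 := ℝ) (extChartAt I x x) : _ →L[ℝ] E).comp
      (mfderiv I (modelWithCornersSelf ℝ E) (extChartAt I x) x))

/-- The function `M → ℝ` given by a `0`-form. -/
def Form.toFun (f : Form I M 0) (x : M) : ℝ := f x ![]

/-- The wedge product `f ∧ α` of a `0`-form and an `l`-form. -/
def Form.zeroWedge (f : Form I M 0) (α : Form I M l) : Form I M l := fun x => f.toFun x • α x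

/-- The constant function `a`, as a `0`-form. -/
def Form.const (a : ℝ) : Form I M 0 := fun _ => ContinuousAlternatingMap.constOfIsEmpty ℝ _ (Fin 0) a

/-- `α ∈ Ω^l(M, ∂M)`: `α` is smooth and its pullback under the boundary inclusion `i : B → M` is
zero. -/
def Form.IsRelative (J : ModelWithCorners ℝ E' H') (i : B → M) (α : Form I M l) : Prop :=
  α.IsSmooth ∧ α.pullback J i = 0

variable (I J) in
/-- `H^l(M, ∂M) = 0`, for the cohomology of the complex `Ω^*(M, ∂M)`: every closed relative form is
the exterior derivative of a relative form (and is zero if `l = 0`). -/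
def RelCohomologyVanishes (i : B → M) : ℕ → Prop
  | 0 => ∀ α : Form I M 0, α.IsRelative J i → α.extD = 0 → α = 0
  | l + 1 => ∀ α : Form I M (l + 1), α.IsRelative J i → α.extD = 0 →
      ∃ β : Form I M l, β.IsRelative J i ∧ β.extD = α

theorem Form.pullback_comp_diff (g h : Diff I M) (α : Form I M l) :
    α.pullback I (g * h : Diff I M) = (α.pullback I g).pullback I h := by
  funext x
  have hg : MDifferentiableAt I I g (h x) := g.mdifferentiable (by simp) _
  have hh : MDifferentiableAt I I h x := h.mdifferentiable (by simp) _
  have hc : mfderiv I I (g * h : Diff I M) x = (mfderiv I I g (h x)).comp (mfderiv I I h x) :=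
    mfderiv_comp x hg hh
  ext v
  simp only [Form.pullback, hc]
  rfl

theorem Form.pullback_one_diff (α : Form I M l) : α.pullback I (1 : Diff I M) = α := by
  funext x
  have hc : mfderiv I I (1 : Diff I M) x = ContinuousLinearMap.id ℝ (TangentSpace I x) :=
    mfderiv_id
  ext v
  simp only [Form.pullback, hc]
  rfl

/-- The group `Diff_w(M)` of all diffeomorphisms that preserve the form `w`. -/
def DiffPreserving (w : Form I M l) : Subgroup (Diff I M) where
  carrier := {g | w.pullback I g = w}
  one_mem' := Form.pullback_one_diff w
  mul_mem' := by
    intro a b ha hb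
    change w.pullback I (a * b : Diff I M) = w
    rw [Form.pullback_comp_diff, show w.pullback I a = w from ha, show w.pullback I b = w from hb]
  inv_mem' := by
    intro a ha
    change w.pullback I (a⁻¹ : Diff I M) = w
    conv_lhs => rw [← show w.pullback I a = w from ha]
    rw [← Form.pullback_comp_diff, mul_inv_cancel, Form.pullback_one_diff]

/-- `Diff_{w,0}(M)`: the identity component of `Diff_w(M)`. -/
def DiffVol (w : Form I M l) : Subgroup (Diff I M) := identityComponent (DiffPreserving w)

/-- `Diff_{w,0}(M, ∂M)`: the identity component of the subgroup of those elements of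
`Diff_{w,0}(M)` that fix the boundary pointwise. -/
def DiffVolRel (w : Form I M l) : Subgroup (Diff I M) :=
  identityComponent (DiffVol w ⊓ fixBoundary)

theorem diffVolRel_le (w : Form I M l) : DiffVolRel w ≤ DiffVol w :=
  (identityComponent_le _).trans inf_le_left

/-- The inclusion `j : Diff_{w,0}(M, ∂M) → Diff_{w,0}(M)`. -/
def diffVolIncl (w : Form I M l) : DiffVolRel w →* DiffVol w :=
  Subgroup.inclusion (diffVolRel_le w)

/-- The boundary restriction `r : Diff_{w,0}(M) → Diff₀(∂M)`, `g ↦ g|_{∂M}`. -/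
def IsBoundaryInclusion.volRestrict [J.Boundaryless] [IsManifold I ∞ M] [FiniteDimensional ℝ E]
    [T2Space M] [SigmaCompactSpace M] {i : B → M} (hi : IsBoundaryInclusion I J i)
    (w : Form I M l) : DiffVol w →* DiffZero J B :=
  hi.restrictZero (DiffPreserving w)

end Forms

/-! ## Volume forms and integration -/

section Integration

variable {n : ℕ} {H : Type*} [TopologicalSpace H]
  {I : ModelWithCorners ℝ (EuclideanSpace ℝ (Fin n)) H}
  {M : Type*} [TopologicalSpace M] [ChartedSpace H M]

/-- A volume form: a smooth, nowhere vanishing form of top degree. -/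
structure IsVolumeForm (w : Form I M n) : Prop where
  isSmooth : w.IsSmooth
  ne_zero : ∀ x, w x ≠ 0

/-- The value of a top degree form at `x` on the coordinate frame of the preferred chart at `x`. -/
def Form.coeff (α : Form I M n) (x : M) : ℝ :=
  α.inChart x (extChartAt I x x) (fun k => EuclideanSpace.single k 1)

variable [MeasurableSpace M]

/-- The measure `|w|` on the domain of the preferred chart at `x₀`: in coordinates, it is
`|w(∂₁, …, ∂ₙ)|` times Lebesgue measure. -/
def chartMeasure (w : Form I M n) (x₀ : M) : MeasureTheory.Measure M :=
  (((MeasureTheory.volume : MeasureTheory.Measure (EuclideanSpace ℝ (Fin n))).restrict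
    (extChartAt I x₀).target).withDensity
      (fun y => ENNReal.ofReal |w.inChart x₀ y (fun k => EuclideanSpace.single k 1)|)).map
        (extChartAt I x₀).symm

/-- The measure `|w|` on `M`: the smallest measure that dominates its restrictions to the chart
domains. -/
def volumeMeasure (w : Form I M n) : MeasureTheory.Measure M := ⨆ x₀ : M, chartMeasure w x₀

/-- The integral `∫_M α` of an `n`-form over `M`, where `M` carries the orientation defined by the
volume form `w`: writing `α = f w`, it is the integral of the function `f` with respect to `|w|`. -/
def formIntegral (w α : Form I M n) : ℝ :=
  ∫ x, α.coeff x / w.coeff x ∂(volumeMeasure w)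

/-- `vol(M) = ∫_M w`. -/
def vol (w : Form I M n) : ℝ := formIntegral w w

end Integration

/-! ## Group cochains -/

section GroupCochains

/-- The simplicial coboundary `δ = ∑ (-1)^i ε_i^*` on cochains of a group `G` with values in a
module `V` on which the elements of `G` act (from the right) by `act`:
`δc(g₁, …, g_{k+1}) = c(g₂, …, g_{k+1}) + ∑_{i=1}^{k} (-1)^i c(g₁, …, g_i g_{i+1}, …, g_{k+1})
+ (-1)^{k+1} c(g₁, …, g_k)^{g_{k+1}}`. -/
def coboundary {G V : Type*} [Mul G] [AddCommGroup V] [Module ℝ V] (act : G → V → V) {k : ℕ}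
    (c : (Fin k → G) → V) : (Fin (k + 1) → G) → V := fun g =>
  c (fun a => g a.succ)
    + ∑ a : Fin k, (-1 : ℝ) ^ ((a : ℕ) + 1) • c (Fin.contractNth a.castSucc (· * ·) g)
    + (-1 : ℝ) ^ (k + 1) • act (g (Fin.last k)) (c (fun a => g a.castSucc))

variable (G : Type*) [Group G]

/-- Real `k`-cochains on the simplicial set `BG^δ_•`, i.e. `𝒜^{k,0}(BG^δ_•)`; since `BG^δ_•` is
zero-dimensional, these form the whole total complex. -/
abbrev Cochain (k : ℕ) : Type _ := (Fin k → G) → ℝ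

/-- The coboundary of real cochains. -/
def Cochain.d (k : ℕ) : Cochain G k →ₗ[ℝ] Cochain G (k + 1) where
  toFun c := coboundary (fun _ a => a) c
  map_add' c c' := by
    funext g
    simp only [coboundary, Pi.add_apply, smul_add, Finset.sum_add_distrib]
    ring
  map_smul' a c := by
    funext g
    simp only [coboundary, Pi.smul_apply, smul_eq_mul, RingHom.id_apply, Finset.mul_sum, mul_add]
    congr 1
    · congr 1
      exact Finset.sum_congr rfl fun _ _ => by ring
    · ring

/-- Real `k`-cocycles. -/
def cocycles (k : ℕ) : Submodule ℝ (Cochain G k) := LinearMap.ker (Cochain.d G k)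

/-- Real `k`-coboundaries. -/
def coboundaries : (k : ℕ) → Submodule ℝ (Cochain G k)
  | 0 => ⊥
  | k + 1 => LinearMap.range (Cochain.d G k)

/-- The real cohomology `H^k(BG^δ)`. -/
abbrev Cohomology (k : ℕ) : Type _ :=
  cocycles G k ⧸ (coboundaries G k).submoduleOf (cocycles G k)

variable {G}

/-- The cohomology class of a cocycle. -/
def Cohomology.mk {k : ℕ} (z : cocycles G k) : Cohomology G k := Submodule.Quotient.mk z

/-- The cochain `z` is a cocycle and its class is `x`. -/
def Represents {k : ℕ} (z : Cochain G k) (x : Cohomology G k) : Prop :=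
  ∃ hz : z ∈ cocycles G k, Cohomology.mk ⟨z, hz⟩ = x

/-- Pullback of cochains under a group homomorphism. -/
def Cochain.comap {G' : Type*} [Group G'] (ρ : G' →* G) {k : ℕ} (c : Cochain G k) :
    Cochain G' k := fun g => c (fun a => ρ (g a))

/-- For homomorphisms `j : K → G` and `r : G → Q` that induce a fibration
`BK^δ → BG^δ → BQ^δ`, the class `x ∈ H^k(BK^δ)` transgresses to `y ∈ H^{k+1}(BQ^δ)`: there are a
cochain `u` on `BG^δ` and a cocycle `v` representing `y` with `du = r^* v` and `[j^* u] = x`. -/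
def Transgresses {K Q : Type*} [Group K] [Group Q] (j : K →* G) (r : G →* Q) {k : ℕ}
    (x : Cohomology K k) (y : Cohomology Q (k + 1)) : Prop :=
  ∃ (u : Cochain G k) (v : Cochain Q (k + 1)),
    Represents v y ∧ Cochain.d G k u = v.comap r ∧ Represents (u.comap j) x

end GroupCochains

/-! ## The double complex `𝒜^{k,l}(MG^δ_•)` -/

section DoubleComplex

variable {E H : Type*} [NormedAddCommGroup E] [NormedSpace ℝ E] [TopologicalSpace H]
  {I : ModelWithCorners ℝ E H} {M : Type*} [TopologicalSpace M] [ChartedSpace H M]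

/-- `𝒜^{k,l}(MG^δ_•)`: maps from `G^k` to `l`-forms on `M` (smoothness of the values is the
predicate `TotalCochain.HasDegree` below). -/
abbrev FormCochain (G : Subgroup (Diff I M)) (k l : ℕ) : Type _ := (Fin k → G) → Form I M l

variable {G : Subgroup (Diff I M)}

/-- `δ : 𝒜^{k,l} → 𝒜^{k+1,l}`, where `G` acts on forms by pullback. -/
def FormCochain.delta {k l : ℕ} (c : FormCochain G k l) : FormCochain G (k + 1) l :=
  coboundary (fun (g : G) (α : Form I M l) => α.pullback I (g : Diff I M)) c

/-- `d'' : 𝒜^{k,l} → 𝒜^{k,l+1}`, which is `(-1)^k` times the exterior derivative. -/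
def FormCochain.dd {k l : ℕ} (c : FormCochain G k l) : FormCochain G k (l + 1) :=
  fun g => (-1 : ℝ) ^ k • (c g).extD

/-- The pullback to `𝒜^{k,0}(MG^δ_•)` of a real cochain on `BG^δ_•`: its values are regarded as
constant functions on `M`. -/
def FormCochain.ofReal {k : ℕ} (c : Cochain G k) : FormCochain G k 0 := fun g => Form.const (c g)

/-- The wedge product of elements of `𝒜^{k,0}` and `𝒜^{0,l}`. -/
def FormCochain.zeroWedge {k l : ℕ} (c : FormCochain G k 0) (c' : FormCochain G 0 l) :
    FormCochain G k l := fun g => (c g).zeroWedge (c' ![])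

variable (G) in
/-- Families with a component in each `𝒜^{k,l}`; the component of `a` in bidegree `(k, l)` is
`a (k, l)`. -/
abbrev TotalCochain : Type _ := ∀ p : ℕ × ℕ, FormCochain G p.1 p.2

/-- `a` belongs to the degree `m` part `𝒜^m(MG^δ_•) = ⨁_{k+l=m} 𝒜^{k,l}(MG^δ_•)` of the total
complex: its components are smooth, and vanish outside of total degree `m`. -/
structure TotalCochain.HasDegree (a : TotalCochain G) (m : ℕ) : Prop where
  isSmooth : ∀ p g, (a p g).IsSmooth
  eq_zero : ∀ p : ℕ × ℕ, p.1 + p.2 ≠ m → a p = 0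

/-- The component of `δ a` in bidegree `(k, l)`. -/
def TotalCochain.deltaPart (a : TotalCochain G) : (k l : ℕ) → FormCochain G k l
  | 0, _ => 0
  | k + 1, l => (a (k, l)).delta

/-- The component of `d'' a` in bidegree `(k, l)`. -/
def TotalCochain.ddPart (a : TotalCochain G) : (k l : ℕ) → FormCochain G k l
  | _, 0 => 0
  | k, l + 1 => (a (k, l)).dd

/-- The total differential `d = δ + d''`. -/
def TotalCochain.d (a : TotalCochain G) : TotalCochain G :=
  fun p => a.deltaPart p.1 p.2 + a.ddPart p.1 p.2

/-- An element of `𝒜^{k,l}` as an element of the total complex. -/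
def FormCochain.toTotal {k l : ℕ} (c : FormCochain G k l) : TotalCochain G :=
  Pi.single (M := fun p : ℕ × ℕ => FormCochain G p.1 p.2) (k, l) c

variable (G) in
/-- The element of `𝒜^{0,l}(MG^δ_•)` corresponding to an `l`-form on `M`. -/
def FormCochain.ofForm {l : ℕ} (α : Form I M l) : FormCochain G 0 l := fun _ => α

end DoubleComplex

/-! ## The class `c(M)` and the cochains on the full group -/

section Classes

variable {m : ℕ} {M : Type*} [TopologicalSpace M] [ChartedSpace (EuclideanHalfSpace (m + 1)) M]
  {E' H' : Type*} [NormedAddCommGroup E'] [NormedSpace ℝ E'] [TopologicalSpace H']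
  (J : ModelWithCorners ℝ E' H') {B : Type*} [TopologicalSpace B] [ChartedSpace H' B]
  (i : B → M) (w : Form (𝓡∂ (m + 1)) M (m + 1))

section

variable {G : Subgroup (Diff (𝓡∂ (m + 1)) M)} [MeasurableSpace M]

/-- Integration along the fiber `M`, `∫_M : 𝒜^{k,n}(MG^δ_•) → 𝒜^{k,0}(BG^δ_•)`, with respect to the
orientation given by `w`. -/
def fiberIntegral {k : ℕ} (c : FormCochain G k (m + 1)) : Cochain G k :=
  fun g => formIntegral w (c g)

/-- `∫_M φ^{(0)} ∧ w^{(n)}`, for `φ` of total degree `n - 1 = m`. -/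
def secondaryCochain (φ : TotalCochain G) : Cochain G m :=
  fiberIntegral w ((φ (m, 0)).zeroWedge (FormCochain.ofForm G w))

end

/-- The elements `φ = φ^{(0)} + ⋯ + φ^{(n-1)}` of `𝒜^{n-1}(M Diff_{w,0}(M,∂M)^δ_•)` from which `c(M)`
is defined: `dφ = w^{(n)}`, and `φ^{(l)}` takes values in `Ω^l(M, ∂M)` for `l ≤ n - 2`.
Here `n = m + 1`, and `φ^{(l)} = φ (m - l, l)`. -/
structure IsRelPrimitive (φ : TotalCochain (DiffVolRel w)) : Prop where
  hasDegree : φ.HasDegree m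
  d_eq : φ.d = (FormCochain.ofForm (DiffVolRel w) w).toTotal
  isRelative : ∀ k l : ℕ, k + l = m → l < m → ∀ g, (φ (k, l) g).IsRelative J i

open Classical in
/-- The class `c(M) ∈ H^{n-1}(B Diff_{w,0}(M,∂M)^δ)`: the class of `∫_M φ^{(0)} ∧ w^{(n)}`, for any
choice of `φ`. -/
def secondaryClass [MeasurableSpace M] : Cohomology (DiffVolRel w) m :=
  if h : ∃ (x : Cohomology (DiffVolRel w) m) (φ : TotalCochain (DiffVolRel w)),
      IsRelPrimitive J i w φ ∧ Represents (secondaryCochain w φ) x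
  then h.choose else 0

/-- The conditions on `φ = φ^{(0)} + ⋯ + φ^{(n-1)}` in `𝒜^{n-1}(M Diff_{w,0}(M)^δ_•)`, with
`n = m + 1` and `φ^{(l)} = φ (m - l, l)`: one has `dφ = w^{(n)} + δφ^{(0)}`; for `l < n - 1`, the
form `φ^{(l)}(g₁, …)` belongs to `Ω^l(M, ∂M)` if all `g_a` are in `Diff_{w,0}(M, ∂M)`; and for
`l < n - 1`, the pullback of `φ^{(l)}(g₁, …)` to `∂M` depends only on the restrictions of the `g_a`
to `∂M`. -/
structure IsAdaptedPrimitive (φ : TotalCochain (DiffVol w)) : Prop where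
  hasDegree : φ.HasDegree m
  d_eq : φ.d = (FormCochain.ofForm (DiffVol w) w).toTotal + (φ (m, 0)).delta.toTotal
  isRelative : ∀ k l : ℕ, k + l = m → l < m → ∀ g : Fin k → DiffVolRel w,
    (φ (k, l) (fun a => diffVolIncl w (g a))).IsRelative J i
  pullback_eq : ∀ k l : ℕ, k + l = m → l < m → ∀ g h : Fin k → DiffVol w,
    (∀ a, ∀ x ∈ (𝓡∂ (m + 1)).boundary M, (g a : Diff (𝓡∂ (m + 1)) M) x
      = (h a : Diff (𝓡∂ (m + 1)) M) x) →
    (φ (k, l) g).pullback J i = (φ (k, l) h).pullback J i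

end Classes

end

end VolDiff

/-!
Write `n = m + 1`, and write `φ^{(0)} = φ (m, 0)` for the component in form degree zero.

The formula `du = vol(M) · r^*χ` is integration of the hypothesis `δφ^{(0)} = r^*χ` over `M`, which
commutes with `δ` because the group preserves the measure `|w|` (`volumeMeasure_map`,
`d_functionIntegral`). If all group elements fix the boundary, then the constant `r^*χ = δφ^{(0)}`
vanishes because `φ^{(0)}` vanishes on the boundary; so the restriction of `φ` along `j` satisfies
`dφ = w` and is one of the elements from which `c(M)` is defined
(`IsAdaptedPrimitive.isRelPrimitive`).

It remains to see that the class of `∫_M φ^{(0)} ∧ w` does not depend on the choice of `φ`. The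
difference `ψ` of two choices is closed in the double complex. A zigzag through the exact complexes
`Ω^*(M, ∂M)` shows that `ψ^{(0)} = δη` for some cochain `η` of functions (`exists_eq_delta`), and so
the integrals differ by the coboundary of `∫_M η ∧ w`. Only the start of the zigzag needs an
argument: its first term is a closed `m`-form `α` on `M`, which is not required to vanish on the
boundary. If `α|_{∂M} = dβ|_{∂M}` for some form `β` on `M`, then `α - dβ` is relative and hence
exact, and the group acts trivially on `β|_{∂M}`.

That closed `m`-forms are exact on the boundary (`IsVolumeForm.mem_exactOnBoundary`) is proved as
follows. The form `θ` given by the component of `φ` in bidegree `(0, m)` satisfies `dθ = w`. By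
Stokes' theorem for relative forms (`IsVolumeForm.formIntegral_extD_eq_zero`), the functional
`α ↦ ∫_M dα` vanishes on forms that are exact on the boundary, and it is nonzero on `θ`. On the
other hand, the forms that are exact on the boundary have codimension at most one among all smooth
`m`-forms (`IsBoundaryInclusion.exists_generator`), because `∂M` is a connected manifold of dimension
`m`: this follows from the compactly supported Poincaré lemma on `ℝᵐ`
(`exists_eq_mul_prod_add_sum_fderiv`), a partition of unity, and connectedness. So the functional
detects exactness on the boundary, and it vanishes on closed forms.
-/

namespace VolDiff

noncomputable section

/-! ### Smoothness of maps into spaces of alternating forms -/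

section Alternating

variable {E E' X : Type*} [NormedAddCommGroup E] [NormedSpace ℝ E] [FiniteDimensional ℝ E]
  [NormedAddCommGroup E'] [NormedSpace ℝ E']
  [NormedAddCommGroup X] [NormedSpace ℝ X] {l : ℕ} {n : WithTop ℕ∞}

/-- Smoothness of a family of alternating forms on a finite-dimensional space can be tested on
values: the coefficients in a basis embed the space of forms into some `ℝ^N`. -/
theorem contDiffWithinAt_alternating_iff {F : X → E [⋀^Fin l]→L[ℝ] ℝ} {s : Set X} {x : X} :
    ContDiffWithinAt ℝ n F s x ↔ ∀ v, ContDiffWithinAt ℝ n (fun y => F y v) s x := by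
  constructor
  · intro h v
    exact ((ContinuousAlternatingMap.apply ℝ E ℝ v).contDiff).comp_contDiffWithinAt h
  · intro h
    let b := Module.finBasis ℝ E
    let Φ : (E [⋀^Fin l]→L[ℝ] ℝ) →ₗ[ℝ] ((Fin l → Fin (Module.finrank ℝ E)) → ℝ) :=
      { toFun := fun a r => a (fun k => b (r k))
        map_add' := fun _ _ => rfl
        map_smul' := fun _ _ => rfl }
    have hΦ : LinearMap.ker Φ = ⊥ := by
      rw [LinearMap.ker_eq_bot]
      intro a a' h
      apply ContinuousAlternatingMap.toAlternatingMap_injective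
      refine b.ext_alternating fun r _ => ?_
      exact congrFun h r
    obtain ⟨g, hg⟩ := LinearMap.exists_leftInverse_of_injective Φ hΦ
    have h1 : ContDiffWithinAt ℝ n (fun y => Φ (F y)) s x := contDiffWithinAt_pi.2 fun r => h _
    have h2 := (LinearMap.toContinuousLinearMap g).contDiff.comp_contDiffWithinAt h1
    convert h2 using 1
    funext y
    exact (LinearMap.congr_fun hg (F y)).symm

theorem contDiffWithinAt_compContinuousLinearMap [FiniteDimensional ℝ E']
    {F : X → E' [⋀^Fin l]→L[ℝ] ℝ} {A : X → E →L[ℝ] E'} {s : Set X} {x : X}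
    (hF : ContDiffWithinAt ℝ n F s x) (hA : ContDiffWithinAt ℝ n A s x) :
    ContDiffWithinAt ℝ n (fun y => (F y).compContinuousLinearMap (A y)) s x := by
  refine contDiffWithinAt_alternating_iff.2 fun v => ?_
  have h1 : ContDiffWithinAt ℝ n (fun y => (F y).toContinuousMultilinearMap) s x :=
    (ContinuousAlternatingMap.toContinuousMultilinearMapCLM (𝕜 := ℝ) (E := E') (F := ℝ)
      (ι := Fin l) ℝ).contDiff.comp_contDiffWithinAt hF
  have h2 : ContDiffWithinAt ℝ n (fun y =>
      ContinuousMultilinearMap.compContinuousLinearMapContinuousMultilinear ℝ (fun _ : Fin l => E)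
        (fun _ : Fin l => E') ℝ (fun _ => A y)) s x :=
    (ContinuousMultilinearMap.contDiff _).comp_contDiffWithinAt (contDiffWithinAt_pi.2 fun _ => hA)
  have h3 := h2.clm_apply h1
  exact (ContinuousMultilinearMap.apply ℝ (fun _ : Fin l => E) ℝ v).contDiff.comp_contDiffWithinAt h3

end Alternating

theorem two_le_infty : (2 : WithTop ℕ∞) ≤ ∞ :=
  WithTop.coe_le_coe.2 (le_top : (2 : ℕ∞) ≤ ⊤)

/-! ### Forms in charts -/

section Charts

variable {E H : Type*} [NormedAddCommGroup E] [NormedSpace ℝ E] [TopologicalSpace H]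
  {I : ModelWithCorners ℝ E H} {M : Type*} [TopologicalSpace M] [ChartedSpace H M]
  {E' H' : Type*} [NormedAddCommGroup E'] [NormedSpace ℝ E'] [TopologicalSpace H']
  {J : ModelWithCorners ℝ E' H'} {B : Type*} [TopologicalSpace B] [ChartedSpace H' B]
  {l : ℕ}

theorem Form.apply_eq_of_eq (α : Form I M l) {x x' : M} (h : x = x') (v : Fin l → E) :
    (show E [⋀^Fin l]→L[ℝ] ℝ from α x) v = (show E [⋀^Fin l]→L[ℝ] ℝ from α x') v := by
  subst h; rfl

theorem Form.pullback_id (α : Form I M l) : α.pullback I id = α := Form.pullback_one_diff α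

theorem Form.sub_eq_add_smul (α β : Form I M l) : α - β = α + (-1 : ℝ) • β := by
  funext x
  ext v
  change α x v - β x v = α x v + (-1) * β x v
  ring

theorem Form.pullback_add (f : B → M) (α β : Form I M l) :
    (α + β).pullback J f = α.pullback J f + β.pullback J f := rfl

theorem Form.pullback_smul (f : B → M) (a : ℝ) (α : Form I M l) :
    (a • α).pullback J f = a • α.pullback J f := rfl

theorem Form.pullback_sub (f : B → M) (α β : Form I M l) :
    (α - β).pullback J f = α.pullback J f - β.pullback J f := rfl

/-- The pullback of forms, as a linear map. -/
def Form.pullbackₗ (J : ModelWithCorners ℝ E' H') (f : B → M) : Form I M l →ₗ[ℝ] Form J B l where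
  toFun α := α.pullback J f
  map_add' := Form.pullback_add f
  map_smul' := Form.pullback_smul f

variable (I M l) in
/-- The space `Ω^l(M)` of smooth forms. -/
def smoothForms : Submodule ℝ (Form I M l) where
  carrier := {α | α.IsSmooth}
  zero_mem' := fun _ => contDiffOn_const (c := (0 : E [⋀^Fin l]→L[ℝ] ℝ))
  add_mem' := fun hα hβ x₀ => (hα x₀).add (hβ x₀)
  smul_mem' := fun a _ hα x₀ => (hα x₀).const_smul a

theorem Form.IsSmooth.contDiffWithinAt {α : Form I M l} (hα : α.IsSmooth) {x₀ : M} {y : E}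
    (hy : y ∈ (extChartAt I x₀).target) :
    ContDiffWithinAt ℝ ∞ (α.inChart x₀) (Set.range I) y :=
  (hα x₀ y hy).mono_of_mem_nhdsWithin (extChartAt_target_mem_nhdsWithin_of_mem hy)

/-- The product of a function and a form. -/
def Form.fmul (f : M → ℝ) (α : Form I M l) : Form I M l := fun x => f x • α x

theorem Form.inChart_fmul (f : M → ℝ) (α : Form I M l) (x₀ : M) (y : E) :
    (α.fmul f).inChart x₀ y = f ((extChartAt I x₀).symm y) • α.inChart x₀ y := rfl

variable [IsManifold I ∞ M] [IsManifold J ∞ B]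

theorem fderivWithin_writtenInCharts {f : B → M} {b₀ : B} {x₀ : M} {y : E'}
    (hy : y ∈ (extChartAt J b₀).target)
    (hf : MDifferentiableAt J I f ((extChartAt J b₀).symm y))
    (hfy : f ((extChartAt J b₀).symm y) ∈ (extChartAt I x₀).source) :
    mfderivWithin 𝓘(ℝ, E') 𝓘(ℝ, E) (extChartAt I x₀ ∘ f ∘ (extChartAt J b₀).symm)
      (Set.range J) y = (mfderiv I 𝓘(ℝ, E) (extChartAt I x₀) (f ((extChartAt J b₀).symm y))).comp
        ((mfderiv J I f ((extChartAt J b₀).symm y)).comp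
          (mfderivWithin 𝓘(ℝ, E') J (extChartAt J b₀).symm (Set.range J) y)) := by
  have : IsManifold I 1 M := IsManifold.of_le (n := ∞) (by simp)
  have : IsManifold J 1 B := IsManifold.of_le (n := ∞) (by simp)
  have U : UniqueMDiffWithinAt 𝓘(ℝ, E') (Set.range J) y :=
    J.uniqueMDiffOn _ (extChartAt_target_subset_range _ hy)
  have hs : MDifferentiableWithinAt 𝓘(ℝ, E') J (extChartAt J b₀).symm (Set.range J) y :=
    mdifferentiableWithinAt_extChartAt_symm hy
  have hc : MDifferentiableAt I 𝓘(ℝ, E) (extChartAt I x₀) (f ((extChartAt J b₀).symm y)) :=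
    mdifferentiableAt_extChartAt (by rwa [← extChartAt_source (I := I)])
  rw [← mfderiv_comp_mfderivWithin _ hf hs U]
  exact mfderiv_comp_mfderivWithin (f := f ∘ (extChartAt J b₀).symm) _ hc
    (MDifferentiableAt.comp_mdifferentiableWithinAt _ hf hs) U

theorem Form.inChart_pullback (α : Form I M l) {f : B → M} {b₀ : B} {x₀ : M} {y : E'}
    (hy : y ∈ (extChartAt J b₀).target)
    (hf : MDifferentiableAt J I f ((extChartAt J b₀).symm y))
    (hfy : f ((extChartAt J b₀).symm y) ∈ (extChartAt I x₀).source) :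
    (α.pullback J f).inChart b₀ y =
      (α.inChart x₀ (extChartAt I x₀ (f ((extChartAt J b₀).symm y)))).compContinuousLinearMap
        (fderivWithin ℝ (extChartAt I x₀ ∘ f ∘ (extChartAt J b₀).symm) (Set.range J) y) := by
  have : IsManifold I 1 M := IsManifold.of_le (n := ∞) (by simp)
  have e2 := mfderivWithin_extChartAt_symm_comp_mfderiv_extChartAt' (I := I) hfy
  ext v
  have e3 : ∀ u : E', (mfderivWithin 𝓘(ℝ, E) I (extChartAt I x₀).symm (Set.range I)
      (extChartAt I x₀ (f ((extChartAt J b₀).symm y))))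
      (fderivWithin ℝ (extChartAt I x₀ ∘ f ∘ (extChartAt J b₀).symm) (Set.range J) y u)
      = (mfderiv J I f ((extChartAt J b₀).symm y)
          (mfderivWithin 𝓘(ℝ, E') J (extChartAt J b₀).symm (Set.range J) y u) : E) := by
    intro u
    rw [← mfderivWithin_eq_fderivWithin, fderivWithin_writtenInCharts hy hf hfy]
    exact DFunLike.congr_fun e2 _
  refine Eq.trans ?_ (Form.apply_eq_of_eq α ((extChartAt I x₀).left_inv hfy).symm _)
  refine congrArg (show E [⋀^Fin l]→L[ℝ] ℝ from α _) ?_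
  funext k
  exact (e3 (v k)).symm

/-- Change of charts for the coordinate expressions of a form. -/
theorem Form.inChart_transition (α : Form I M l) {x₀ x₁ : M} {y : E}
    (hy : y ∈ (extChartAt I x₀).target) (hy' : (extChartAt I x₀).symm y ∈ (extChartAt I x₁).source) :
    α.inChart x₀ y =
      (α.inChart x₁ (extChartAt I x₁ ((extChartAt I x₀).symm y))).compContinuousLinearMap
        (fderivWithin ℝ (extChartAt I x₁ ∘ (extChartAt I x₀).symm) (Set.range I) y) := by
  conv_lhs => rw [← Form.pullback_id α]
  exact Form.inChart_pullback α hy mdifferentiableAt_id hy'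

theorem Form.inChart_self (α : Form I M l) (x : M) :
    α.inChart x (extChartAt I x x) = (show E [⋀^Fin l]→L[ℝ] ℝ from α x) := by
  have : IsManifold I 1 M := IsManifold.of_le (n := ∞) (by simp)
  ext v
  refine Eq.trans ?_ (Form.apply_eq_of_eq α (extChartAt_to_inv (I := I) x) _)
  refine congrArg (show E [⋀^Fin l]→L[ℝ] ℝ from α _) ?_
  funext k
  exact DFunLike.congr_fun (mfderivWithin_range_extChartAt_symm (I := I) (x := x)) (v k)


theorem Form.extD_apply (α : Form I M l) (x : M) :
    (show E [⋀^Fin (l + 1)]→L[ℝ] ℝ from α.extD x) =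
      extDerivWithin (α.inChart x) (Set.range I) (extChartAt I x x) := by
  have : IsManifold I 1 M := IsManifold.of_le (n := ∞) (by simp)
  ext v
  refine congrArg (extDerivWithin (α.inChart x) (Set.range I) (extChartAt I x x)) ?_
  funext k
  exact DFunLike.congr_fun (mfderiv_extChartAt_self (I := I) (x := x)) (v k)

/-- A map written in charts, as a map between model vector spaces. -/
theorem contDiffWithinAt_writtenInCharts {f : B → M} {b₀ : B} {x₀ : M} {y : E'}
    (hy : y ∈ (extChartAt J b₀).target)
    (hf : ContMDiffAt J I ∞ f ((extChartAt J b₀).symm y))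
    (hfy : f ((extChartAt J b₀).symm y) ∈ (extChartAt I x₀).source) :
    ContDiffWithinAt ℝ ∞ (extChartAt I x₀ ∘ f ∘ (extChartAt J b₀).symm) (Set.range J) y := by
  have h1 : ContMDiffWithinAt 𝓘(ℝ, E') J ∞ (extChartAt J b₀).symm (Set.range J) y :=
    contMDiffWithinAt_extChartAt_symm_range (n := ∞) b₀ hy
  have h2 : ContMDiffAt I 𝓘(ℝ, E) ∞ (extChartAt I x₀) (f ((extChartAt J b₀).symm y)) :=
    contMDiffAt_extChartAt' (by rwa [← extChartAt_source (I := I)])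
  exact (h2.comp_contMDiffWithinAt y (hf.comp_contMDiffWithinAt y h1)).contDiffWithinAt

/-- Near a point of the source, a form pulled back along `f` is in coordinates the pullback along
the coordinate expression of `f`. -/
theorem Form.inChart_pullback_eventually (α : Form I M l) {f : B → M} {b₀ : B} {x₀ : M} {y : E'}
    (hy : y ∈ (extChartAt J b₀).target) (hf : ContMDiff J I ∞ f)
    (hfy : f ((extChartAt J b₀).symm y) ∈ (extChartAt I x₀).source) :
    (α.pullback J f).inChart b₀ =ᶠ[𝓝[Set.range J] y] fun z =>
      (α.inChart x₀ ((extChartAt I x₀ ∘ f ∘ (extChartAt J b₀).symm) z)).compContinuousLinearMap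
        (fderivWithin ℝ (extChartAt I x₀ ∘ f ∘ (extChartAt J b₀).symm) (Set.range J) z) := by
  have hc : ContinuousWithinAt (f ∘ (extChartAt J b₀).symm) (Set.range J) y :=
    hf.continuous.continuousAt.comp_continuousWithinAt
      (contMDiffWithinAt_extChartAt_symm_range (n := ∞) b₀ hy).continuousWithinAt
  filter_upwards [extChartAt_target_mem_nhdsWithin_of_mem hy,
    hc ((isOpen_extChartAt_source (I := I) x₀).mem_nhds hfy)] with z hz hz'
  exact α.inChart_pullback hz (hf.mdifferentiable (by simp) _) hz'

theorem Form.inChart_pullback_contDiffWithinAt [FiniteDimensional ℝ E] [FiniteDimensional ℝ E']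
    (α : Form I M l) {f : B → M} {b₀ : B} {x₀ : M} {y : E'}
    (hy : y ∈ (extChartAt J b₀).target) (hf : ContMDiff J I ∞ f)
    (hfy : f ((extChartAt J b₀).symm y) ∈ (extChartAt I x₀).source)
    (hα : ContDiffWithinAt ℝ ∞ (α.inChart x₀) (Set.range I)
      (extChartAt I x₀ (f ((extChartAt J b₀).symm y)))) :
    ContDiffWithinAt ℝ ∞ ((α.pullback J f).inChart b₀) (Set.range J) y := by
  have hyr : y ∈ Set.range J := extChartAt_target_subset_range _ hy
  have hτ := contDiffWithinAt_writtenInCharts (I := I) hy hf.contMDiffAt hfy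
  have h := α.inChart_pullback_eventually hy hf hfy
  refine ContDiffWithinAt.congr_of_eventuallyEq ?_ h (h.self_of_nhdsWithin hyr)
  refine contDiffWithinAt_compContinuousLinearMap ?_ ?_
  · exact ContDiffWithinAt.comp (t := Set.range I) y hα hτ
      fun z _ => ⟨_, rfl⟩
  · exact hτ.fderivWithin_right J.uniqueDiffOn (by simp) hyr

/-- Smoothness of a form can be tested in any one chart around each point. -/
theorem Form.isSmooth_of_forall_exists [FiniteDimensional ℝ E] {α : Form I M l}
    (h : ∀ x, ∃ x₀, x ∈ (extChartAt I x₀).source ∧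
      ContDiffWithinAt ℝ ∞ (α.inChart x₀) (Set.range I) (extChartAt I x₀ x)) : α.IsSmooth := by
  intro x₁ y hy
  obtain ⟨x₀, hx, hα⟩ := h ((extChartAt I x₁).symm y)
  have := Form.inChart_pullback_contDiffWithinAt α (f := id) hy contMDiff_id hx hα
  rw [Form.pullback_id] at this
  exact this.mono (extChartAt_target_subset_range _)

theorem Form.IsSmooth.pullback [FiniteDimensional ℝ E] [FiniteDimensional ℝ E'] {α : Form I M l}
    (hα : α.IsSmooth) {f : B → M} (hf : ContMDiff J I ∞ f) : (α.pullback J f).IsSmooth :=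
  fun b₀ _ hy => (α.inChart_pullback_contDiffWithinAt hy hf (mem_extChartAt_source _)
    (hα.contDiffWithinAt (mem_extChartAt_target _))).mono (extChartAt_target_subset_range b₀)

theorem Form.extDerivWithin_inChart_pullback (α : Form I M l) {f : B → M} {b₀ : B} {x₀ : M} {y : E'}
    (hy : y ∈ (extChartAt J b₀).target) (hf : ContMDiff J I ∞ f)
    (hfy : f ((extChartAt J b₀).symm y) ∈ (extChartAt I x₀).source) (hα : α.IsSmooth) :
    extDerivWithin ((α.pullback J f).inChart b₀) (Set.range J) y =
      (extDerivWithin (α.inChart x₀) (Set.range I)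
        (extChartAt I x₀ (f ((extChartAt J b₀).symm y)))).compContinuousLinearMap
        (fderivWithin ℝ (extChartAt I x₀ ∘ f ∘ (extChartAt J b₀).symm) (Set.range J) y) := by
  have hyr : y ∈ Set.range J := extChartAt_target_subset_range _ hy
  have h := α.inChart_pullback_eventually hy hf hfy
  rw [h.extDerivWithin_eq_of_mem hyr]
  refine extDerivWithin_pullback (t := Set.range I) (r := ∞)
    (f := extChartAt I x₀ ∘ f ∘ (extChartAt J b₀).symm) ?_
    (contDiffWithinAt_writtenInCharts hy hf.contMDiffAt hfy)
    (by simpa using two_le_infty) J.uniqueDiffOn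
    (J.range_subset_closure_interior hyr) hyr ?_
  · exact (hα.contDiffWithinAt ((extChartAt I x₀).map_source hfy)).differentiableWithinAt (by simp)
  · intro z _
    exact ⟨_, rfl⟩

/-- The exterior derivative can be computed in any chart. -/
theorem Form.inChart_extD {α : Form I M l} (hα : α.IsSmooth) {x₀ : M} {y : E}
    (hy : y ∈ (extChartAt I x₀).target) :
    α.extD.inChart x₀ y = extDerivWithin (α.inChart x₀) (Set.range I) y := by
  have h1 := α.extDerivWithin_inChart_pullback (f := id) hy contMDiff_id
    (mem_extChartAt_source _) hα
  rw [Form.pullback_id] at h1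
  rw [h1, Form.inChart_transition α.extD hy (mem_extChartAt_source _), Form.inChart_self]
  erw [Form.extD_apply]
  rfl

theorem Form.extD_pullback {α : Form I M l} (hα : α.IsSmooth) {f : B → M}
    (hf : ContMDiff J I ∞ f) : (α.pullback J f).extD = α.extD.pullback J f := by
  funext b
  have h1 := α.extDerivWithin_inChart_pullback (f := f) (mem_extChartAt_target (I := J) b) hf
    (x₀ := f b) (by rw [extChartAt_to_inv]; exact mem_extChartAt_source _) hα
  rw [extChartAt_to_inv, ← Form.extD_apply, ← Form.extD_apply] at h1
  refine h1.trans ?_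
  have h2 : mfderiv J I f b = fderivWithin ℝ (extChartAt I (f b) ∘ f ∘ (extChartAt J b).symm)
      (Set.range J) (extChartAt J b b) :=
    (hf.mdifferentiable (by simp) b).mfderiv
  ext v
  refine congrArg (show E [⋀^Fin (l + 1)]→L[ℝ] ℝ from α.extD (f b)) ?_
  funext k
  exact (DFunLike.congr_fun h2 (v k)).symm

theorem Form.IsSmooth.extD {α : Form I M l} (hα : α.IsSmooth) : α.extD.IsSmooth := by
  intro x₀ y hy
  have hyr : y ∈ Set.range I := extChartAt_target_subset_range _ hy
  have h1 : ContDiffWithinAt ℝ ∞ (fderivWithin ℝ (α.inChart x₀) (Set.range I)) (Set.range I) y :=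
    (hα.contDiffWithinAt hy).fderivWithin_right I.uniqueDiffOn (by simp) hyr
  have h3 : ContDiff ℝ ∞ (ContinuousAlternatingMap.alternatizeUncurryFinCLM ℝ E ℝ (n := l)) :=
    ContinuousLinearMap.contDiff _
  have h2 : ContDiffWithinAt ℝ ∞ (extDerivWithin (α.inChart x₀) (Set.range I)) (Set.range I) y :=
    h3.comp_contDiffWithinAt h1
  exact (h2.mono (extChartAt_target_subset_range _)).congr (fun z hz => Form.inChart_extD hα hz)
    (Form.inChart_extD hα hy)

theorem Form.extD_extD {α : Form I M l} (hα : α.IsSmooth) : α.extD.extD = 0 := by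
  funext x
  have hxr : extChartAt I x x ∈ Set.range I := ⟨_, rfl⟩
  have hx := mem_extChartAt_target (I := I) x
  refine (Form.extD_apply α.extD x).trans ?_
  have h : α.extD.inChart x =ᶠ[𝓝[Set.range I] (extChartAt I x x)]
      extDerivWithin (α.inChart x) (Set.range I) := by
    filter_upwards [extChartAt_target_mem_nhdsWithin_of_mem hx] with z hz
    exact Form.inChart_extD hα hz
  rw [h.extDerivWithin_eq_of_mem hxr]
  exact extDerivWithin_extDerivWithin_apply (hα.contDiffWithinAt hx)
    (by simpa using two_le_infty) I.uniqueDiffOn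
    (I.range_subset_closure_interior hxr) hxr


theorem Form.extD_add {α β : Form I M l} (hα : α.IsSmooth) (hβ : β.IsSmooth) :
    (α + β).extD = α.extD + β.extD := by
  funext x
  have hx := mem_extChartAt_target (I := I) x
  refine (Form.extD_apply _ x).trans ((extDerivWithin_add
    (I.uniqueDiffOn _ (extChartAt_target_subset_range _ hx))
    ((hα.contDiffWithinAt hx).differentiableWithinAt (by simp))
    ((hβ.contDiffWithinAt hx).differentiableWithinAt (by simp))).trans ?_)
  exact congrArg₂ (· + ·) (Form.extD_apply α x).symm (Form.extD_apply β x).symm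

theorem Form.extD_smul (a : ℝ) (α : Form I M l) : (a • α).extD = a • α.extD := by
  funext x
  refine (Form.extD_apply _ x).trans ((extDerivWithin_smul a (α.inChart x)
    (I.uniqueDiffOn _ (extChartAt_target_subset_range _ (mem_extChartAt_target (I := I) x)))).trans
      ?_)
  exact congrArg (a • ·) (Form.extD_apply α x).symm

variable (I M l) in
/-- The exterior derivative as a linear map on smooth forms. -/
def extDₗ : smoothForms I M l →ₗ[ℝ] Form I M (l + 1) where
  toFun α := α.1.extD
  map_add' α β := Form.extD_add α.2 β.2
  map_smul' a α := Form.extD_smul a α.1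

theorem Form.extD_sub {α β : Form I M l} (hα : α.IsSmooth) (hβ : β.IsSmooth) :
    (α - β).extD = α.extD - β.extD := by
  have hβ' : ((-1 : ℝ) • β).IsSmooth := (smoothForms I M l).smul_mem _ hβ
  rw [Form.sub_eq_add_smul, Form.extD_add hα hβ', Form.extD_smul, ← Form.sub_eq_add_smul]

theorem contDiffOn_comp_extChartAt_symm {f : M → ℝ} (hf : ContMDiff I 𝓘(ℝ, ℝ) ∞ f) (x₀ : M) :
    ContDiffOn ℝ ∞ (f ∘ (extChartAt I x₀).symm) (extChartAt I x₀).target :=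
  (hf.comp_contMDiffOn (contMDiffOn_extChartAt_symm x₀)).contDiffOn

theorem Form.IsSmooth.fmul {f : M → ℝ} (hf : ContMDiff I 𝓘(ℝ, ℝ) ∞ f) {α : Form I M l}
    (hα : α.IsSmooth) : (α.fmul f).IsSmooth :=
  fun x₀ => (contDiffOn_comp_extChartAt_symm hf x₀).smul (hα x₀)

end Charts

/-! ### The simplicial coboundary -/

section Coboundary

/-- Double sums over pairs of face maps cancel: `∂∂ = 0` for functions of tuples. -/
theorem sum_sum_succAbove_eq_zero {X V : Type*} [AddCommGroup V] [Module ℝ V] {k : ℕ}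
    (F : (Fin k → X) → V) (P : Fin (k + 2) → X) :
    ∑ i : Fin (k + 2), (-1 : ℝ) ^ (i : ℕ) • ∑ j : Fin (k + 1), (-1 : ℝ) ^ (j : ℕ) •
      F (fun a => P (i.succAbove (j.succAbove a))) = 0 := by
  simp only [Finset.smul_sum, smul_smul, ← pow_add]
  set T : Fin (k + 2) → Fin (k + 1) → V := fun i j =>
    (-1 : ℝ) ^ ((i : ℕ) + j) • F (fun a => P (i.succAbove (j.succAbove a))) with hT
  have hinv : ∀ i j, T (i.succAbove j) (j.predAbove i) = -T i j := by
    intro i j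
    simp only [hT, Fin.neg_one_pow_succAbove_add_predAbove, neg_smul,
      Fin.succAbove_succAbove_succAbove_predAbove]
  rw [← Finset.sum_product']
  refine Finset.sum_involution (fun p _ => (p.1.succAbove p.2, p.2.predAbove p.1)) ?_ ?_ ?_ ?_
  · rintro ⟨i, j⟩ _
    change T i j + T (i.succAbove j) (j.predAbove i) = 0
    rw [hinv, add_neg_cancel]
  · rintro ⟨i, j⟩ _ _ h
    exact Fin.succAbove_ne i j (congrArg Prod.fst h)
  · intro _ _
    simp
  · rintro ⟨i, j⟩ _
    simp [Fin.succAbove_succAbove_predAbove, Fin.predAbove_predAbove_succAbove]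

variable {G V : Type*} [Group G] [AddCommGroup V] [Module ℝ V]

/-- The homogeneous form of an inhomogeneous cochain, as a function of the partial products. -/
def homogenize (act : G → V →ₗ[ℝ] V) {k : ℕ} (c : (Fin k → G) → V) (P : Fin (k + 1) → G) : V :=
  act (P (Fin.last k))⁻¹ (c fun a => (P a.castSucc)⁻¹ * P a.succ)

theorem contractNth_inv_mul {k : ℕ} (P : Fin (k + 2) → G) (a : Fin k) :
    Fin.contractNth a.castSucc (· * ·) (fun b : Fin (k + 1) => (P b.castSucc)⁻¹ * P b.succ) =
      fun b => (P (a.castSucc.succ.succAbove b.castSucc))⁻¹ * P (a.castSucc.succ.succAbove b.succ) := by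
  funext b
  rcases lt_trichotomy (b : ℕ) (a : ℕ) with h | h | h
  · rw [Fin.contractNth_apply_of_lt _ _ _ _ (by simpa using h),
      Fin.succAbove_of_castSucc_lt _ _ (by rw [Fin.lt_def]; simp; omega),
      Fin.succAbove_of_castSucc_lt _ _ (by rw [Fin.lt_def]; simp; omega)]
    rfl
  · rw [Fin.contractNth_apply_of_eq _ _ _ _ (by simpa using h),
      Fin.succAbove_of_castSucc_lt _ _ (by rw [Fin.lt_def]; simp; omega),
      Fin.succAbove_of_le_castSucc _ _ (by rw [Fin.le_def]; simp; omega)]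
    simp only [Fin.succ_castSucc, mul_assoc, mul_inv_cancel_left]
  · rw [Fin.contractNth_apply_of_gt _ _ _ _ (by simpa using h),
      Fin.succAbove_of_le_castSucc _ _ (by rw [Fin.le_def]; simp; omega),
      Fin.succAbove_of_le_castSucc _ _ (by rw [Fin.le_def]; simp; omega)]
    rfl

/-- On homogeneous cochains, the coboundary is the alternating sum over the omitted argument. -/
theorem homogenize_coboundary {act : G → V →ₗ[ℝ] V}
    (hmul : ∀ g h v, act (g * h) v = act h (act g v)) {k : ℕ} (c : (Fin k → G) → V)
    (P : Fin (k + 2) → G) :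
    homogenize act (coboundary (fun g v => act g v) c) P =
      ∑ i : Fin (k + 2), (-1 : ℝ) ^ (i : ℕ) • homogenize act c (fun a => P (i.succAbove a)) := by
  rw [Fin.sum_univ_succ, Fin.sum_univ_castSucc]
  simp only [homogenize, coboundary, map_add, map_sum, map_smul]
  rw [← add_assoc]
  congr 1
  · congr 1
    · simp
    · refine Finset.sum_congr rfl fun a _ => ?_
      rw [contractNth_inv_mul]
      congr 3
      rw [Fin.succAbove_of_le_castSucc _ _ (by rw [Fin.le_def]; simp), Fin.succ_last]
  · congr 1
    rw [← hmul]
    congr 2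
    · rw [mul_assoc, Fin.succ_last, mul_inv_cancel, mul_one]
      simp
    · funext a
      simp

theorem coboundary_coboundary {act : G → V →ₗ[ℝ] V} (hone : ∀ v, act 1 v = v)
    (hmul : ∀ g h v, act (g * h) v = act h (act g v)) {k : ℕ} (c : (Fin k → G) → V) :
    coboundary (fun g v => act g v) (coboundary (fun g v => act g v) c) = 0 := by
  funext g
  -- The partial products of `g`, translated so that the last one is `1` and acts trivially.
  set Q : Fin (k + 3) → G := fun i => (Fin.partialProd g (Fin.last _))⁻¹ * Fin.partialProd g i
  have h := homogenize_coboundary hmul (coboundary (fun g v => act g v) c) Q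
  simp only [homogenize_coboundary hmul c] at h
  rw [sum_sum_succAbove_eq_zero (homogenize act c)] at h
  have hQ : (fun a : Fin (k + 2) => (Q a.castSucc)⁻¹ * Q a.succ) = g := by
    funext a
    simp [Q, mul_assoc, Fin.partialProd_right_inv]
  rw [homogenize, hQ] at h
  have hl : (Q (Fin.last (k + 2)))⁻¹ = 1 := by simp [Q]
  rwa [hl, hone] at h

end Coboundary

section CoboundaryLinear

theorem neg_one_pow_succ_smul {V : Type*} [AddCommGroup V] [Module ℝ V] (k : ℕ) (v : V) :
    (-1 : ℝ) ^ (k + 1) • v = -((-1 : ℝ) ^ k • v) := by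
  rw [pow_succ, mul_neg_one, neg_smul]

variable {G V : Type*} [Group G] [AddCommGroup V] [Module ℝ V]

theorem coboundary_sub (act : G → V →ₗ[ℝ] V) {k : ℕ} (c c' : (Fin k → G) → V) :
    coboundary (fun g v => act g v) (c - c') =
      coboundary (fun g v => act g v) c - coboundary (fun g v => act g v) c' := by
  funext g
  simp only [coboundary, Pi.sub_apply, map_sub, smul_sub, Finset.sum_sub_distrib]
  abel

theorem coboundary_smul (act : G → V →ₗ[ℝ] V) {k : ℕ} (a : ℝ) (c : (Fin k → G) → V) :
    coboundary (fun g v => act g v) (a • c) = a • coboundary (fun g v => act g v) c := by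
  funext g
  simp only [coboundary, Pi.smul_apply, map_smul, smul_add, Finset.smul_sum]
  simp only [smul_comm a]

/-- The coboundary is natural in the coefficients and in the group. -/
theorem coboundary_map {G' V' : Type*} [Group G'] [AddCommGroup V'] [Module ℝ V']
    {act : G → V → V} {act' : G' → V' → V'} (ρ : G' →* G) (S : Submodule ℝ V) (L : S →ₗ[ℝ] V')
    (hS : ∀ g, ∀ v ∈ S, act g v ∈ S)
    (hL : ∀ g (v : S), L ⟨act (ρ g) v, hS _ _ v.2⟩ = act' g (L v))
    {k : ℕ} (c : (Fin k → G) → S) (g : Fin (k + 1) → G') :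
    ∃ h : coboundary act (fun g => (c g : V)) (fun a => ρ (g a)) ∈ S,
      L ⟨coboundary act (fun g => (c g : V)) (fun a => ρ (g a)), h⟩ =
        coboundary act' (fun g => L (c fun a => ρ (g a))) g := by
  have e : coboundary act (fun g => (c g : V)) (fun a => ρ (g a)) =
      ((c (fun a => ρ (g a.succ))
        + ∑ a : Fin k, (-1 : ℝ) ^ ((a : ℕ) + 1) •
            c (fun b => ρ (Fin.contractNth a.castSucc (· * ·) g b))
        + (-1 : ℝ) ^ (k + 1) • ⟨act (ρ (g (Fin.last k))) (c (fun a => ρ (g a.castSucc))),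
          hS _ _ (c _).2⟩ : S) : V) := by
    simp only [coboundary, Submodule.coe_add, Submodule.coe_smul,
      AddSubmonoidClass.coe_finsetSum]
    congr 2
    refine Finset.sum_congr rfl fun a _ => ?_
    congr 3
    exact (Fin.comp_contractNth (· * ·) (· * ·) (fun x y => map_mul ρ x y) a.castSucc g).symm
  refine ⟨e ▸ Subtype.property _, ?_⟩
  have e' : (⟨_, e ▸ Subtype.property _⟩ : S) = _ := Subtype.ext e
  rw [e']
  simp only [map_add, map_sum, map_smul, hL, coboundary]

end CoboundaryLinear

/-! ### The double complex -/

section FormCochains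

variable {E H : Type*} [NormedAddCommGroup E] [NormedSpace ℝ E] [TopologicalSpace H]
  {I : ModelWithCorners ℝ E H} {M : Type*} [TopologicalSpace M] [ChartedSpace H M]
  {E' H' : Type*} [NormedAddCommGroup E'] [NormedSpace ℝ E'] [TopologicalSpace H']
  {J : ModelWithCorners ℝ E' H'} {B : Type*} [TopologicalSpace B] [ChartedSpace H' B]
  {G : Subgroup (Diff I M)} {k l : ℕ}

theorem FormCochain.delta_delta (c : FormCochain G k l) : c.delta.delta = 0 :=
  coboundary_coboundary (act := fun g : G => Form.pullbackₗ (l := l) I ⇑(g : Diff I M))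
    (fun α => Form.pullback_one_diff α) (fun g h α => Form.pullback_comp_diff (g : Diff I M) h α) c

theorem FormCochain.delta_sub (c c' : FormCochain G k l) :
    (c - c').delta = c.delta - c'.delta :=
  coboundary_sub (fun g : G => Form.pullbackₗ (l := l) I ⇑(g : Diff I M)) c c'

theorem FormCochain.delta_smul (a : ℝ) (c : FormCochain G k l) :
    FormCochain.delta (a • c : FormCochain G k l) = a • c.delta :=
  coboundary_smul (fun g : G => Form.pullbackₗ (l := l) I ⇑(g : Diff I M)) a c

/-- Restriction to a subgroup commutes with `δ`. -/
theorem FormCochain.delta_comp_hom {G' : Subgroup (Diff I M)} (ρ : G' →* G)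
    (hρ : ∀ g, (ρ g : Diff I M) = g) (c : FormCochain G k l) (g : Fin (k + 1) → G') :
    c.delta (fun a => ρ (g a)) =
      FormCochain.delta (fun g : Fin k → G' => c fun a => ρ (g a)) g := by
  have h := coboundary_map (act := fun (g : G) (α : Form I M l) => α.pullback I (g : Diff I M))
    (act' := fun (g : G') (α : Form I M l) => α.pullback I (g : Diff I M)) ρ ⊤
    (Submodule.subtype ⊤) (fun _ _ _ => trivial)
    (fun g α => congrArg (fun f : Diff I M => (α : Form I M l).pullback I f) (hρ g))
    (fun g => ⟨c g, trivial⟩) g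
  exact h.2

theorem Form.pullback_pullback {g : M → M} {f : B → M} (hg : MDifferentiable I I g)
    (hf : MDifferentiable J I f) (α : Form I M l) :
    (α.pullback I g).pullback J f = α.pullback J (g ∘ f) := by
  funext x
  have hc : mfderiv J I (g ∘ f) x = (mfderiv I I g (f x)).comp (mfderiv J I f x) :=
    mfderiv_comp x (hg _) (hf _)
  ext v
  simp only [Form.pullback, hc]
  rfl

variable [IsManifold I ∞ M]

theorem FormCochain.isSmooth_delta [FiniteDimensional ℝ E] {c : FormCochain G k l}
    (hc : ∀ g, (c g).IsSmooth) (g : Fin (k + 1) → G) : (c.delta g).IsSmooth := by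
  have h := coboundary_map (act := fun (g : G) (α : Form I M l) => α.pullback I (g : Diff I M))
    (act' := fun (g : G) (α : Form I M l) => α.pullback I (g : Diff I M)) (MonoidHom.id G)
    (smoothForms I M l) (Submodule.subtype _)
    (fun g α hα => Form.IsSmooth.pullback hα (g : Diff I M).contMDiff) (fun _ _ => rfl)
    (fun g => ⟨c g, hc g⟩) g
  exact h.1

theorem FormCochain.extD_delta [FiniteDimensional ℝ E] {c : FormCochain G k l}
    (hc : ∀ g, (c g).IsSmooth) (g : Fin (k + 1) → G) :
    (c.delta g).extD = FormCochain.delta (fun g => (c g).extD) g := by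
  have h := coboundary_map (act := fun (g : G) (α : Form I M l) => α.pullback I (g : Diff I M))
    (act' := fun (g : G) (α : Form I M (l + 1)) => α.pullback I (g : Diff I M)) (MonoidHom.id G)
    (smoothForms I M l) (extDₗ I M l)
    (fun g α hα => Form.IsSmooth.pullback hα (g : Diff I M).contMDiff)
    (fun g α => Form.extD_pullback α.2 (g : Diff I M).contMDiff)
    (fun g => ⟨c g, hc g⟩) g
  exact h.2

theorem FormCochain.dd_delta [FiniteDimensional ℝ E] {c : FormCochain G k l}
    (hc : ∀ g, (c g).IsSmooth) : c.delta.dd = -c.dd.delta := by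
  have h : c.dd = (-1 : ℝ) ^ k • (fun g => (c g).extD : FormCochain G k (l + 1)) := rfl
  rw [h, FormCochain.delta_smul]
  funext g
  change (-1 : ℝ) ^ (k + 1) • (c.delta g).extD = -((-1 : ℝ) ^ k • _)
  rw [FormCochain.extD_delta hc]
  exact neg_one_pow_succ_smul (V := Form I M (l + 1)) k _

theorem FormCochain.dd_sub {c c' : FormCochain G k l} (hc : ∀ g, (c g).IsSmooth)
    (hc' : ∀ g, (c' g).IsSmooth) : (c - c').dd = c.dd - c'.dd := by
  funext g
  change (-1 : ℝ) ^ k • (c g - c' g).extD = (-1 : ℝ) ^ k • (c g).extD - (-1 : ℝ) ^ k • (c' g).extD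
  rw [Form.extD_sub (hc g) (hc' g), smul_sub]

variable (I J l) in
/-- The space `Ω^l(M, ∂M)` of smooth forms that vanish on the boundary. -/
def relativeForms (i : B → M) : Submodule ℝ (Form I M l) where
  carrier := {α | α.IsRelative J i}
  zero_mem' := ⟨(smoothForms I M l).zero_mem, map_zero (Form.pullbackₗ J i)⟩
  add_mem' hα hβ := ⟨(smoothForms I M l).add_mem hα.1 hβ.1, by
    rw [Form.pullback_add, hα.2, hβ.2, add_zero]⟩
  smul_mem' a _ hα := ⟨(smoothForms I M l).smul_mem a hα.1, by
    rw [Form.pullback_smul, hα.2, smul_zero]⟩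

/-- For a group of diffeomorphisms that fix the boundary, `δ` preserves relative cochains. -/
theorem FormCochain.isRelative_delta [FiniteDimensional ℝ E] {i : B → M}
    (hi : MDifferentiable J I i) (hG : ∀ g : G, ∀ b, (g : Diff I M) (i b) = i b)
    {c : FormCochain G k l} (hc : ∀ g, (c g).IsRelative J i) (g : Fin (k + 1) → G) :
    (c.delta g).IsRelative J i := by
  have h := coboundary_map (act := fun (g : G) (α : Form I M l) => α.pullback I (g : Diff I M))
    (act' := fun (g : G) (α : Form I M l) => α.pullback I (g : Diff I M)) (MonoidHom.id G)
    (relativeForms I J l i) (Submodule.subtype _)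
    (fun g α hα => ⟨Form.IsSmooth.pullback hα.1 (g : Diff I M).contMDiff, by
      rw [Form.pullback_pullback ((g : Diff I M).mdifferentiable (by simp)) hi,
        show (g : Diff I M) ∘ i = i from funext (hG g)]
      exact hα.2⟩) (fun _ _ => rfl)
    (fun g => ⟨c g, hc g⟩) g
  exact h.1

end FormCochains

/-! ### The measure defined by a volume form -/

section Measure

open MeasureTheory

variable {n : ℕ}

/-- The coordinate frame of `ℝⁿ`. -/
abbrev frame (n : ℕ) : Fin n → EuclideanSpace ℝ (Fin n) := fun k => EuclideanSpace.single k 1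

theorem frame_eq_basis (n : ℕ) :
    frame n = (EuclideanSpace.basisFun (Fin n) ℝ).toBasis := by
  funext k
  simp [frame]

theorem compContinuousLinearMap_frame
    (a : EuclideanSpace ℝ (Fin n) [⋀^Fin n]→L[ℝ] ℝ)
    (A : EuclideanSpace ℝ (Fin n) →L[ℝ] EuclideanSpace ℝ (Fin n)) :
    a.compContinuousLinearMap A (frame n) = A.det * a (frame n) := by
  rw [frame_eq_basis]
  set b := (EuclideanSpace.basisFun (Fin n) ℝ).toBasis
  have h := a.toAlternatingMap.eq_smul_basis_det b
  change a.toAlternatingMap (fun k => A (b k)) = _ * a.toAlternatingMap b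
  rw [h]
  simp only [AlternatingMap.smul_apply, smul_eq_mul, Module.Basis.det_self, mul_one]
  rw [mul_comm]
  congr 1
  have := b.det_comp (A : EuclideanSpace ℝ (Fin n) →ₗ[ℝ] EuclideanSpace ℝ (Fin n)) b
  rw [b.det_self, mul_one] at this
  exact this

variable {H : Type*} [TopologicalSpace H]
  {I : ModelWithCorners ℝ (EuclideanSpace ℝ (Fin n)) H}
  {M : Type*} [TopologicalSpace M] [ChartedSpace H M]

theorem measurableSet_extChartAt_target (x₀ : M) : MeasurableSet (extChartAt I x₀).target := by
  rw [extChartAt_target]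
  exact ((chartAt H x₀).open_target.preimage I.continuous_symm).measurableSet.inter
    I.isClosed_range.measurableSet

variable [MeasurableSpace M] [BorelSpace M]

theorem aemeasurable_extChartAt_symm (x₀ : M) :
    AEMeasurable (extChartAt I x₀).symm
      ((volume : Measure (EuclideanSpace ℝ (Fin n))).restrict (extChartAt I x₀).target) :=
  (continuousOn_extChartAt_symm x₀).aemeasurable (measurableSet_extChartAt_target x₀)

theorem measurableSet_target_inter_preimage (x₀ : M) {A : Set M} (hA : MeasurableSet A) :
    MeasurableSet ((extChartAt I x₀).target ∩ (extChartAt I x₀).symm ⁻¹' A) := by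
  have h1 : Measurable ((extChartAt I x₀).target.domRestrict (extChartAt I x₀).symm) :=
    (continuousOn_extChartAt_symm x₀).domRestrict.measurable
  have h2 := (measurableSet_extChartAt_target (I := I) x₀).subtype_image (h1 hA)
  convert h2 using 1
  ext y
  exact ⟨fun h => ⟨⟨y, h.1⟩, h.2, rfl⟩, by rintro ⟨⟨z, hz⟩, hzA, rfl⟩; exact ⟨hz, hzA⟩⟩

theorem integral_chartMeasure (w : Form I M n) (x₀ : M) {F : M → ℝ}
    (hF : AEStronglyMeasurable F (chartMeasure w x₀))
    (hw : ContinuousOn (w.inChart x₀) (extChartAt I x₀).target) :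
    ∫ x, F x ∂(chartMeasure w x₀) = ∫ y in (extChartAt I x₀).target,
      |w.inChart x₀ y (frame n)| * F ((extChartAt I x₀).symm y) := by
  have h1 := aemeasurable_extChartAt_symm (I := I) x₀
  have hd : AEMeasurable (fun y => ENNReal.ofReal |w.inChart x₀ y (frame n)|)
      ((volume : Measure (EuclideanSpace ℝ (Fin n))).restrict (extChartAt I x₀).target) := by
    refine ContinuousOn.aemeasurable ?_ (measurableSet_extChartAt_target x₀)
    exact ENNReal.continuous_ofReal.comp_continuousOn (continuous_abs.comp_continuousOn
      ((ContinuousAlternatingMap.apply ℝ _ ℝ (frame n)).continuous.comp_continuousOn hw))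
  rw [chartMeasure, integral_map (h1.mono_ac (withDensity_absolutelyContinuous _ _)) hF]
  refine (integral_withDensity_eq_integral_toReal_smul₀ hd (by simp) _).trans ?_
  refine integral_congr_ae (Filter.Eventually.of_forall fun y => ?_)
  simp only [ENNReal.toReal_ofReal (abs_nonneg _), smul_eq_mul]

theorem chartMeasure_apply (w : Form I M n) (x₀ : M) {A : Set M} (hA : MeasurableSet A) :
    chartMeasure w x₀ A = ∫⁻ y in (extChartAt I x₀).target ∩ (extChartAt I x₀).symm ⁻¹' A,
      ENNReal.ofReal |w.inChart x₀ y (frame n)| := by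
  have h1 := aemeasurable_extChartAt_symm (I := I) x₀
  rw [chartMeasure, Measure.map_apply_of_aemeasurable
    (h1.mono_ac (withDensity_absolutelyContinuous _ _)) hA, withDensity_apply',
    Measure.restrict_restrict' (measurableSet_extChartAt_target x₀), Set.inter_comm]

theorem chartMeasure_inter_source (w : Form I M n) (x₀ : M) {A : Set M} (hA : MeasurableSet A) :
    chartMeasure w x₀ (A ∩ (extChartAt I x₀).source) = chartMeasure w x₀ A := by
  rw [chartMeasure_apply w x₀ hA, chartMeasure_apply w x₀
    (hA.inter (isOpen_extChartAt_source x₀).measurableSet)]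
  congr 2
  ext y
  constructor
  · rintro ⟨h, h'⟩
    exact ⟨h, h'.1⟩
  · rintro ⟨h, h'⟩
    exact ⟨h, h', (extChartAt I x₀).map_target h⟩

variable [IsManifold I ∞ M]

/-- The change of variables formula: a diffeomorphism that preserves `w` preserves `|w|`. -/
theorem chartMeasure_image {w : Form I M n} {g : Diff I M} (hg : w.pullback I g = w)
    {x₀ x₁ : M} {A : Set M} (hA : MeasurableSet A) (hA₀ : A ⊆ (extChartAt I x₀).source)
    (hA₁ : ∀ x ∈ A, g x ∈ (extChartAt I x₁).source) :
    chartMeasure w x₁ (g '' A) = chartMeasure w x₀ A := by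
  have hgA : MeasurableSet (g '' A) :=
    (g.toHomeomorph.measurableEmbedding.measurableSet_image (s := A)).2 hA
  rw [chartMeasure_apply w x₁ hgA, chartMeasure_apply w x₀ hA]
  set S := (extChartAt I x₀).target ∩ (extChartAt I x₀).symm ⁻¹' A
  set τ := extChartAt I x₁ ∘ g ∘ (extChartAt I x₀).symm
  have himg : (extChartAt I x₁).target ∩ (extChartAt I x₁).symm ⁻¹' (g '' A) = τ '' S := by
    ext z
    constructor
    · rintro ⟨hz, x, hx, hxz⟩
      refine ⟨extChartAt I x₀ x, ⟨(extChartAt I x₀).map_source (hA₀ hx), ?_⟩, ?_⟩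
      · rw [Set.mem_preimage, (extChartAt I x₀).left_inv (hA₀ hx)]
        exact hx
      · simp only [τ, Function.comp_apply, (extChartAt I x₀).left_inv (hA₀ hx)]
        rw [hxz, (extChartAt I x₁).right_inv hz]
    · rintro ⟨y, ⟨hy, hyA⟩, rfl⟩
      refine ⟨(extChartAt I x₁).map_source (hA₁ _ hyA), (extChartAt I x₀).symm y, hyA, ?_⟩
      exact ((extChartAt I x₁).left_inv (hA₁ _ hyA)).symm
  have hinj : Set.InjOn τ S := by
    rintro y ⟨hy, hyA⟩ z ⟨hz, hzA⟩ h
    exact (extChartAt I x₀).symm.injOn hy hz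
      (g.injective ((extChartAt I x₁).injOn (hA₁ _ hyA) (hA₁ _ hzA) h))
  have hd : ∀ y ∈ S, HasFDerivWithinAt τ (fderivWithin ℝ τ (Set.range I) y) S y := by
    rintro y ⟨hy, hyA⟩
    exact ((contDiffWithinAt_writtenInCharts (I := I) (J := I) hy g.contMDiff.contMDiffAt
      (hA₁ _ hyA)).differentiableWithinAt (by simp)).hasFDerivWithinAt.mono
        (Set.inter_subset_left.trans (extChartAt_target_subset_range _))
  rw [himg, lintegral_image_eq_lintegral_abs_det_fderiv_mul volume
    (measurableSet_target_inter_preimage x₀ hA) hd hinj]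
  refine setLIntegral_congr_fun (measurableSet_target_inter_preimage x₀ hA) ?_
  rintro y ⟨hy, hyA⟩
  have h := Form.inChart_pullback (I := I) (J := I) w hy (g.mdifferentiable (by simp) _)
    (hA₁ _ hyA)
  rw [hg] at h
  simp only
  rw [h, compContinuousLinearMap_frame, abs_mul, ENNReal.ofReal_mul (abs_nonneg _)]
  rfl

theorem chartMeasure_eq_of_subset (w : Form I M n) {x₀ x₁ : M} {A : Set M} (hA : MeasurableSet A)
    (hA₀ : A ⊆ (extChartAt I x₀).source) (hA₁ : A ⊆ (extChartAt I x₁).source) :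
    chartMeasure w x₁ A = chartMeasure w x₀ A := by
  have h := chartMeasure_image (g := 1) (Form.pullback_one_diff w) hA hA₀ hA₁
  rwa [show ((1 : Diff I M) : M → M) '' A = A from Set.image_id A] at h

/-- On the domain of a chart, `|w|` is the measure given by the coordinate expression of `w`. -/
theorem volumeMeasure_apply (w : Form I M n) {x₀ : M} {A : Set M} (hA : MeasurableSet A)
    (hA₀ : A ⊆ (extChartAt I x₀).source) : volumeMeasure w A = chartMeasure w x₀ A := by
  have hs : MeasurableSet (extChartAt I x₀).source := (isOpen_extChartAt_source x₀).measurableSet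
  refine le_antisymm ?_ (le_iSup (chartMeasure w) x₀ A)
  have hle : volumeMeasure w ≤
      chartMeasure w x₀ + (volumeMeasure w).restrict (extChartAt I x₀).sourceᶜ := by
    refine iSup_le fun x₁ => Measure.le_iff.2 fun s hms => ?_
    rw [Measure.add_apply, Measure.restrict_apply hms, ← Set.sdiff_eq,
      ← measure_inter_add_sdiff s hs]
    refine add_le_add ?_ (le_iSup (chartMeasure w) x₁ _)
    rw [← chartMeasure_inter_source w x₁ (hms.inter hs),
      ← chartMeasure_inter_source w x₀ hms,
      chartMeasure_eq_of_subset w (x₀ := x₀)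
        ((hms.inter hs).inter (isOpen_extChartAt_source x₁).measurableSet)
        (fun x hx => hx.1.2) (fun x hx => hx.2)]
    exact measure_mono Set.inter_subset_left
  refine (hle A).trans ?_
  rw [Measure.add_apply, Measure.restrict_apply hA, ← Set.sdiff_eq, Set.sdiff_eq_empty.2 hA₀,
    measure_empty, add_zero]

theorem volumeMeasure_restrict_source (w : Form I M n) (x₀ : M) :
    (volumeMeasure w).restrict (extChartAt I x₀).source = chartMeasure w x₀ := by
  ext A hA
  rw [Measure.restrict_apply hA, volumeMeasure_apply w
    (hA.inter (isOpen_extChartAt_source x₀).measurableSet) Set.inter_subset_right,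
    chartMeasure_inter_source w x₀ hA]

/-- Diffeomorphisms that preserve `w` preserve the measure `|w|`. -/
theorem volumeMeasure_map [CompactSpace M] {w : Form I M n} {g : Diff I M}
    (hg : w.pullback I g = w) : (volumeMeasure w).map g = volumeMeasure w := by
  have hgm : MeasurableEmbedding g := g.toHomeomorph.measurableEmbedding
  suffices h : ∀ A, MeasurableSet A → volumeMeasure w (g '' A) = volumeMeasure w A by
    ext A hA
    rw [Measure.map_apply hgm.measurable hA, ← h _ (hgm.measurable hA),
      Set.image_preimage_eq A (f := g) g.surjective]
  suffices h : (volumeMeasure w).comap g = volumeMeasure w by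
    intro A hA
    rw [← hgm.comap_apply, h]
  let U : M → Set M := fun x => (extChartAt I x).source ∩ g ⁻¹' (extChartAt I (g x)).source
  have hUo : ∀ x, IsOpen (U x) := fun x =>
    (isOpen_extChartAt_source x).inter ((isOpen_extChartAt_source _).preimage g.continuous)
  obtain ⟨t, ht⟩ := isCompact_univ.elim_finite_subcover U hUo
    (fun x _ => Set.mem_iUnion.2 ⟨x, mem_extChartAt_source _, mem_extChartAt_source _⟩)
  have hcov : ⋃ x : t, U x = Set.univ := by
    refine Set.eq_univ_of_univ_subset (ht.trans ?_)
    intro x hx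
    simpa using hx
  rw [Measure.ext_iff_of_iUnion_eq_univ hcov]
  intro x
  ext A hA
  have hAU : MeasurableSet (A ∩ U x) := hA.inter (hUo x).measurableSet
  rw [Measure.restrict_apply hA, Measure.restrict_apply hA, hgm.comap_apply,
    volumeMeasure_apply w (x₀ := g x) ((hgm.measurableSet_image).2 hAU),
    volumeMeasure_apply w (x₀ := (x : M)) hAU (fun y hy => hy.2.1)]
  · exact chartMeasure_image hg hAU (fun y hy => hy.2.1) (fun y hy => hy.2.2)
  · rintro _ ⟨y, hy, rfl⟩
    exact hy.2.2

end Measure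

/-! ### Integration of forms -/

section FormIntegral

open MeasureTheory

variable {n : ℕ} {H : Type*} [TopologicalSpace H]
  {I : ModelWithCorners ℝ (EuclideanSpace ℝ (Fin n)) H}
  {M : Type*} [TopologicalSpace M] [ChartedSpace H M]

theorem alternating_frame_ne_zero {a : EuclideanSpace ℝ (Fin n) [⋀^Fin n]→L[ℝ] ℝ} (ha : a ≠ 0) :
    a (frame n) ≠ 0 := by
  intro h
  apply ha
  apply ContinuousAlternatingMap.toAlternatingMap_injective
  rw [frame_eq_basis] at h
  have := a.toAlternatingMap.eq_smul_basis_det (EuclideanSpace.basisFun (Fin n) ℝ).toBasis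
  rw [this]
  change (a _) • _ = _
  rw [h, zero_smul]
  rfl

theorem Form.IsSmooth.continuousOn_inChart {l : ℕ} {a : Form I M l} (ha : a.IsSmooth) (x₀ : M)
    (v : Fin l → EuclideanSpace ℝ (Fin n)) :
    ContinuousOn (fun y => a.inChart x₀ y v) (extChartAt I x₀).target :=
  (ContinuousAlternatingMap.apply ℝ _ ℝ v).continuous.comp_continuousOn (ha x₀).continuousOn

theorem Form.IsSmooth.continuous_toFun {a : Form I M 0} (ha : a.IsSmooth) :
    Continuous a.toFun := by
  refine continuous_iff_continuousAt.2 fun x₀ => ?_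
  have hmem : (extChartAt I x₀).source ∈ 𝓝 x₀ := extChartAt_source_mem_nhds x₀
  refine ContinuousAt.congr (ContinuousOn.continuousAt (s := (extChartAt I x₀).source)
    ((ha.continuousOn_inChart x₀ ![]).comp (continuousOn_extChartAt x₀)
      (extChartAt I x₀).mapsTo) hmem) (Filter.eventually_of_mem hmem fun x hx => ?_)
  refine Eq.trans ?_ (Form.apply_eq_of_eq a ((extChartAt I x₀).left_inv hx) ![])
  exact congrArg (show EuclideanSpace ℝ (Fin n) [⋀^Fin 0]→L[ℝ] ℝ from a _)
    (Subsingleton.elim _ _)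

variable [IsManifold I ∞ M]

theorem Form.coeff_eq (a : Form I M n) (x : M) :
    a.coeff x = (show EuclideanSpace ℝ (Fin n) [⋀^Fin n]→L[ℝ] ℝ from a x) (frame n) := by
  rw [Form.coeff, Form.inChart_self]

theorem IsVolumeForm.coeff_ne_zero {w : Form I M n} (hw : IsVolumeForm w) (x : M) :
    w.coeff x ≠ 0 := by
  rw [Form.coeff_eq]
  exact alternating_frame_ne_zero (hw.ne_zero x)

theorem Form.exists_coeff_eq (x₀ : M) {x : M} (hx : x ∈ (extChartAt I x₀).source) :
    ∃ d : ℝ, ∀ a : Form I M n, a.coeff x = d * a.inChart x₀ (extChartAt I x₀ x) (frame n) := by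
  refine ⟨(fderivWithin ℝ (extChartAt I x₀ ∘ (extChartAt I x).symm) (Set.range I)
    (extChartAt I x x)).det, fun a => ?_⟩
  rw [Form.coeff, Form.inChart_transition a (x₁ := x₀) (mem_extChartAt_target x)
    (by rwa [extChartAt_to_inv]), extChartAt_to_inv]
  exact compContinuousLinearMap_frame _ _

theorem IsVolumeForm.inChart_ne_zero {w : Form I M n} (hw : IsVolumeForm w) {x₀ : M}
    {y : EuclideanSpace ℝ (Fin n)} (hy : y ∈ (extChartAt I x₀).target) :
    w.inChart x₀ y (frame n) ≠ 0 := by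
  obtain ⟨d, hd⟩ := Form.exists_coeff_eq x₀ ((extChartAt I x₀).map_target hy)
  have h := hw.coeff_ne_zero ((extChartAt I x₀).symm y)
  rw [hd, (extChartAt I x₀).right_inv hy] at h
  exact right_ne_zero_of_mul h

/-- The quotient of two top degree forms can be computed in any chart. -/
theorem IsVolumeForm.coeff_div {w : Form I M n} (hw : IsVolumeForm w) (a : Form I M n) (x₀ : M)
    {x : M} (hx : x ∈ (extChartAt I x₀).source) :
    a.coeff x / w.coeff x = a.inChart x₀ (extChartAt I x₀ x) (frame n) /
      w.inChart x₀ (extChartAt I x₀ x) (frame n) := by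
  obtain ⟨d, hd⟩ := Form.exists_coeff_eq x₀ hx
  have h := hw.coeff_ne_zero x
  rw [hd] at h
  rw [hd, hd, mul_div_mul_left _ _ (left_ne_zero_of_mul h)]

theorem IsVolumeForm.continuous_coeff_div {w : Form I M n} (hw : IsVolumeForm w) {a : Form I M n}
    (ha : a.IsSmooth) : Continuous fun x => a.coeff x / w.coeff x := by
  refine continuous_iff_continuousAt.2 fun x₀ => ?_
  have hmem : (extChartAt I x₀).source ∈ 𝓝 x₀ := extChartAt_source_mem_nhds x₀
  refine ContinuousAt.congr (ContinuousOn.continuousAt (s := (extChartAt I x₀).source) ?_ hmem)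
    (Filter.eventually_of_mem hmem fun x hx => (hw.coeff_div a x₀ hx).symm)
  refine ContinuousOn.div ?_ ?_
    fun x hx => hw.inChart_ne_zero ((extChartAt I x₀).map_source hx)
  · exact (ha.continuousOn_inChart x₀ _).comp (continuousOn_extChartAt x₀)
      (extChartAt I x₀).mapsTo
  · exact (hw.isSmooth.continuousOn_inChart x₀ _).comp (continuousOn_extChartAt x₀)
      (extChartAt I x₀).mapsTo

variable [MeasurableSpace M]

theorem IsVolumeForm.formIntegral_zeroWedge {w : Form I M n} (hw : IsVolumeForm w)
    (f : Form I M 0) : formIntegral w (f.zeroWedge w) = ∫ x, f.toFun x ∂(volumeMeasure w) := by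
  refine integral_congr_ae (Filter.Eventually.of_forall fun x => ?_)
  have h : (f.zeroWedge w).coeff x = f.toFun x * w.coeff x := by
    rw [Form.coeff_eq, Form.coeff_eq]
    rfl
  simp only [h]
  exact mul_div_cancel_right₀ _ (hw.coeff_ne_zero x)

variable [BorelSpace M]

theorem IsVolumeForm.isFiniteMeasure [CompactSpace M] {w : Form I M n} (hw : IsVolumeForm w) :
    IsFiniteMeasure (volumeMeasure w) := by
  have : IsLocallyFiniteMeasure (volumeMeasure w) := by
    refine ⟨fun x => ?_⟩
    set y := extChartAt I x x
    have hc : ContinuousWithinAt (fun z => |w.inChart x z (frame n)|) (extChartAt I x).target y :=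
      (continuous_abs.comp_continuousOn (hw.isSmooth.continuousOn_inChart x _)) y
        (mem_extChartAt_target x)
    have hev := hc.eventually (gt_mem_nhds (lt_add_one _))
    rw [eventually_nhdsWithin_iff, Metric.eventually_nhds_iff_ball] at hev
    obtain ⟨r, hr, hb⟩ := hev
    have hA : IsOpen ((extChartAt I x).source ∩ extChartAt I x ⁻¹' Metric.ball y r) :=
      isOpen_extChartAt_preimage' x Metric.isOpen_ball
    refine ⟨_, hA.mem_nhds ⟨mem_extChartAt_source x, Metric.mem_ball_self hr⟩, ?_⟩
    rw [volumeMeasure_apply w hA.measurableSet Set.inter_subset_left,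
      chartMeasure_apply w x hA.measurableSet]
    calc _ ≤ ∫⁻ _ in Metric.ball y r,
          ENNReal.ofReal (|w.inChart x y (frame n)| + 1) := by
          refine (setLIntegral_mono' (measurableSet_target_inter_preimage x hA.measurableSet)
            fun z hz => ?_).trans (lintegral_mono_set fun z hz => ?_)
          · refine ENNReal.ofReal_le_ofReal (hb z ?_ hz.1).le
            have := hz.2.2
            rwa [Set.mem_preimage, (extChartAt I x).right_inv hz.1] at this
          · have := hz.2.2
            rwa [Set.mem_preimage, (extChartAt I x).right_inv hz.1] at this
      _ < ⊤ := by
          rw [setLIntegral_const]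
          exact ENNReal.mul_lt_top ENNReal.ofReal_lt_top measure_ball_lt_top
  infer_instance

theorem IsVolumeForm.integrable [CompactSpace M] {w : Form I M n} (hw : IsVolumeForm w)
    {f : M → ℝ} (hf : Continuous f) : Integrable f (volumeMeasure w) := by
  have := hw.isFiniteMeasure
  obtain ⟨C, hC⟩ := isCompact_univ.exists_bound_of_continuousOn hf.continuousOn
  exact Integrable.of_bound hf.measurable.aestronglyMeasurable C
    (Filter.Eventually.of_forall fun x => hC x trivial)

theorem IsVolumeForm.vol_ne_zero [CompactSpace M] [Nonempty M] {w : Form I M n}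
    (hw : IsVolumeForm w) : vol w ≠ 0 := by
  have := hw.isFiniteMeasure
  have h1 : vol w = (volumeMeasure w).real Set.univ := by
    rw [vol, formIntegral]
    simp only [div_self (hw.coeff_ne_zero _)]
    simp
  rw [h1]
  intro h0
  rw [measureReal_eq_zero_iff, Measure.measure_univ_eq_zero] at h0
  obtain ⟨x⟩ := ‹Nonempty M›
  have h2 : chartMeasure w x Set.univ = 0 := by
    rw [← volumeMeasure_restrict_source, h0]
    simp
  rw [chartMeasure_apply w x MeasurableSet.univ, Set.preimage_univ, Set.inter_univ,
    setLIntegral_eq_zero_iff' (measurableSet_extChartAt_target x)] at h2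
  · have h3 : volume (extChartAt I x).target = 0 := by
      refine measure_mono_null ?_ h2
      intro y hy h
      have := h hy
      rw [ENNReal.ofReal_eq_zero] at this
      exact absurd (abs_nonpos_iff.1 this) (hw.inChart_ne_zero hy)
    have h4 := extChartAt_target_mem_nhdsWithin (I := I) x
    obtain ⟨V, hV, hxV, hsub⟩ := mem_nhdsWithin.1 h4
    have h5 := I.range_subset_closure_interior
      (extChartAt_target_subset_range x (mem_extChartAt_target (I := I) x))
    obtain ⟨z, hzV, hz⟩ := mem_closure_iff.1 h5 V hV hxV
    have h6 : 0 < volume (V ∩ interior (Set.range I)) :=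
      (hV.inter isOpen_interior).measure_pos _ ⟨z, hzV, hz⟩
    exact h6.ne' (measure_mono_null ((Set.inter_subset_inter_right _ interior_subset).trans hsub) h3)
  · exact (ENNReal.continuous_ofReal.comp_continuousOn (continuous_abs.comp_continuousOn
      (hw.isSmooth.continuousOn_inChart x _))).aemeasurable (measurableSet_extChartAt_target x)

variable [CompactSpace M]

/-- Integration of smooth top degree forms, as a linear map. -/
def formIntegralₗ {w : Form I M n} (hw : IsVolumeForm w) : smoothForms I M n →ₗ[ℝ] ℝ where
  toFun a := formIntegral w a
  map_add' a b := by
    have h : ∀ x, (a + b : Form I M n).coeff x / w.coeff x =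
        (a : Form I M n).coeff x / w.coeff x + (b : Form I M n).coeff x / w.coeff x := by
      intro x
      rw [← add_div]
      rfl
    change ∫ x, (a + b : Form I M n).coeff x / w.coeff x ∂(volumeMeasure w) = _
    simp only [h]
    exact integral_add (hw.integrable (hw.continuous_coeff_div a.2))
      (hw.integrable (hw.continuous_coeff_div b.2))
  map_smul' r a := by
    have h : ∀ x, (r • a : Form I M n).coeff x / w.coeff x =
        r * ((a : Form I M n).coeff x / w.coeff x) := by
      intro x
      rw [← mul_div_assoc]
      rfl
    change ∫ x, (r • a : Form I M n).coeff x / w.coeff x ∂(volumeMeasure w) = _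
    simp only [h]
    exact integral_const_mul _ _

/-- Integration of smooth functions against a volume form, as a linear map on `0`-forms. -/
def functionIntegralₗ {w : Form I M n} (hw : IsVolumeForm w) : smoothForms I M 0 →ₗ[ℝ] ℝ where
  toFun a := ∫ x, (a : Form I M 0).toFun x ∂(volumeMeasure w)
  map_add' a b := integral_add (hw.integrable (Form.IsSmooth.continuous_toFun a.2))
    (hw.integrable (Form.IsSmooth.continuous_toFun b.2))
  map_smul' _ _ := integral_const_mul _ _

theorem integral_pullback_toFun {w : Form I M n} {g : Diff I M} (hg : w.pullback I g = w)
    (f : Form I M 0) : ∫ x, (f.pullback I g).toFun x ∂(volumeMeasure w) =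
      ∫ x, f.toFun x ∂(volumeMeasure w) := by
  have h : ∀ x, (f.pullback I g).toFun x = f.toFun (g x) := fun x =>
    congrArg (show EuclideanSpace ℝ (Fin n) [⋀^Fin 0]→L[ℝ] ℝ from f _) (Subsingleton.elim _ _)
  simp only [h]
  have hgm : MeasurableEmbedding g := g.toHomeomorph.measurableEmbedding
  rw [← hgm.integral_map (μ := volumeMeasure w) f.toFun, volumeMeasure_map hg]

/-- Integration over `M` commutes with `δ`, for groups that preserve the volume form. -/
theorem d_functionIntegral {w : Form I M n} (hw : IsVolumeForm w) {G : Subgroup (Diff I M)}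
    (hG : ∀ g : G, w.pullback I (g : Diff I M) = w) {k : ℕ} {c : FormCochain G k 0}
    (hc : ∀ g, (c g).IsSmooth) :
    Cochain.d G k (fun g => formIntegral w ((c g).zeroWedge w)) =
      fun g => formIntegral w ((c.delta g).zeroWedge w) := by
  simp only [hw.formIntegral_zeroWedge]
  funext g
  have h := coboundary_map (act := fun (g : G) (α : Form I M 0) => α.pullback I (g : Diff I M))
    (act' := fun (_ : G) (a : ℝ) => a) (MonoidHom.id G)
    (smoothForms I M 0) (functionIntegralₗ hw)
    (fun g α hα => Form.IsSmooth.pullback hα (g : Diff I M).contMDiff)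
    (fun g α => integral_pullback_toFun (hG g) α)
    (fun g => ⟨c g, hc g⟩) g
  exact h.2.symm

end FormIntegral

/-! ### Forms near the boundary -/

section Boundary

variable {m : ℕ}

/-- The inclusion of `ℝᵐ` into `ℝᵐ⁺¹` as the hyperplane `y₀ = 0`. -/
def hyperplaneIncl (m : ℕ) : EuclideanSpace ℝ (Fin m) →L[ℝ] EuclideanSpace ℝ (Fin (m + 1)) :=
  LinearMap.toContinuousLinearMap
    { toFun := fun v => WithLp.toLp 2 (Fin.cons 0 v.ofLp)
      map_add' := fun u v => by
        ext k
        refine Fin.cases ?_ (fun k => ?_) k <;> simp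
      map_smul' := fun a v => by
        ext k
        refine Fin.cases ?_ (fun k => ?_) k <;> simp }

/-- The projection of `ℝᵐ⁺¹` to `ℝᵐ` that forgets `y₀`. -/
def hyperplaneProj (m : ℕ) : EuclideanSpace ℝ (Fin (m + 1)) →L[ℝ] EuclideanSpace ℝ (Fin m) :=
  LinearMap.toContinuousLinearMap
    { toFun := fun v => WithLp.toLp 2 fun k => v k.succ
      map_add' := fun _ _ => rfl
      map_smul' := fun _ _ => rfl }

@[simp] theorem hyperplaneIncl_zero (v : EuclideanSpace ℝ (Fin m)) : hyperplaneIncl m v 0 = 0 := rfl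

@[simp] theorem hyperplaneIncl_succ (v : EuclideanSpace ℝ (Fin m)) (k : Fin m) :
    hyperplaneIncl m v k.succ = v k := rfl

@[simp] theorem hyperplaneProj_apply (v : EuclideanSpace ℝ (Fin (m + 1))) (k : Fin m) :
    hyperplaneProj m v k = v k.succ := rfl

theorem hyperplaneIncl_proj {v : EuclideanSpace ℝ (Fin (m + 1))} (hv : v 0 = 0) :
    hyperplaneIncl m (hyperplaneProj m v) = v := by
  ext k
  refine Fin.cases ?_ (fun k => ?_) k
  · exact hv.symm
  · rfl

/-- The coordinate frame of the hyperplane `y₀ = 0`. -/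
abbrev tangentFrame (m : ℕ) : Fin m → EuclideanSpace ℝ (Fin (m + 1)) :=
  fun k => EuclideanSpace.single k.succ 1

theorem hyperplaneIncl_frame (k : Fin m) :
    hyperplaneIncl m (frame m k) = tangentFrame m k := by
  ext j
  refine Fin.cases ?_ (fun j => ?_) j
  · simp [tangentFrame, Fin.succ_ne_zero]
  · simp [tangentFrame, frame, Fin.succ_inj]

/-- An `m`-form on `ℝᵐ⁺¹` vanishes on the image of an isomorphism from `ℝᵐ` to the hyperplane
`y₀ = 0` if and only if it vanishes on the coordinate frame. -/
theorem compContinuousLinearMap_eq_zero_iff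
    (a : EuclideanSpace ℝ (Fin (m + 1)) [⋀^Fin m]→L[ℝ] ℝ)
    {D : EuclideanSpace ℝ (Fin m) →L[ℝ] EuclideanSpace ℝ (Fin (m + 1))}
    (hD : Function.Injective D) (hD₀ : ∀ v, D v 0 = 0) :
    a.compContinuousLinearMap D = 0 ↔ a (tangentFrame m) = 0 := by
  have hDA : D = (hyperplaneIncl m).comp ((hyperplaneProj m).comp D) := by
    ext1 v
    exact (hyperplaneIncl_proj (hD₀ v)).symm
  set A := (hyperplaneProj m).comp D with hA
  have hAinj : Function.Injective (A : EuclideanSpace ℝ (Fin m) →ₗ[ℝ] EuclideanSpace ℝ (Fin m)) := by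
    intro u v h
    apply hD
    rw [hDA]
    exact congrArg (hyperplaneIncl m) h
  have hdet : A.det ≠ 0 := by
    have := (LinearEquiv.ofInjectiveEndo _ hAinj).isUnit_det'
    exact this.ne_zero
  have h1 : (a.compContinuousLinearMap D) (frame m) = A.det * a (tangentFrame m) := by
    rw [hDA]
    change (a.compContinuousLinearMap (hyperplaneIncl m)).compContinuousLinearMap A (frame m) = _
    rw [compContinuousLinearMap_frame]
    congr 1
    change a (fun k => hyperplaneIncl m (frame m k)) = _
    simp only [hyperplaneIncl_frame]
  constructor
  · intro h
    rw [h] at h1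
    exact (mul_eq_zero.1 h1.symm).resolve_left hdet
  · intro h
    by_contra hne
    exact alternating_frame_ne_zero hne (by rw [h1, h, mul_zero])

variable {M : Type*} [TopologicalSpace M] [ChartedSpace (EuclideanHalfSpace (m + 1)) M]

theorem zero_le_of_mem_extChartAt_target (x₀ : M) {y : EuclideanSpace ℝ (Fin (m + 1))}
    (hy : y ∈ (extChartAt (𝓡∂ (m + 1)) x₀).target) : 0 ≤ y 0 := by
  have := extChartAt_target_subset_range x₀ hy
  rwa [range_modelWithCornersEuclideanHalfSpace] at this

theorem IsBoundaryInclusion.mdifferentiable {B : Type*} [TopologicalSpace B]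
    [ChartedSpace (EuclideanSpace ℝ (Fin m)) B] {i : B → M}
    (hi : IsBoundaryInclusion (𝓡∂ (m + 1)) (𝓡 m) i) :
    MDifferentiable (𝓡 m) (𝓡∂ (m + 1)) i :=
  hi.isSmoothEmbedding.contMDiff.mdifferentiable (by simp)

/-- The differential of an immersion is injective: an immersion has a smooth local left inverse. -/
theorem IsBoundaryInclusion.mfderiv_injective {B : Type*} [TopologicalSpace B]
    [ChartedSpace (EuclideanSpace ℝ (Fin m)) B] {i : B → M}
    (hi : IsBoundaryInclusion (𝓡∂ (m + 1)) (𝓡 m) i) (b : B) :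
    Function.Injective (mfderiv (𝓡 m) (𝓡∂ (m + 1)) i b) := by
  have him := hi.isSmoothEmbedding.isImmersion.isImmersionAt b
  set ρ : M → EuclideanSpace ℝ (Fin m) :=
    fun y => (him.equiv.symm (him.codChart.extend (𝓡∂ (m + 1)) y)).1 with hρ
  have hρs : MDifferentiableAt (𝓡∂ (m + 1)) 𝓘(ℝ, EuclideanSpace ℝ (Fin m)) ρ (i b) := by
    have h1 := him.codChart.contMDiffOn_extend him.codChart_mem_maximalAtlas
    have h2 : ContMDiff 𝓘(ℝ, EuclideanSpace ℝ (Fin (m + 1))) 𝓘(ℝ, EuclideanSpace ℝ (Fin m)) ∞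
        (fun v : EuclideanSpace ℝ (Fin (m + 1)) => (him.equiv.symm v).1) :=
      ContDiff.contMDiff (by fun_prop)
    exact ((h2.comp_contMDiffOn h1).contMDiffAt
      (him.codChart.open_source.mem_nhds him.mem_codChart_source)).mdifferentiableAt (by simp)
  have hρi : ∀ b' ∈ him.domChart.source, ρ (i b') = him.domChart.extend (𝓡 m) b' := by
    intro b' hb'
    have h3 := him.writtenInCharts ((him.domChart.extend (𝓡 m)).map_source
      (by rwa [him.domChart.extend_source]))
    simp only [Function.comp_apply] at h3
    rw [him.domChart.extend_left_inv hb'] at h3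
    rw [hρ]
    simp only
    rw [h3, ContinuousLinearEquiv.symm_apply_apply]
  set σ : M → B := fun y => (him.domChart.extend (𝓡 m)).symm (ρ y)
  have hb := him.mem_domChart_source
  have hσ : MDifferentiableAt (𝓡∂ (m + 1)) (𝓡 m) σ (i b) := by
    have h4 := contMDiffOn_extend_symm him.domChart_mem_maximalAtlas
    have h5 : ContMDiffAt 𝓘(ℝ, EuclideanSpace ℝ (Fin m)) (𝓡 m) ∞
        (him.domChart.extend (𝓡 m)).symm (ρ (i b)) := by
      refine h4.contMDiffAt ?_
      rw [← him.domChart.extend_target']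
      refine him.domChart.isOpen_extend_target.mem_nhds ?_
      rw [hρi b hb]
      exact (him.domChart.extend (𝓡 m)).map_source (by rwa [him.domChart.extend_source])
    exact (h5.mdifferentiableAt (by simp)).comp (i b) hρs
  have hσi : σ ∘ i =ᶠ[𝓝 b] id := by
    filter_upwards [him.domChart.open_source.mem_nhds hb] with b' hb'
    simp only [σ, Function.comp_apply, hρi b' hb', him.domChart.extend_left_inv hb', id]
  have hcomp : (mfderiv (𝓡∂ (m + 1)) (𝓡 m) σ (i b)).comp (mfderiv (𝓡 m) (𝓡∂ (m + 1)) i b) =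
      mfderiv (𝓡 m) (𝓡 m) (σ ∘ i) b := (mfderiv_comp b hσ (hi.mdifferentiable b)).symm
  intro u v h
  have h6 : ∀ u, mfderiv (𝓡∂ (m + 1)) (𝓡 m) σ (i b) (mfderiv (𝓡 m) (𝓡∂ (m + 1)) i b u) =
      (u : EuclideanSpace ℝ (Fin m)) := by
    intro u
    refine (DFunLike.congr_fun hcomp u).trans ?_
    refine (DFunLike.congr_fun hσi.mfderiv_eq u).trans ?_
    exact DFunLike.congr_fun (mfderiv_id (I := 𝓡 m) (x := b)) u
  exact (h6 u).symm.trans ((congrArg _ h).trans (h6 v))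

variable [IsManifold (𝓡∂ (m + 1)) ∞ M]

theorem mem_boundary_iff {x₀ x : M} (hx : x ∈ (extChartAt (𝓡∂ (m + 1)) x₀).source) :
    x ∈ (𝓡∂ (m + 1)).boundary M ↔ extChartAt (𝓡∂ (m + 1)) x₀ x 0 = 0 := by
  have h0 : 0 ≤ extChartAt (𝓡∂ (m + 1)) x₀ x 0 :=
    zero_le_of_mem_extChartAt_target x₀ ((extChartAt _ x₀).map_source hx)
  rw [extChartAt_source] at hx
  have h := (𝓡∂ (m + 1)).isInteriorPoint_iff_of_mem_atlas (n := ∞) (by simp)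
    (chart_mem_atlas (EuclideanHalfSpace (m + 1)) x₀) hx
  have h1 : extChartAt (𝓡∂ (m + 1)) x₀ x ∈ interior (Set.range (𝓡∂ (m + 1))) ↔
      0 < extChartAt (𝓡∂ (m + 1)) x₀ x 0 := by
    rw [interior_range_modelWithCornersEuclideanHalfSpace]
    rfl
  have h2 : (𝓡∂ (m + 1)).IsInteriorPoint x ↔ 0 < extChartAt (𝓡∂ (m + 1)) x₀ x 0 := by
    rw [← h1, h]
    exact ⟨fun h => OpenPartialHomeomorph.interior_extend_target_subset_interior_range _ h,
      fun h => (chartAt _ x₀).mem_interior_extend_target ((chartAt _ x₀).map_source hx) h⟩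
  change (𝓡∂ (m + 1)).IsBoundaryPoint x ↔ _
  rw [ModelWithCorners.isBoundaryPoint_iff_not_isInteriorPoint, h2, not_lt]
  exact ⟨fun h => le_antisymm h h0, fun h => h.le⟩

variable {B : Type*} [TopologicalSpace B] [ChartedSpace (EuclideanSpace ℝ (Fin m)) B]
  [IsManifold (𝓡 m) ∞ B] {i : B → M}

/-- The pullback of an `m`-form to the boundary vanishes at a point if and only if its coordinate
expression vanishes on the tangential coordinate frame. -/
theorem IsBoundaryInclusion.pullback_apply_eq_zero_iff
    (hi : IsBoundaryInclusion (𝓡∂ (m + 1)) (𝓡 m) i) (a : Form (𝓡∂ (m + 1)) M m) {b : B} {x₀ : M}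
    (hx : i b ∈ (extChartAt (𝓡∂ (m + 1)) x₀).source) :
    a.pullback (𝓡 m) i b = 0 ↔
      a.inChart x₀ (extChartAt (𝓡∂ (m + 1)) x₀ (i b)) (tangentFrame m) = 0 := by
  have : IsManifold (𝓡∂ (m + 1)) 1 M := IsManifold.of_le (n := ∞) (by simp)
  have : IsManifold (𝓡 m) 1 B := IsManifold.of_le (n := ∞) (by simp)
  have hyt := mem_extChartAt_target (I := 𝓡 m) b
  have hb : (extChartAt (𝓡 m) b).symm (extChartAt (𝓡 m) b b) = b := extChartAt_to_inv b
  have hx' : i ((extChartAt (𝓡 m) b).symm (extChartAt (𝓡 m) b b)) ∈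
      (extChartAt (𝓡∂ (m + 1)) x₀).source := by rwa [hb]
  have h1 := a.inChart_pullback (f := i) (J := 𝓡 m) hyt (hi.mdifferentiable _) hx'
  have h2 := fderivWithin_writtenInCharts (I := 𝓡∂ (m + 1)) hyt (hi.mdifferentiable _) hx'
  rw [Form.inChart_self] at h1
  set τ := extChartAt (𝓡∂ (m + 1)) x₀ ∘ i ∘ (extChartAt (𝓡 m) b).symm with hτ
  set y := extChartAt (𝓡 m) b b
  set D := fderivWithin ℝ τ (Set.range (𝓡 m)) y with hDdef
  have hDinj : Function.Injective D := by
    rw [hDdef, ← mfderivWithin_eq_fderivWithin, h2]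
    have i1 := (isInvertible_mfderiv_extChartAt hx').bijective.injective
    have i2 := hi.mfderiv_injective ((extChartAt (𝓡 m) b).symm y)
    have i3 := (isInvertible_mfderivWithin_extChartAt_symm hyt).bijective.injective
    exact i1.comp (i2.comp i3)
  have hyr : y ∈ Set.range (𝓡 m) := extChartAt_target_subset_range _ hyt
  have hτd : DifferentiableWithinAt ℝ τ (Set.range (𝓡 m)) y :=
    (contDiffWithinAt_writtenInCharts (I := 𝓡∂ (m + 1)) hyt
      hi.isSmoothEmbedding.contMDiff.contMDiffAt hx').differentiableWithinAt (by simp)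
  have hD₀ : ∀ v, D v 0 = 0 := by
    intro v
    let p : EuclideanSpace ℝ (Fin (m + 1)) →L[ℝ] ℝ := EuclideanSpace.proj 0
    have h3 : HasFDerivWithinAt (p ∘ τ) (p.comp D) (Set.range (𝓡 m)) y :=
      p.hasFDerivAt.comp_hasFDerivWithinAt y hτd.hasFDerivWithinAt
    have hc : ContinuousWithinAt (i ∘ (extChartAt (𝓡 m) b).symm) (Set.range (𝓡 m)) y :=
      hi.isSmoothEmbedding.contMDiff.continuous.continuousAt.comp_continuousWithinAt
        (contMDiffWithinAt_extChartAt_symm_range (n := ∞) b hyt).continuousWithinAt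
    have h4 : p ∘ τ =ᶠ[𝓝[Set.range (𝓡 m)] y] fun _ => 0 := by
      filter_upwards [hc ((isOpen_extChartAt_source (I := 𝓡∂ (m + 1)) x₀).mem_nhds hx')] with z hz
      refine (mem_boundary_iff hz).1 ?_
      rw [← hi.range_eq]
      exact ⟨_, rfl⟩
    have h5 : HasFDerivWithinAt (p ∘ τ)
        (0 : EuclideanSpace ℝ (Fin m) →L[ℝ] ℝ) (Set.range (𝓡 m)) y :=
      (hasFDerivWithinAt_const (0 : ℝ) y _).congr_of_eventuallyEq h4 (h4.self_of_nhdsWithin hyr)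
    exact DFunLike.congr_fun ((𝓡 m).uniqueDiffOn.eq hyr h3 h5) v
  rw [← hb, ← compContinuousLinearMap_eq_zero_iff _ hDinj hD₀, hb]
  rw [hb] at h1
  rw [← h1]
  exact Iff.rfl

end Boundary

/-! ### Stokes' theorem for forms that vanish along the boundary -/

section HalfSpace

open MeasureTheory

variable {m : ℕ}

theorem fderivWithin_eq_zero_of_notMem {E F : Type*} [NormedAddCommGroup E] [NormedSpace ℝ E]
    [NormedAddCommGroup F] [NormedSpace ℝ F] {f : E → F} {s K : Set E} (hK : IsClosed K)
    (hf : ∀ y ∉ K, f y = 0) {y : E} (hy : y ∉ K) : fderivWithin ℝ f s y = 0 := by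
  have h : f =ᶠ[𝓝 y] fun _ => 0 := by
    filter_upwards [hK.isOpen_compl.mem_nhds hy] with z hz using hf z hz
  rw [(h.filter_mono nhdsWithin_le_nhds).fderivWithin_eq h.self_of_nhds]
  exact fderivWithin_const_apply (0 : F)

/-- The divergence theorem on a half-space, for compactly supported vector fields that are tangent
to the boundary. -/
theorem integral_divergence_halfSpace {f : Fin (m + 1) → EuclideanSpace ℝ (Fin (m + 1)) → ℝ}
    {K : Set (EuclideanSpace ℝ (Fin (m + 1)))}
    (hf : ∀ k, ContDiffOn ℝ ∞ (f k) (Set.range (𝓡∂ (m + 1)))) (hK : IsCompact K)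
    (hfK : ∀ k, ∀ y ∉ K, f k y = 0) (hf₀ : ∀ y, y 0 = 0 → f 0 y = 0) :
    ∫ y in Set.range (𝓡∂ (m + 1)), ∑ k, fderivWithin ℝ (f k) (Set.range (𝓡∂ (m + 1))) y
      (frame (m + 1) k) = 0 := by
  set R := Set.range (𝓡∂ (m + 1)) with hR
  have hRe : R = {y | 0 ≤ y 0} := range_modelWithCornersEuclideanHalfSpace _
  have hRU : UniqueDiffOn ℝ R := (𝓡∂ (m + 1)).uniqueDiffOn
  obtain ⟨C, hC⟩ := hK.isBounded.exists_norm_le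
  set r : ℝ := max C 0 + 1 with hr
  have hr0 : 0 < r := by positivity
  have hKr : ∀ y : EuclideanSpace ℝ (Fin (m + 1)), ∀ k, r ≤ |y k| → y ∉ K := by
    intro y k h hy
    have h1 := (PiLp.norm_apply_le y k).trans (hC y hy)
    rw [Real.norm_eq_abs] at h1
    have := le_max_left C 0
    linarith
  set T : (Fin (m + 1) → ℝ) ≃L[ℝ] EuclideanSpace ℝ (Fin (m + 1)) :=
    (EuclideanSpace.equiv (Fin (m + 1)) ℝ).symm with hT
  have hTa : ∀ x k, T x k = x k := fun _ _ => rfl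
  set D : EuclideanSpace ℝ (Fin (m + 1)) → ℝ := fun y =>
    ∑ k, fderivWithin ℝ (f k) R y (frame (m + 1) k) with hD
  have hDK : ∀ y ∉ K, D y = 0 := by
    intro y hy
    simp only [hD]
    refine Finset.sum_eq_zero fun k _ => ?_
    rw [fderivWithin_eq_zero_of_notMem hK.isClosed (hfK k) hy]
    rfl
  set a : Fin (m + 1) → ℝ := Fin.cons 0 fun _ => -r with ha
  set b : Fin (m + 1) → ℝ := fun _ => r with hb
  have hab : a ≤ b := by
    intro k
    refine Fin.cases ?_ (fun k => ?_) k
    · exact hr0.le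
    · change -r ≤ r
      linarith
  have hsub : Set.Icc a b ⊆ T ⁻¹' R := by
    intro x hx
    rw [hRe]
    exact hx.1 0
  have hDc : ContinuousOn D R := by
    refine continuousOn_finsetSum _ fun k _ => ?_
    exact ((hf k).continuousOn_fderivWithin hRU (by simp)).clm_apply continuousOn_const
  have h1 : ∫ y in R, D y = ∫ x in Set.Icc a b, D (T x) := by
    have hmp : MeasurePreserving T := PiLp.volume_preserving_toLp (Fin (m + 1))
    rw [← hmp.setIntegral_preimage_emb T.toHomeomorph.measurableEmbedding]
    refine setIntegral_eq_of_subset_of_forall_sdiff_eq_zero ?_ hsub ?_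
    · exact (T.continuous.measurable (𝓡∂ (m + 1)).isClosed_range.measurableSet)
    · rintro x ⟨hx, hx'⟩
      by_contra hne
      apply hx'
      have hxK : T x ∈ K := by
        by_contra h
        exact hne (hDK _ h)
      have h2 : ∀ k, |x k| < r := fun k => by
        by_contra h
        exact hKr (T x) k (not_lt.1 h) hxK
      rw [hRe] at hx
      refine ⟨fun k => ?_, fun k => (abs_lt.1 (h2 k)).2.le⟩
      refine Fin.cases ?_ (fun k => ?_) k
      · exact hx
      · exact (abs_lt.1 (h2 k.succ)).1.le
  have hTm : Set.MapsTo T (Set.Icc a b) R := hsub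
  rw [h1]
  have key := integral_divergence_of_hasFDerivAt_off_countable' a b hab (fun k x => f k (T x))
    (fun k x => (fderivWithin ℝ (f k) R (T x)).comp (T : (Fin (m + 1) → ℝ) →L[ℝ] _)) ∅
    Set.countable_empty (fun k => (hf k).continuousOn.comp T.continuous.continuousOn hTm) ?_ ?_
  · have hTe : ∀ k : Fin (m + 1), T (Pi.single k 1) = frame (m + 1) k := fun k => rfl
    simp only [ContinuousLinearMap.comp_apply, ContinuousLinearEquiv.coe_coe, hTe] at key
    rw [show (∫ x in Set.Icc a b, D (T x)) = _ from key]
    refine Finset.sum_eq_zero fun k _ => ?_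
    have e1 : ∀ x, f k (T (k.insertNth (b k) x)) = 0 := by
      intro x
      refine hfK k _ (hKr _ k ?_)
      rw [hTa, Fin.insertNth_apply_same]
      exact le_abs_self _
    have e2 : ∀ x, f k (T (k.insertNth (a k) x)) = 0 := by
      intro x
      refine Fin.cases (motive := fun k => ∀ x, f k (T (k.insertNth (a k) x)) = 0) ?_ ?_ k x
      · intro x
        refine hf₀ _ ?_
        rw [hTa, Fin.insertNth_apply_same]
        rfl
      · intro k x
        refine hfK k.succ _ (hKr _ k.succ ?_)
        rw [hTa, Fin.insertNth_apply_same]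
        change r ≤ |-r|
        rw [abs_neg]
        exact le_abs_self _
    simp only [e1, e2, sub_self]
  · rintro x ⟨hx, -⟩ k
    have hx0 : R ∈ 𝓝 (T x) := by
      have : IsOpen {y : EuclideanSpace ℝ (Fin (m + 1)) | 0 < y 0} :=
        isOpen_lt continuous_const (by fun_prop)
      refine Filter.mem_of_superset (this.mem_nhds (hx 0 trivial).1) fun y hy => ?_
      rw [hRe]
      exact (show 0 < y 0 from hy).le
    have h3 : HasFDerivAt (f k) (fderivWithin ℝ (f k) R (T x)) (T x) :=
      (((hf k).differentiableOn (by simp)) _ (mem_of_mem_nhds hx0)).hasFDerivWithinAt.hasFDerivAt hx0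
    exact h3.comp x T.hasFDerivAt
  · refine ContinuousOn.integrableOn_compact isCompact_Icc ?_
    exact hDc.comp T.continuous.continuousOn hTm

/-- Stokes' theorem on a half-space, for compactly supported forms that vanish along the
boundary. -/
theorem integral_extDerivWithin_halfSpace
    {F : EuclideanSpace ℝ (Fin (m + 1)) → EuclideanSpace ℝ (Fin (m + 1)) [⋀^Fin m]→L[ℝ] ℝ}
    {K : Set (EuclideanSpace ℝ (Fin (m + 1)))}
    (hF : ContDiffOn ℝ ∞ F (Set.range (𝓡∂ (m + 1)))) (hK : IsCompact K)
    (hFK : ∀ y ∉ K, F y = 0) (hF₀ : ∀ y, y 0 = 0 → F y (tangentFrame m) = 0) :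
    ∫ y in Set.range (𝓡∂ (m + 1)), extDerivWithin F (Set.range (𝓡∂ (m + 1))) y
      (frame (m + 1)) = 0 := by
  have hval : ∀ v, ContDiffOn ℝ ∞ (fun y => F y v) (Set.range (𝓡∂ (m + 1))) := fun v y hy =>
    contDiffWithinAt_alternating_iff.1 (hF y hy) v
  rw [← integral_divergence_halfSpace (m := m)
    (f := fun k y => (-1 : ℝ) ^ (k : ℕ) • F y (k.removeNth (frame (m + 1)))) (K := K)
    (fun k => (hval _).const_smul _) hK]
  · refine setIntegral_congr_fun (𝓡∂ (m + 1)).isClosed_range.measurableSet fun y hy => ?_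
    have hU := (𝓡∂ (m + 1)).uniqueDiffOn y hy
    rw [extDerivWithin_apply ((hF y hy).differentiableWithinAt (by simp)) hU]
    refine Finset.sum_congr rfl fun k _ => ?_
    rw [fderivWithin_fun_const_smul hU (((hval _) y hy).differentiableWithinAt (by simp))]
    rw [smul_apply, zsmul_eq_mul, smul_eq_mul]
    push_cast
    rfl
  · intro k y hy
    rw [hFK y hy]
    simp
  · intro y hy
    have h : (0 : Fin (m + 1)).removeNth (frame (m + 1)) = tangentFrame m := by
      funext k
      simp [Fin.removeNth]
    rw [h, hF₀ y hy, smul_zero]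

end HalfSpace

/-! ### Forms supported in the domain of a chart -/

section Support

variable {E H : Type*} [NormedAddCommGroup E] [NormedSpace ℝ E] [TopologicalSpace H]
  {I : ModelWithCorners ℝ E H} {M : Type*} [TopologicalSpace M] [ChartedSpace H M]
  {l : ℕ}

theorem Form.inChart_eq_zero {α : Form I M l} {x₀ : M} {y : E}
    (h : α ((extChartAt I x₀).symm y) = 0) : α.inChart x₀ y = 0 := by
  rw [Form.inChart, h]
  rfl

theorem Form.inChart_eventually_eq_zero {α : Form I M l} {C : Set M} (hC : IsClosed C)
    (hα : ∀ x ∉ C, α x = 0) {x₀ x : M} (hx₀ : x ∈ (extChartAt I x₀).source) (hx : x ∉ C) :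
    α.inChart x₀ =ᶠ[𝓝[Set.range I] (extChartAt I x₀ x)] fun _ => 0 := by
  have h1 : ContinuousAt (extChartAt I x₀).symm (extChartAt I x₀ x) :=
    continuousAt_extChartAt_symm' hx₀
  have h2 : Cᶜ ∈ 𝓝 ((extChartAt I x₀).symm (extChartAt I x₀ x)) := by
    rw [(extChartAt I x₀).left_inv hx₀]
    exact hC.isOpen_compl.mem_nhds hx
  filter_upwards [nhdsWithin_le_nhds (h1 h2)] with y hy
  exact Form.inChart_eq_zero (hα _ hy)

theorem extDerivWithin_eq_zero_of_eventuallyEq {F : E → E [⋀^Fin l]→L[ℝ] ℝ} {s : Set E} {y : E}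
    (hy : y ∈ s) (h : F =ᶠ[𝓝[s] y] fun _ => 0) : extDerivWithin F s y = 0 := by
  rw [h.extDerivWithin_eq_of_mem hy, extDerivWithin,
    fderivWithin_const_apply (0 : E [⋀^Fin l]→L[ℝ] ℝ)]
  exact map_zero (ContinuousAlternatingMap.alternatizeUncurryFinCLM ℝ E ℝ (n := l))

/-- The exterior derivative does not enlarge supports. -/
theorem Form.extD_eq_zero_of_notMem [IsManifold I ∞ M] {α : Form I M l} {C : Set M}
    (hC : IsClosed C) (hα : ∀ x ∉ C, α x = 0) {x : M} (hx : x ∉ C) : α.extD x = 0 := by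
  refine (Form.extD_apply α x).trans (extDerivWithin_eq_zero_of_eventuallyEq ⟨_, rfl⟩ ?_)
  exact Form.inChart_eventually_eq_zero hC hα (mem_extChartAt_source x) hx

/-- The coordinate expression of a form in the preferred chart at `x₀`, extended by zero outside of
the target of the chart. -/
def Form.inChartExt (α : Form I M l) (x₀ : M) : E → E [⋀^Fin l]→L[ℝ] ℝ :=
  (extChartAt I x₀).target.indicator (α.inChart x₀)

theorem Form.inChartExt_of_mem (α : Form I M l) {x₀ : M} {y : E}
    (hy : y ∈ (extChartAt I x₀).target) : α.inChartExt x₀ y = α.inChart x₀ y :=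
  Set.indicator_of_mem hy _

theorem Form.inChartExt_of_notMem {α : Form I M l} {x₀ : M} {C : Set M}
    (hα : ∀ x ∉ C, α x = 0) {y : E} (hy : y ∉ extChartAt I x₀ '' C) : α.inChartExt x₀ y = 0 := by
  by_cases h : y ∈ (extChartAt I x₀).target
  · rw [Form.inChartExt_of_mem _ h]
    refine Form.inChart_eq_zero (hα _ fun hC => hy ⟨_, hC, (extChartAt I x₀).right_inv h⟩)
  · exact Set.indicator_of_notMem h _

theorem Form.IsSmooth.contDiffOn_inChartExt {α : Form I M l} (hα : α.IsSmooth) {x₀ : M} {C : Set M}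
    (hC : IsCompact C) (hC₀ : C ⊆ (extChartAt I x₀).source) (hαC : ∀ x ∉ C, α x = 0) :
    ContDiffOn ℝ ∞ (α.inChartExt x₀) (Set.range I) := by
  intro y hy
  by_cases h : y ∈ (extChartAt I x₀).target
  · refine (hα.contDiffWithinAt h).congr_of_eventuallyEq ?_ (Form.inChartExt_of_mem _ h)
    filter_upwards [extChartAt_target_mem_nhdsWithin_of_mem h] with z hz
    exact Form.inChartExt_of_mem _ hz
  · have hK : IsClosed (extChartAt I x₀ '' C) :=
      (hC.image_of_continuousOn ((continuousOn_extChartAt x₀).mono hC₀)).isClosed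
    have hyK : y ∉ extChartAt I x₀ '' C := by
      rintro ⟨x, hx, rfl⟩
      exact h ((extChartAt I x₀).map_source (hC₀ hx))
    refine (contDiffWithinAt_const (c := (0 : E [⋀^Fin l]→L[ℝ] ℝ))).congr_of_eventuallyEq ?_
      (Form.inChartExt_of_notMem hαC hyK)
    filter_upwards [nhdsWithin_le_nhds (hK.isOpen_compl.mem_nhds hyK)] with z hz
    exact Form.inChartExt_of_notMem hαC hz

open Classical in
/-- The form on `M` with coordinate expression `F` in the preferred chart at `x₀`, extended by zero
outside of the domain of the chart. -/
def Form.ofChart (I : ModelWithCorners ℝ E H) (x₀ : M) (F : E → E [⋀^Fin l]→L[ℝ] ℝ) :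
    Form I M l := fun x =>
  if x ∈ (extChartAt I x₀).source then
    (F (extChartAt I x₀ x)).compContinuousLinearMap (mfderiv I 𝓘(ℝ, E) (extChartAt I x₀) x)
  else 0

theorem Form.ofChart_eq_zero {x₀ : M} {F : E → E [⋀^Fin l]→L[ℝ] ℝ} {K : Set E}
    (hF : ∀ y ∈ Set.range I, y ∉ K → F y = 0) {x : M} (hx : x ∉ (extChartAt I x₀).symm '' K) :
    Form.ofChart I x₀ F x = 0 := by
  by_cases h : x ∈ (extChartAt I x₀).source
  · have h0 : F (extChartAt I x₀ x) = 0 := hF _ ⟨chartAt H x₀ x, rfl⟩ fun hK =>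
      hx ⟨_, hK, (extChartAt I x₀).left_inv h⟩
    rw [Form.ofChart, if_pos h, h0]
    rfl
  · rw [Form.ofChart, if_neg h]

variable [IsManifold I ∞ M]

theorem Form.inChart_ofChart {x₀ : M} (F : E → E [⋀^Fin l]→L[ℝ] ℝ) {y : E}
    (hy : y ∈ (extChartAt I x₀).target) : (Form.ofChart I x₀ F).inChart x₀ y = F y := by
  have : IsManifold I 1 M := IsManifold.of_le (n := ∞) (by simp)
  have h := mfderiv_extChartAt_comp_mfderivWithin_extChartAt_symm (I := I) hy
  rw [Form.inChart, Form.ofChart, if_pos ((extChartAt I x₀).map_target hy)]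
  ext v
  refine Eq.trans ?_ (congrArg (fun z => F z v) ((extChartAt I x₀).right_inv hy))
  refine congrArg (F _) ?_
  funext k
  exact DFunLike.congr_fun h (v k)

theorem Form.isSmooth_ofChart [FiniteDimensional ℝ E] [T2Space M] {x₀ : M}
    {F : E → E [⋀^Fin l]→L[ℝ] ℝ} (hF : ContDiffOn ℝ ∞ F (Set.range I)) {K : Set E}
    (hK : IsCompact K) (hK₀ : K ⊆ (extChartAt I x₀).target) (hFK : ∀ y ∈ Set.range I, y ∉ K → F y = 0) :
    (Form.ofChart I x₀ F).IsSmooth := by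
  have hC : IsClosed ((extChartAt I x₀).symm '' K) :=
    (hK.image_of_continuousOn ((continuousOn_extChartAt_symm x₀).mono hK₀)).isClosed
  refine Form.isSmooth_of_forall_exists fun x => ?_
  by_cases hx : x ∈ (extChartAt I x₀).source
  · refine ⟨x₀, hx, (hF _ ⟨_, rfl⟩).congr_of_eventuallyEq ?_
      (Form.inChart_ofChart F ((extChartAt I x₀).map_source hx))⟩
    filter_upwards [extChartAt_target_mem_nhdsWithin_of_mem ((extChartAt I x₀).map_source hx)]
      with z hz
    exact Form.inChart_ofChart F hz
  · have hxC : x ∉ (extChartAt I x₀).symm '' K := by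
      rintro ⟨y, hy, rfl⟩
      exact hx ((extChartAt I x₀).map_target (hK₀ hy))
    have h := Form.inChart_eventually_eq_zero (I := I) (α := Form.ofChart I x₀ F) hC
      (fun z hz => Form.ofChart_eq_zero hFK hz)
      (mem_extChartAt_source x) hxC
    exact ⟨x, mem_extChartAt_source x, contDiffWithinAt_const.congr_of_eventuallyEq h
      (h.self_of_nhdsWithin ⟨_, rfl⟩)⟩

/-- An additive property of smooth forms holds for all of them if it holds locally. -/
theorem Form.mem_of_forall_exists_isOpen [FiniteDimensional ℝ E] [T2Space M] [CompactSpace M]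
    (S : Submodule ℝ (Form I M l)) {α : Form I M l}
    (h : ∀ x, ∃ U : Set M, IsOpen U ∧ x ∈ U ∧ ∀ f : M → ℝ, ContMDiff I 𝓘(ℝ, ℝ) ∞ f →
      tsupport f ⊆ U → α.fmul f ∈ S) : α ∈ S := by
  choose U hU hxU hS using h
  obtain ⟨ρ, hρ⟩ := SmoothPartitionOfUnity.exists_isSubordinate I isClosed_univ U hU
    (fun x _ => Set.mem_iUnion.2 ⟨x, hxU x⟩)
  have hfin : (Function.support fun k => (ρ k : M → ℝ)).Finite := by
    have := ρ.locallyFinite.finite_nonempty_of_compact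
    refine this.subset fun k hk => ?_
    exact Function.support_nonempty_iff.2 hk
  have hsum : α = ∑ k ∈ hfin.toFinset, α.fmul (ρ k) := by
    funext x
    rw [Finset.sum_apply]
    have h1 : ∑ k ∈ hfin.toFinset, ρ k x = 1 := by
      rw [← ρ.sum_eq_one (Set.mem_univ x)]
      refine (finsum_eq_sum_of_support_subset _ fun k hk => ?_).symm
      rw [Set.Finite.coe_toFinset]
      intro h0
      exact hk (congrFun h0 x)
    have h2 : ∑ k ∈ hfin.toFinset, (α.fmul (ρ k)) x = (∑ k ∈ hfin.toFinset, ρ k x) • α x :=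
      (Finset.sum_smul).symm
    rw [h2, h1, one_smul]
  rw [hsum]
  exact S.sum_mem fun k _ => hS k (ρ k) (ρ k).contMDiff (hρ k)

end Support

section Stokes

open MeasureTheory

variable {m : ℕ} {M : Type*} [TopologicalSpace M] [ChartedSpace (EuclideanHalfSpace (m + 1)) M]
  [IsManifold (𝓡∂ (m + 1)) ∞ M] [MeasurableSpace M] [BorelSpace M] [CompactSpace M]

/-- The case of a form `β` supported in the domain of one chart, in which the density of `w` has
constant sign `s`: the integral of `dβ` is `s` times the integral of an exterior derivative over the
half-space, and the tangential coefficient of `β` vanishes on the hyperplane. -/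
theorem IsVolumeForm.formIntegral_extD_eq_zero_of_subset
    {w : Form (𝓡∂ (m + 1)) M (m + 1)} (hw : IsVolumeForm w) {β : Form (𝓡∂ (m + 1)) M m}
    (hβ : β.IsSmooth) {x₀ : M} {C : Set M} (hC : IsClosed C)
    (hC₀ : C ⊆ (extChartAt (𝓡∂ (m + 1)) x₀).source) (hβC : ∀ x ∉ C, β x = 0) {s : ℝ}
    (hs : ∀ x ∈ C, |w.inChart x₀ (extChartAt (𝓡∂ (m + 1)) x₀ x) (frame (m + 1))| =
      s * w.inChart x₀ (extChartAt (𝓡∂ (m + 1)) x₀ x) (frame (m + 1)))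
    (hβ₀ : ∀ y, y 0 = 0 → β.inChartExt x₀ y (tangentFrame m) = 0) :
    formIntegral w β.extD = 0 := by
  set e := extChartAt (𝓡∂ (m + 1)) x₀ with he
  have hdC : ∀ x ∉ C, β.extD x = 0 := fun x hx => Form.extD_eq_zero_of_notMem hC hβC hx
  have hcoeff : ∀ x ∉ C, β.extD.coeff x = 0 := by
    intro x hx
    rw [Form.coeff_eq, hdC x hx]
    rfl
  have h1 : formIntegral w β.extD =
      ∫ x, β.extD.coeff x / w.coeff x ∂(chartMeasure w x₀) := by
    rw [← volumeMeasure_restrict_source]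
    refine (setIntegral_eq_integral_of_forall_compl_eq_zero fun x hx => ?_).symm
    rw [hcoeff x fun h => hx (hC₀ h), zero_div]
  rw [h1, integral_chartMeasure w x₀ (hw.continuous_coeff_div hβ.extD).aestronglyMeasurable
    (hw.isSmooth x₀).continuousOn]
  have hK : IsCompact (e '' C) :=
    hC.isCompact.image_of_continuousOn ((continuousOn_extChartAt x₀).mono hC₀)
  have hFs := hβ.contDiffOn_inChartExt hC.isCompact hC₀ hβC
  have hFK : ∀ y ∉ e '' C, β.inChartExt x₀ y = 0 := fun y hy => Form.inChartExt_of_notMem hβC hy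
  have h2 : ∀ y ∈ e.target, |w.inChart x₀ y (frame (m + 1))| *
      (β.extD.coeff (e.symm y) / w.coeff (e.symm y)) =
      s * extDerivWithin (β.inChartExt x₀) (Set.range (𝓡∂ (m + 1))) y (frame (m + 1)) := by
    intro y hy
    have h3 : extDerivWithin (β.inChartExt x₀) (Set.range (𝓡∂ (m + 1))) y =
        β.extD.inChart x₀ y := by
      rw [Form.inChart_extD hβ hy]
      refine Filter.EventuallyEq.extDerivWithin_eq ?_ (Form.inChartExt_of_mem _ hy)
      filter_upwards [extChartAt_target_mem_nhdsWithin_of_mem hy] with z hz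
      exact Form.inChartExt_of_mem _ hz
    rw [h3]
    by_cases hyC : e.symm y ∈ C
    · have h4 := hs _ hyC
      have h5 := hw.coeff_div β.extD x₀ (hC₀ hyC)
      rw [e.right_inv hy] at h4 h5
      have h6 := hw.inChart_ne_zero hy
      rw [h4, h5]
      field_simp
    · rw [hcoeff _ hyC, Form.inChart_eq_zero (hdC _ hyC)]
      simp
  rw [setIntegral_congr_fun (measurableSet_extChartAt_target x₀) h2, integral_const_mul]
  have h7 : ∫ y in e.target, extDerivWithin (β.inChartExt x₀) (Set.range (𝓡∂ (m + 1))) y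
      (frame (m + 1)) = ∫ y in Set.range (𝓡∂ (m + 1)),
        extDerivWithin (β.inChartExt x₀) (Set.range (𝓡∂ (m + 1))) y (frame (m + 1)) := by
    refine (setIntegral_eq_of_subset_of_forall_sdiff_eq_zero
      (𝓡∂ (m + 1)).isClosed_range.measurableSet (extChartAt_target_subset_range x₀) ?_).symm
    rintro y ⟨hy, hy'⟩
    have hyK : y ∉ e '' C := by
      rintro ⟨x, hx, rfl⟩
      exact hy' (e.map_source (hC₀ hx))
    rw [extDerivWithin_eq_zero_of_eventuallyEq hy]
    · rfl
    · filter_upwards [nhdsWithin_le_nhds (hK.isClosed.isOpen_compl.mem_nhds hyK)] with z hz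
      exact hFK z hz
  rw [h7, integral_extDerivWithin_halfSpace hFs hK hFK hβ₀, mul_zero]

variable {B : Type*} [TopologicalSpace B] [ChartedSpace (EuclideanSpace ℝ (Fin m)) B]
  [IsManifold (𝓡 m) ∞ B] {i : B → M}

/-- The integral of the exterior derivative of a form that vanishes on the boundary is zero. -/
theorem IsVolumeForm.formIntegral_extD_eq_zero [T2Space M]
    (hi : IsBoundaryInclusion (𝓡∂ (m + 1)) (𝓡 m) i)
    {w : Form (𝓡∂ (m + 1)) M (m + 1)} (hw : IsVolumeForm w) {β : Form (𝓡∂ (m + 1)) M m}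
    (hβ : β.IsRelative (𝓡 m) i) : formIntegral w β.extD = 0 := by
  let L : smoothForms (𝓡∂ (m + 1)) M m →ₗ[ℝ] smoothForms (𝓡∂ (m + 1)) M (m + 1) :=
    (extDₗ (𝓡∂ (m + 1)) M m).codRestrict _ fun α => Form.IsSmooth.extD α.2
  suffices h : β ∈ (LinearMap.ker ((formIntegralₗ hw).comp L)).map (Submodule.subtype _) by
    obtain ⟨α, hα, rfl⟩ := h
    exact hα
  refine Form.mem_of_forall_exists_isOpen _ fun x₀ => ?_
  set e := extChartAt (𝓡∂ (m + 1)) x₀ with he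
  set v : M → ℝ := fun x => w.inChart x₀ (e x) (frame (m + 1)) with hv
  have hvc : ContinuousOn v e.source :=
    (hw.isSmooth.continuousOn_inChart x₀ _).comp (continuousOn_extChartAt x₀) e.mapsTo
  -- On a neighbourhood of `x₀`, the sign of the density of `w` is constant.
  refine ⟨e.source ∩ (fun x => v x * v x₀) ⁻¹' Set.Ioi 0,
    (hvc.mul continuousOn_const).isOpen_inter_preimage (isOpen_extChartAt_source x₀) isOpen_Ioi,
    ⟨mem_extChartAt_source x₀, ?_⟩, fun f hf hfU => ?_⟩
  · exact mul_self_pos.2 (hw.inChart_ne_zero (mem_extChartAt_target x₀))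
  have hfβ : (β.fmul f).IsSmooth := Form.IsSmooth.fmul hf hβ.1
  refine ⟨⟨β.fmul f, hfβ⟩, ?_, rfl⟩
  have hzero : ∀ x ∉ tsupport f, β.fmul f x = 0 := by
    intro x hx
    rw [Form.fmul, image_eq_zero_of_notMem_tsupport hx]
    exact zero_smul ℝ (β x)
  refine hw.formIntegral_extD_eq_zero_of_subset (x₀ := x₀) (s := SignType.sign (v x₀)) hfβ
    (isClosed_tsupport f) (fun x hx => (hfU hx).1) hzero (fun x hx => ?_) fun y hy => ?_
  · have h1 : 0 < v x * v x₀ := (hfU hx).2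
    change |v x| = _ * v x
    rcases lt_trichotomy (v x₀) 0 with h | h | h
    · rw [sign_neg h, abs_of_neg (neg_of_mul_pos_left h1 h.le)]
      simp
    · rw [h, mul_zero] at h1
      exact absurd h1 (lt_irrefl _)
    · rw [sign_pos h, abs_of_pos (pos_of_mul_pos_left h1 h.le)]
      simp
  · by_cases hyt : y ∈ e.target
    · rw [Form.inChartExt_of_mem _ hyt]
      have h1 : e.symm y ∈ (𝓡∂ (m + 1)).boundary M := by
        rw [mem_boundary_iff (e.map_target hyt), ← he, e.right_inv hyt, hy]
      rw [← hi.range_eq] at h1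
      obtain ⟨b, hb⟩ := h1
      have h2 := (hi.pullback_apply_eq_zero_iff β (x₀ := x₀) (b := b)
        (by rw [hb]; exact e.map_target hyt)).1 (congrFun hβ.2 b)
      rw [hb, ← he, e.right_inv hyt] at h2
      rw [Form.inChart_fmul]
      change f _ * (β.inChart x₀ y) (tangentFrame m) = 0
      rw [h2, mul_zero]
    · rw [Form.inChartExt, Set.indicator_of_notMem hyt]
      rfl

end Stokes

/-! ### The compactly supported Poincaré lemma on `ℝᵐ` -/

section Poincare

open MeasureTheory Convolution

variable {V : Type*} [NormedAddCommGroup V] [NormedSpace ℝ V]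

/-- Integrating a smooth function along the lines in direction `e`, with a weight `p`, gives a
smooth function if the function has bounded support in the direction `e`. -/
theorem contDiff_integral_line {u : V → ℝ} (hu : ContDiff ℝ ∞ u) {e : V} {L : V →L[ℝ] ℝ}
    (hL : L e = 1) {c r : ℝ} (hur : ∀ y, r ≤ |L y - c| → u y = 0) {p : ℝ → ℝ}
    (hp : LocallyIntegrable p) : ContDiff ℝ ∞ fun y => ∫ t, p t * u (y - t • e) := by
  rw [contDiff_iff_contDiffAt]
  intro y₀
  set N := |L y₀| + 1 with hN
  have hs : IsOpen {y : V | |L y| < N} := isOpen_lt (by fun_prop) continuous_const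
  have key : ContDiffOn ℝ ∞ (fun y => ((p ⋆[ContinuousLinearMap.mul ℝ ℝ, volume]
      (fun s => u (y + s • e))) : ℝ → ℝ) 0) {y : V | |L y| < N} := by
    refine contDiffOn_convolution_right_with_param_comp (n := ⊤) (ContinuousLinearMap.mul ℝ ℝ)
      (v := fun _ => (0 : ℝ)) contDiffOn_const (k := Metric.closedBall 0 (N + |c| + |r|)) hs
      (isCompact_closedBall _ _) (g := fun y s => u (y + s • e)) ?_ hp ?_
    · intro y s hy hs
      refine hur _ ?_
      simp only [map_add, map_smul, hL, smul_eq_mul, mul_one]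
      rw [Metric.mem_closedBall, dist_zero_right, Real.norm_eq_abs, not_le] at hs
      have h1 : |L y| < N := hy
      have h2 : |s| ≤ |L y + s - c| + |L y| + |c| := by
        have := abs_sub_abs_le_abs_sub s (c - L y)
        have h3 := abs_sub c (L y)
        have h4 : s - (c - L y) = L y + s - c := by ring
        rw [h4] at this
        linarith
      have := le_abs_self r
      linarith
    · refine ContDiff.contDiffOn ?_
      change ContDiff ℝ ∞ fun q : V × ℝ => u (q.1 + q.2 • e)
      fun_prop
  refine (ContDiffOn.contDiffAt (key.congr fun y _ => ?_) (hs.mem_nhds ?_))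
  · simp only [convolution, zero_sub, neg_smul, ← sub_eq_add_neg, ContinuousLinearMap.mul_apply']
  · change |L y₀| < N
    linarith

theorem integrable_line {u : V → ℝ} (hu : Continuous u) {e : V} {L : V →L[ℝ] ℝ}
    (hL : L e = 1) {c r : ℝ} (hur : ∀ y, r ≤ |L y - c| → u y = 0) (y : V) :
    Integrable fun t : ℝ => u (y - t • e) := by
  refine Continuous.integrable_of_hasCompactSupport (by fun_prop) ?_
  refine HasCompactSupport.intro (isCompact_closedBall (L y - c) |r|) fun t ht => hur _ ?_
  rw [Metric.mem_closedBall, Real.dist_eq, not_le, abs_sub_comm] at ht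
  simp only [map_sub, map_smul, hL, smul_eq_mul, mul_one]
  rw [show L y - t - c = L y - c - t by ring]
  exact (le_abs_self r).trans ht.le

/-- Integration from `-∞` along the lines in direction `e` inverts the derivative in the direction
`e`. -/
theorem fderiv_integral_line {u : V → ℝ} (hu : ContDiff ℝ ∞ u) {e : V} {L : V →L[ℝ] ℝ}
    (hL : L e = 1) {c r : ℝ} (hur : ∀ y, r ≤ |L y - c| → u y = 0) (y : V) :
    fderiv ℝ (fun y => ∫ t, (Set.Ioi (0 : ℝ)).indicator (fun _ => 1) t * u (y - t • e)) y e =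
      u y := by
  have hp : LocallyIntegrable ((Set.Ioi (0 : ℝ)).indicator (fun _ => (1 : ℝ))) :=
    (locallyIntegrable_const 1).indicator measurableSet_Ioi
  have hd := (contDiff_integral_line hu hL hur hp).differentiable (by simp) y
  set Q : V → ℝ := fun y => ∫ t, (Set.Ioi (0 : ℝ)).indicator (fun _ => 1) t * u (y - t • e)
    with hQ
  have hline : HasDerivAt (fun s : ℝ => y + s • e) e 0 := by
    simpa using ((hasDerivAt_id (0 : ℝ)).smul_const e).const_add y
  have h1 : HasDerivAt (fun s : ℝ => Q (y + s • e)) (fderiv ℝ Q y e) 0 := by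
    have h2 : HasFDerivAt Q (fderiv ℝ Q y) (y + (0 : ℝ) • e) := by
      rw [zero_smul, add_zero]
      exact hd.hasFDerivAt
    exact h2.comp_hasDerivAt 0 hline
  have hint : Integrable fun x : ℝ => u (y + x • e) := by
    have := (integrable_line hu.continuous hL hur y).comp_neg
    simpa [sub_neg_eq_add] using this
  have hcont : Continuous fun x : ℝ => u (y + x • e) := by
    have := hu.continuous
    fun_prop
  have h3 : ∀ s : ℝ, Q (y + s • e) = (∫ x in Set.Iic (0 : ℝ), u (y + x • e)) +
      ∫ x in (0 : ℝ)..s, u (y + x • e) := by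
    intro s
    rw [← intervalIntegral.integral_Iic_sub_Iic hint.integrableOn hint.integrableOn,
      add_sub_cancel]
    have h4 : Q (y + s • e) = ∫ t, (Set.Iio s).indicator (fun x => u (y + x • e)) (s - t) := by
      refine integral_congr_ae (Filter.Eventually.of_forall fun t => ?_)
      simp only [Set.indicator_apply, Set.mem_Ioi, Set.mem_Iio, sub_lt_self_iff]
      have : y + s • e - t • e = y + (s - t) • e := by module
      split_ifs <;> simp [this]
    rw [h4, integral_sub_left_eq_self (fun x => (Set.Iio s).indicator (fun x => u (y + x • e)) x),
      integral_indicator measurableSet_Iio, integral_Iic_eq_integral_Iio]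
  have h5 : HasDerivAt (fun s : ℝ => Q (y + s • e)) (u (y + (0 : ℝ) • e)) 0 := by
    simp only [h3]
    exact (intervalIntegral.integral_hasDerivAt_right (hcont.intervalIntegrable _ _)
      (hcont.stronglyMeasurableAtFilter _ _) hcont.continuousAt).const_add _
  rw [zero_smul, add_zero] at h5
  exact h1.unique h5

/-- One step of the compactly supported Poincaré lemma: up to a derivative in the direction `e`, a
function with bounded support in this direction is the product of a given bump function of one
variable and a function that is invariant in the direction `e`. -/
theorem exists_eq_mul_add_fderiv {u : V → ℝ} (hu : ContDiff ℝ ∞ u) {e : V} {L : V →L[ℝ] ℝ}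
    (hL : L e = 1) {c r : ℝ} (hur : ∀ y, r ≤ |L y - c| → u y = 0) {η : ℝ → ℝ}
    (hη : ContDiff ℝ ∞ η) (hηr : ∀ x, r ≤ |x - c| → η x = 0) (hη₁ : ∫ x, η x = 1) :
    ∃ P b : V → ℝ, ContDiff ℝ ∞ P ∧ ContDiff ℝ ∞ b ∧
      (∀ y, u y = η (L y) * P y + fderiv ℝ b y e) ∧ (∀ (y : V) (s : ℝ), P (y + s • e) = P y) ∧
      (∀ y, r ≤ |L y - c| → b y = 0) ∧
      (∀ y : V, (∀ s : ℝ, u (y + s • e) = 0) → P y = 0 ∧ b y = 0) ∧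
      ∀ e' : V, L e' = 0 → (∀ (y : V) (s : ℝ), u (y + s • e') = u y) →
        ∀ (y : V) (s : ℝ), P (y + s • e') = P y ∧ b (y + s • e') = b y := by
  set P : V → ℝ := fun y => ∫ t : ℝ, 1 * u (y - t • e) with hP
  have hPs : ContDiff ℝ ∞ P := contDiff_integral_line hu hL hur (locallyIntegrable_const 1)
  have hPe : ∀ (y : V) (s : ℝ), P (y + s • e) = P y := by
    intro y s
    have h1 : ∀ t : ℝ, y + s • e - t • e = y - (t - s) • e := fun t => by module
    simp only [hP, h1]
    exact integral_sub_right_eq_self (fun t => 1 * u (y - t • e)) s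
  set g : V → ℝ := fun y => u y - η (L y) * P y with hg
  have hgs : ContDiff ℝ ∞ g := hu.sub ((hη.comp L.contDiff).mul hPs)
  have hgr : ∀ y, r ≤ |L y - c| → g y = 0 := by
    intro y hy
    simp only [hg, hur y hy, hηr _ hy, zero_mul, sub_zero]
  set b : V → ℝ := fun y => ∫ t : ℝ, (Set.Ioi (0 : ℝ)).indicator (fun _ => 1) t * g (y - t • e) with hb
  have hp : LocallyIntegrable ((Set.Ioi (0 : ℝ)).indicator (fun _ => (1 : ℝ))) :=
    (locallyIntegrable_const 1).indicator measurableSet_Ioi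
  refine ⟨P, b, hPs, contDiff_integral_line hgs hL hgr hp, fun y => ?_, hPe, fun y hy => ?_,
    fun y hy => ?_, fun e' he' hue' y s => ?_⟩
  · rw [fderiv_integral_line hgs hL hgr]
    simp only [hg]
    ring
  · have hLt : ∀ t : ℝ, L (y - t • e) = L y - t := fun t => by simp [hL]
    rcases le_abs.1 hy with h | h
    · have h2 : b y = ∫ t : ℝ, g (y - t • e) := by
        refine integral_congr_ae (Filter.Eventually.of_forall fun t => ?_)
        beta_reduce
        by_cases ht : 0 < t
        · simp [Set.indicator_of_mem (Set.mem_Ioi.2 ht)]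
        · rw [Set.indicator_of_notMem (by simpa using ht), zero_mul]
          refine (hgr _ ?_).symm
          rw [hLt]
          exact le_abs.2 (Or.inl (by linarith))
      have h3 : ∀ t : ℝ, g (y - t • e) = u (y - t • e) - η (L y - t) * P y := by
        intro t
        have := hPe y (-t)
        rw [neg_smul, ← sub_eq_add_neg] at this
        simp only [hg, this, hLt]
      have hi : Integrable fun t : ℝ => η (L y - t) := by
        have := integrable_line (V := ℝ) (e := 1) (L := ContinuousLinearMap.id ℝ ℝ) hη.continuous
          rfl hηr (L y)
        simpa using this
      rw [h2]
      simp only [h3]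
      rw [integral_sub (integrable_line hu.continuous hL hur y) (hi.mul_const _),
        integral_mul_const, integral_sub_left_eq_self (fun x => η x), hη₁, one_mul]
      simp only [hP, one_mul, sub_self]
    · refine integral_eq_zero_of_ae (Filter.Eventually.of_forall fun t => ?_)
      by_cases ht : 0 < t
      · change _ * _ = (0 : ℝ)
        rw [hgr, mul_zero]
        rw [hLt]
        exact le_abs.2 (Or.inr (by linarith))
      · change _ * _ = (0 : ℝ)
        rw [Set.indicator_of_notMem (by simpa using ht), zero_mul]
  · have h1 : ∀ t : ℝ, u (y - t • e) = 0 := fun t => by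
      have := hy (-t)
      rwa [neg_smul, ← sub_eq_add_neg] at this
    have h2 : P y = 0 := by simp only [hP, h1, mul_zero, integral_zero]
    refine ⟨h2, ?_⟩
    have h3 : ∀ t : ℝ, g (y - t • e) = 0 := by
      intro t
      have := hPe y (-t)
      rw [neg_smul, ← sub_eq_add_neg] at this
      simp only [hg, this, h1, h2, mul_zero, sub_zero]
    simp only [hb, h3, mul_zero, integral_zero]
  · have h1 : ∀ (y : V) (t : ℝ), y + s • e' - t • e = y - t • e + s • e' := fun y t => by module
    have h2 : ∀ y, P (y + s • e') = P y := fun y => by simp only [hP, h1, hue']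
    refine ⟨h2 y, ?_⟩
    have h3 : ∀ z, g (z + s • e') = g z := fun z => by
      simp only [hg, h2, hue', map_add, map_smul, he', smul_zero, add_zero]
    simp only [hb, h1, h3]

theorem fderiv_apply_eq_zero_of_forall_add_smul {f : V → ℝ} {e y : V}
    (hf : DifferentiableAt ℝ f y) (h : ∀ s : ℝ, f (y + s • e) = f y) : fderiv ℝ f y e = 0 := by
  rw [← hf.lineDeriv_eq_fderiv, lineDeriv]
  simp only [h, deriv_const]

/-- The compactly supported Poincaré lemma in top degree: up to a divergence, a smooth function
supported in a cube is a multiple of a given product of bump functions of one variable. -/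
theorem exists_eq_mul_prod_add_sum_fderiv {m : ℕ} {h : EuclideanSpace ℝ (Fin m) → ℝ}
    (hh : ContDiff ℝ ∞ h) {c : EuclideanSpace ℝ (Fin m)} {r : ℝ}
    (hhr : ∀ y k, r ≤ |y k - c k| → h y = 0) {η : Fin m → ℝ → ℝ} (hη : ∀ k, ContDiff ℝ ∞ (η k))
    (hηr : ∀ k x, r ≤ |x - c k| → η k x = 0) (hη₁ : ∀ k, ∫ x, η k x = 1) :
    ∃ (C : ℝ) (b : Fin m → EuclideanSpace ℝ (Fin m) → ℝ), (∀ k, ContDiff ℝ ∞ (b k)) ∧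
      (∀ k y j, r ≤ |y j - c j| → b k y = 0) ∧
      ∀ y, h y = C * ∏ k, η k (y k) + ∑ k, fderiv ℝ (b k) y (frame m k) := by
  have hcoord : ∀ (y : EuclideanSpace ℝ (Fin m)) (s : ℝ) (j k : Fin m), j ≠ k →
      (y + s • frame m k) j = y j := by
    intro y s j k hjk
    simp [frame, hjk]
  -- Coordinates in `S` are split off one at a time.
  have key : ∀ S : Finset (Fin m), ∃ (u : EuclideanSpace ℝ (Fin m) → ℝ)
      (b : Fin m → EuclideanSpace ℝ (Fin m) → ℝ), ContDiff ℝ ∞ u ∧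
      (∀ k ∈ S, ∀ y (s : ℝ), u (y + s • frame m k) = u y) ∧
      (∀ k ∉ S, ∀ y, r ≤ |y k - c k| → u y = 0) ∧
      (∀ k, ContDiff ℝ ∞ (b k)) ∧ (∀ k y j, r ≤ |y j - c j| → b k y = 0) ∧
      ∀ y, h y = (∏ k ∈ S, η k (y k)) * u y + ∑ k, fderiv ℝ (b k) y (frame m k) := by
    intro S
    induction S using Finset.induction_on with
    | empty =>
      refine ⟨h, fun _ _ => 0, hh, by simp, fun k _ y hy => hhr y k hy, fun _ => contDiff_const,
        fun _ _ _ _ => rfl, fun y => ?_⟩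
      simp
    | insert k S hk ih =>
      obtain ⟨u, b, hu, huS, huS', hb, hbr, hub⟩ := ih
      obtain ⟨P, q, hP, hq, hPq, hPk, hqr, hPq₀, hPqinv⟩ := exists_eq_mul_add_fderiv hu
        (e := frame m k) (L := EuclideanSpace.proj k) (by simp [frame]) (huS' k hk) (hη k) (hηr k)
        (hη₁ k)
      set Φ : EuclideanSpace ℝ (Fin m) → ℝ := fun y => ∏ j ∈ S, η j (y j) with hΦ
      have hΦs : ContDiff ℝ ∞ Φ := contDiff_prod fun j _ => (hη j).comp
        (by fun_prop : ContDiff ℝ ∞ fun y : EuclideanSpace ℝ (Fin m) => y j)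
      have hΦk : ∀ y, fderiv ℝ Φ y (frame m k) = 0 := fun y =>
        fderiv_apply_eq_zero_of_forall_add_smul (hΦs.differentiable (by simp) y) fun s =>
          Finset.prod_congr rfl fun j hj => by
            rw [hcoord y s j k fun h => hk (h ▸ hj)]
      have hG : ∀ y, fderiv ℝ (fun y => Φ y * q y) y (frame m k) =
          Φ y * fderiv ℝ q y (frame m k) := by
        intro y
        rw [fderiv_fun_mul (hΦs.differentiable (by simp) y) (hq.differentiable (by simp) y)]
        simp [hΦk]
      set G : Fin m → EuclideanSpace ℝ (Fin m) → ℝ := Pi.single k fun y => Φ y * q y with hGdef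
      have hs : ∀ j, ContDiff ℝ ∞ (G j) := by
        intro j
        by_cases hj : j = k
        · subst hj
          rw [hGdef, Pi.single_eq_same]
          exact hΦs.mul hq
        · rw [hGdef, Pi.single_eq_of_ne hj]
          exact contDiff_const
      refine ⟨P, b + G, hP, ?_, ?_, ?_, ?_, ?_⟩
      · intro j hj y s
        rcases Finset.mem_insert.1 hj with rfl | hj
        · exact hPk y s
        · refine (hPqinv (frame m j) ?_ (huS j hj) y s).1
          have : j ≠ k := fun h => hk (h ▸ hj)
          simp [frame, this.symm]
      · intro j hj y hy
        rw [Finset.mem_insert, not_or] at hj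
        refine (hPq₀ y fun s => huS' j hj.2 _ ?_).1
        rwa [hcoord y s j k hj.1]
      · intro j
        exact (hb j).add (hs j)
      · intro j y a ha
        rw [Pi.add_apply, Pi.add_apply, hbr j y a ha, zero_add]
        by_cases hj : j = k
        · subst hj
          rw [hGdef, Pi.single_eq_same]
          by_cases haS : a ∈ S
          · have : Φ y = 0 := Finset.prod_eq_zero haS (hηr a _ ha)
            rw [this, zero_mul]
          · by_cases haj : a = j
            · subst haj
              rw [hqr y ha, mul_zero]
            · rw [(hPq₀ y fun s => huS' a haS _ (by rwa [hcoord y s a j haj])).2, mul_zero]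
        · rw [hGdef, Pi.single_eq_of_ne hj]
          rfl
      · intro y
        have h1 : ∀ j, fderiv ℝ ((b + G) j) y (frame m j) =
            fderiv ℝ (b j) y (frame m j) +
              (Pi.single k (Φ y * fderiv ℝ q y (frame m k)) : Fin m → ℝ) j := by
          intro j
          rw [Pi.add_apply, fderiv_add ((hb j).differentiable (by simp) y)
            ((hs j).differentiable (by simp) y), add_apply]
          congr 1
          by_cases hj : j = k
          · subst hj
            rw [Pi.single_eq_same, hGdef, Pi.single_eq_same, hG]
          · rw [Pi.single_eq_of_ne hj, hGdef, Pi.single_eq_of_ne hj, fderiv_zero]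
            rfl
        simp only [h1, Finset.sum_add_distrib, Finset.sum_pi_single', Finset.mem_univ, if_true]
        have h2 : u y = η k (y k) * P y + fderiv ℝ q y (frame m k) := hPq y
        rw [hub y, h2, Finset.prod_insert hk]
        simp only [hΦ]
        ring
  obtain ⟨u, b, hu, huS, -, hb, hbr, hub⟩ := key Finset.univ
  refine ⟨u 0, b, hb, hbr, fun y => ?_⟩
  have hu₀ : ∀ z, fderiv ℝ u z = 0 := by
    intro z
    have h1 : ((fderiv ℝ u z : EuclideanSpace ℝ (Fin m) →L[ℝ] ℝ) :
        EuclideanSpace ℝ (Fin m) →ₗ[ℝ] ℝ) = 0 := by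
      refine (EuclideanSpace.basisFun (Fin m) ℝ).toBasis.ext fun k => ?_
      rw [← frame_eq_basis]
      exact fderiv_apply_eq_zero_of_forall_add_smul (hu.differentiable (by simp) z)
        (huS k (Finset.mem_univ k) z)
    ext v
    exact LinearMap.congr_fun h1 v
  rw [hub y, is_const_of_fderiv_eq_zero (hu.differentiable (by simp)) hu₀ y 0, mul_comm]

end Poincare

/-! ### Forms of degree `m` modulo forms that are exact on the boundary -/

section CoordinateForms

/-- The determinant form `dy₁ ∧ ⋯ ∧ dyₙ` on `ℝⁿ`. -/
def detForm (n : ℕ) : EuclideanSpace ℝ (Fin n) [⋀^Fin n]→L[ℝ] ℝ :=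
  { (EuclideanSpace.basisFun (Fin n) ℝ).toBasis.det with
    cont := by
      change Continuous fun v : Fin n → EuclideanSpace ℝ (Fin n) =>
        ((EuclideanSpace.basisFun (Fin n) ℝ).toBasis.toMatrix v).det
      refine Continuous.matrix_det (continuous_matrix fun a b => ?_)
      change Continuous fun v : Fin n → EuclideanSpace ℝ (Fin n) => v b a
      fun_prop }

theorem detForm_frame (n : ℕ) : detForm n (frame n) = 1 := by
  rw [frame_eq_basis]
  exact (EuclideanSpace.basisFun (Fin n) ℝ).toBasis.det_self

/-- The form `dy₁ ∧ ⋯ ∧ dyₘ` on `ℝᵐ⁺¹`, where the coordinates are `y₀, …, yₘ`. -/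
def tangentDet (m : ℕ) : EuclideanSpace ℝ (Fin (m + 1)) [⋀^Fin m]→L[ℝ] ℝ :=
  (detForm m).compContinuousLinearMap (hyperplaneProj m)

theorem tangentDet_tangentFrame (m : ℕ) : tangentDet m (tangentFrame m) = 1 := by
  rw [← detForm_frame m]
  change detForm m (fun k => hyperplaneProj m (tangentFrame m k)) = _
  congr 1
  funext k
  ext j
  simp [tangentFrame, frame, Fin.succ_inj]

/-- The product of all `dyⱼ` with `j ≠ 0` except the `k`-th one of these, as a form on `ℝᵖ⁺²`. -/
def tangentDetRemove (p : ℕ) (k : Fin (p + 1)) :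
    EuclideanSpace ℝ (Fin (p + 2)) [⋀^Fin p]→L[ℝ] ℝ :=
  (detForm p).compContinuousLinearMap (LinearMap.toContinuousLinearMap
    { toFun := fun v => WithLp.toLp 2 fun a => v (k.succAbove a).succ
      map_add' := fun _ _ => rfl
      map_smul' := fun _ _ => rfl })

theorem tangentDetRemove_removeNth {p : ℕ} (k j : Fin (p + 1)) :
    tangentDetRemove p k (j.removeNth (tangentFrame (p + 1))) = if j = k then 1 else 0 := by
  change detForm p (fun a => WithLp.toLp 2 fun a' =>
    tangentFrame (p + 1) (j.succAbove a) (k.succAbove a').succ) = _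
  split_ifs with h
  · subst h
    rw [← detForm_frame p]
    congr 1
    funext a
    ext a'
    simp [tangentFrame, frame, Fin.succ_inj]
  · obtain ⟨a, ha⟩ := Fin.exists_succAbove_eq (Ne.symm h)
    refine (detForm p).map_coord_zero a ?_
    ext a'
    simp [tangentFrame, ha, Fin.succ_inj, Fin.succAbove_ne]

end CoordinateForms

section Cubes

variable {n : ℕ}

theorem exists_cube_subset {c : EuclideanSpace ℝ (Fin n)} {S : Set (EuclideanSpace ℝ (Fin n))}
    (hS : S ∈ 𝓝 c) : ∃ r > 0, ∀ y : EuclideanSpace ℝ (Fin n), (∀ k, |y k - c k| ≤ r) → y ∈ S := by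
  have h1 : (WithLp.toLp 2 : (Fin n → ℝ) → EuclideanSpace ℝ (Fin n)) ⁻¹' S ∈ 𝓝 c.ofLp :=
    (PiLp.continuous_toLp 2 (fun _ : Fin n => ℝ)).continuousAt hS
  obtain ⟨r, hr, h⟩ := Metric.nhds_basis_closedBall.mem_iff.1 h1
  exact ⟨r, hr, fun y hy => h ((dist_pi_le_iff hr.le).2 hy)⟩

theorem isCompact_cube (c : EuclideanSpace ℝ (Fin n)) (r : ℝ) :
    IsCompact {y : EuclideanSpace ℝ (Fin n) | ∀ k, |y k - c k| ≤ r} := by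
  rcases lt_or_ge r 0 with hr | hr
  · rcases isEmpty_or_nonempty (Fin n) with h | ⟨⟨k⟩⟩
    · exact Set.Subsingleton.isCompact fun x _ y _ => by
        ext k
        exact h.elim k
    · convert isCompact_empty
      ext y
      simp only [Set.mem_ofPred_eq, Set.mem_empty_iff_false, iff_false, not_forall]
      exact ⟨k, fun h => absurd (abs_nonneg (y k - c k)) (by linarith)⟩
  · have h1 := (isCompact_closedBall c.ofLp r).image (PiLp.continuous_toLp 2 (fun _ : Fin n => ℝ))
    convert h1 using 1
    ext y
    constructor
    · exact fun h => ⟨y.ofLp, (dist_pi_le_iff hr).2 h, rfl⟩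
    · rintro ⟨x, hx, rfl⟩
      exact (dist_pi_le_iff hr).1 hx

end Cubes

section OneDim

variable {p : ℕ} {M : Type*} [TopologicalSpace M] [ChartedSpace (EuclideanHalfSpace (p + 2)) M]
  [IsManifold (𝓡∂ (p + 2)) ∞ M]
  {E' H' : Type*} [NormedAddCommGroup E'] [NormedSpace ℝ E'] [TopologicalSpace H']
  (J : ModelWithCorners ℝ E' H') {B : Type*} [TopologicalSpace B] [ChartedSpace H' B]
  (i : B → M)

/-- The smooth forms whose pullback to the boundary is that of an exact form. -/
def exactOnBoundary : Submodule ℝ (Form (𝓡∂ (p + 2)) M (p + 1)) where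
  carrier := {α | α.IsSmooth ∧ ∃ β : Form (𝓡∂ (p + 2)) M p, β.IsSmooth ∧
    (α - β.extD).pullback J i = 0}
  zero_mem' := ⟨(smoothForms _ _ _).zero_mem, 0, (smoothForms _ _ _).zero_mem, by
    have h : (0 : Form (𝓡∂ (p + 2)) M p).extD = 0 := by
      have := Form.extD_smul (0 : ℝ) (0 : Form (𝓡∂ (p + 2)) M p)
      rwa [zero_smul, zero_smul] at this
    rw [h, sub_zero]
    exact (Form.pullbackₗ J i).map_zero⟩
  add_mem' := by
    rintro α α' ⟨hα, β, hβ, h⟩ ⟨hα', β', hβ', h'⟩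
    refine ⟨(smoothForms _ _ _).add_mem hα hα', β + β', (smoothForms _ _ _).add_mem hβ hβ', ?_⟩
    rw [Form.extD_add hβ hβ', add_sub_add_comm, Form.pullback_add, h, h', add_zero]
  smul_mem' := by
    rintro a α ⟨hα, β, hβ, h⟩
    refine ⟨(smoothForms _ _ _).smul_mem a hα, a • β, (smoothForms _ _ _).smul_mem a hβ, ?_⟩
    rw [Form.extD_smul, ← smul_sub, Form.pullback_smul, h, smul_zero]

end OneDim

section Local

open MeasureTheory

variable {p : ℕ} {M : Type*} [TopologicalSpace M] [ChartedSpace (EuclideanHalfSpace (p + 2)) M]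
  [IsManifold (𝓡∂ (p + 2)) ∞ M]

theorem Form.pullback_apply_eq_zero {E H E' H' : Type*} [NormedAddCommGroup E] [NormedSpace ℝ E]
    [TopologicalSpace H] {I : ModelWithCorners ℝ E H} {M : Type*} [TopologicalSpace M]
    [ChartedSpace H M] [NormedAddCommGroup E'] [NormedSpace ℝ E'] [TopologicalSpace H']
    {J : ModelWithCorners ℝ E' H'} {B : Type*} [TopologicalSpace B] [ChartedSpace H' B] {l : ℕ}
    {α : Form I M l} {f : B → M} {b : B} (h : α (f b) = 0) : α.pullback J f b = 0 := by
  rw [Form.pullback, h]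
  rfl

/-- The exterior derivative of a form `∑ ± b_k dy₁ ∧ ⋯ ∧ dy_{k-1} ∧ dy_{k+1} ∧ ⋯ ∧ dyₘ`, cut off in
the normal direction, has the divergence of `b` as its tangential coefficient. -/
theorem extDerivWithin_sum_tangentDetRemove {b : Fin (p + 1) → EuclideanSpace ℝ (Fin (p + 1)) → ℝ}
    (hb : ∀ k, ContDiff ℝ ∞ (b k)) {μ : ℝ → ℝ} (hμ : ContDiff ℝ ∞ μ) (hμ₀ : μ 0 = 1)
    {y : EuclideanSpace ℝ (Fin (p + 2))} (hy : y 0 = 0) :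
    extDerivWithin (fun y => ∑ k : Fin (p + 1),
        (μ (y 0) * ((-1) ^ (k : ℕ) * b k (hyperplaneProj (p + 1) y))) • tangentDetRemove p k)
      (Set.range (𝓡∂ (p + 2))) y (tangentFrame (p + 1)) =
      ∑ k, fderiv ℝ (b k) (hyperplaneProj (p + 1) y) (frame (p + 1) k) := by
  have hyr : y ∈ Set.range (𝓡∂ (p + 2)) := by
    rw [range_modelWithCornersEuclideanHalfSpace]
    exact hy.ge
  have hcoef : ∀ k : Fin (p + 1), ContDiff ℝ ∞ fun y : EuclideanSpace ℝ (Fin (p + 2)) =>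
      μ (y 0) * ((-1) ^ (k : ℕ) * b k (hyperplaneProj (p + 1) y)) := fun k =>
    (hμ.comp (by fun_prop : ContDiff ℝ ∞ fun y : EuclideanSpace ℝ (Fin (p + 2)) => y 0)).mul
      (contDiff_const.mul ((hb k).comp (hyperplaneProj (p + 1)).contDiff))
  have hF : ContDiff ℝ ∞ fun y : EuclideanSpace ℝ (Fin (p + 2)) => ∑ k : Fin (p + 1),
      (μ (y 0) * ((-1) ^ (k : ℕ) * b k (hyperplaneProj (p + 1) y))) • tangentDetRemove p k :=
    ContDiff.sum fun k _ => (hcoef k).smul contDiff_const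
  have hU := (𝓡∂ (p + 2)).uniqueDiffOn y hyr
  rw [extDerivWithin_apply (hF.differentiable (by simp) y).differentiableWithinAt hU]
  refine Finset.sum_congr rfl fun j _ => ?_
  have h1 : (fun y : EuclideanSpace ℝ (Fin (p + 2)) => (∑ k : Fin (p + 1),
      (μ (y 0) * ((-1) ^ (k : ℕ) * b k (hyperplaneProj (p + 1) y))) • tangentDetRemove p k)
        (j.removeNth (tangentFrame (p + 1)))) =
      fun y => μ (y 0) * ((-1) ^ (j : ℕ) * b j (hyperplaneProj (p + 1) y)) := by
    funext z
    rw [ContinuousAlternatingMap.sum_apply]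
    simp only [ContinuousAlternatingMap.smul_apply, tangentDetRemove_removeNth, smul_eq_mul,
      mul_ite, mul_one, mul_zero, Finset.sum_ite_eq, Finset.mem_univ, if_true]
  have h2 := (hcoef j).differentiable (by simp) y
  rw [h1, h2.fderivWithin hU, ← h2.lineDeriv_eq_fderiv,
    ← ((hb j).differentiable (by simp) _).lineDeriv_eq_fderiv, lineDeriv, lineDeriv]
  have h3 : ∀ t : ℝ, hyperplaneProj (p + 1) (y + t • tangentFrame (p + 1) j) =
      hyperplaneProj (p + 1) y + t • frame (p + 1) j := by
    intro t
    ext k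
    simp [tangentFrame, frame, Fin.succ_inj]
  have h4 : ∀ t : ℝ, (y + t • tangentFrame (p + 1) j) 0 = 0 := by
    intro t
    simp [tangentFrame, hy, (Fin.succ_ne_zero _).symm]
  simp only [h3, h4, hμ₀, one_mul, deriv_const_mul_field]
  rw [zsmul_eq_mul]
  push_cast
  rw [← mul_assoc, ← pow_add, Even.neg_one_pow (Even.add_self _), one_mul]

variable [T2Space M]
  {B : Type*} [TopologicalSpace B] [ChartedSpace (EuclideanSpace ℝ (Fin (p + 1))) B]
  [IsManifold (𝓡 (p + 1)) ∞ B] {i : B → M}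

/-- Near a boundary point, the forms modulo those that are exact on the boundary are spanned by any
one of a family of bump forms, supported arbitrarily close to any given boundary point nearby. -/
theorem IsBoundaryInclusion.exists_local_generator
    (hi : IsBoundaryInclusion (𝓡∂ (p + 2)) (𝓡 (p + 1)) i) (b₀ : B) :
    ∃ U : Set M, IsOpen U ∧ i b₀ ∈ U ∧ ∀ b, i b ∈ U → ∀ W : Set M, IsOpen W → i b ∈ W →
      ∃ γ : Form (𝓡∂ (p + 2)) M (p + 1), γ.IsSmooth ∧ (∀ x ∉ W, γ x = 0) ∧
        ∀ α : Form (𝓡∂ (p + 2)) M (p + 1), α.IsSmooth → (∀ x ∉ U, α x = 0) →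
          α ∈ exactOnBoundary (𝓡 (p + 1)) i ⊔ Submodule.span ℝ {γ} := by
  set e := extChartAt (𝓡∂ (p + 2)) (i b₀) with he
  have hRe : Set.range (𝓡∂ (p + 2)) = {y : EuclideanSpace ℝ (Fin (p + 2)) | 0 ≤ y 0} :=
    range_modelWithCornersEuclideanHalfSpace _
  have hbd : ∀ b, i b ∈ e.source → e (i b) 0 = 0 := fun b hb => by
    refine (mem_boundary_iff hb).1 ?_
    rw [← hi.range_eq]
    exact ⟨b, rfl⟩
  set c := e (i b₀) with hc
  have hc₀ : c 0 = 0 := hbd b₀ (mem_extChartAt_source _)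
  obtain ⟨r, hr, hrt⟩ : ∃ r > 0, ∀ y : EuclideanSpace ℝ (Fin (p + 2)),
      (∀ k, |y k - c k| ≤ r) → y ∈ Set.range (𝓡∂ (p + 2)) → y ∈ e.target := by
    obtain ⟨V, hV, hVt⟩ := mem_nhdsWithin_iff_exists_mem_nhds_inter.1
      (extChartAt_target_mem_nhdsWithin (I := 𝓡∂ (p + 2)) (i b₀))
    obtain ⟨r, hr, h⟩ := exists_cube_subset hV
    exact ⟨r, hr, fun y hy hy' => hVt ⟨h y hy, hy'⟩⟩
  set Q := {y : EuclideanSpace ℝ (Fin (p + 2)) | ∀ k, |y k - c k| ≤ r} ∩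
    Set.range (𝓡∂ (p + 2)) with hQ
  have hQc : IsCompact Q := (isCompact_cube c r).inter_right (𝓡∂ (p + 2)).isClosed_range
  have hQt : Q ⊆ e.target := fun y hy => hrt y hy.1 hy.2
  have hCc : IsCompact (e.symm '' Q) :=
    hQc.image_of_continuousOn ((continuousOn_extChartAt_symm _).mono hQt)
  have hCs : e.symm '' Q ⊆ e.source := by
    rintro _ ⟨y, hy, rfl⟩
    exact e.map_target (hQt hy)
  set U := e.source ∩ e ⁻¹' {y | ∀ k, |y k - c k| < r} with hU
  have hUC : U ⊆ e.symm '' Q := by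
    rintro x ⟨hx, hxU⟩
    exact ⟨e x, ⟨fun k => (hxU k).le, extChartAt_target_subset_range _ (e.map_source hx)⟩,
      e.left_inv hx⟩
  have hUo : IsOpen U := by
    refine (continuousOn_extChartAt _).isOpen_inter_preimage (isOpen_extChartAt_source _) ?_
    have : {y : EuclideanSpace ℝ (Fin (p + 2)) | ∀ k, |y k - c k| < r} =
        ⋂ k, {y | |y k - c k| < r} := by
      ext y
      simp
    rw [this]
    exact isOpen_iInter_of_finite fun k => isOpen_lt (by fun_prop) continuous_const
  refine ⟨U, hUo, ⟨mem_extChartAt_source _, fun k => by simpa [← hc] using hr⟩,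
    fun b hbU W hW hbW => ?_⟩
  set d := e (i b) with hd
  have hd₀ : d 0 = 0 := hbd b hbU.1
  obtain ⟨r', hr', hr't⟩ : ∃ r' > 0, ∀ y : EuclideanSpace ℝ (Fin (p + 2)),
      (∀ k, |y k - d k| ≤ r') → y ∈ Set.range (𝓡∂ (p + 2)) → y ∈ e.target ∧ e.symm y ∈ W ∩ U := by
    have hdt : d ∈ e.target := e.map_source hbU.1
    have h1 : e.symm ⁻¹' (W ∩ U) ∈ 𝓝 d := by
      refine continuousAt_extChartAt_symm'' hdt ((hW.inter hUo).mem_nhds ?_)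
      rw [hd, e.left_inv hbU.1]
      exact ⟨hbW, hbU⟩
    obtain ⟨V, hV, hVt⟩ := mem_nhdsWithin_iff_exists_mem_nhds_inter.1
      (extChartAt_target_mem_nhdsWithin_of_mem hdt)
    obtain ⟨r', hr', h⟩ := exists_cube_subset (Filter.inter_mem hV h1)
    exact ⟨r', hr', fun y hy hy' => ⟨hVt ⟨(h y hy).1, hy'⟩, (h y hy).2⟩⟩
  set Q' := {y : EuclideanSpace ℝ (Fin (p + 2)) | ∀ k, |y k - d k| ≤ r'} ∩
    Set.range (𝓡∂ (p + 2)) with hQ'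
  have hQ'c : IsCompact Q' := (isCompact_cube d r').inter_right (𝓡∂ (p + 2)).isClosed_range
  have hQ't : Q' ⊆ e.target := fun y hy => (hr't y hy.1 hy.2).1
  -- The bump functions of one variable.
  let f₀ : ContDiffBump (0 : ℝ) := ⟨r / 2, r, by linarith, by linarith⟩
  let f₁ : ContDiffBump (0 : ℝ) := ⟨r' / 2, r', by linarith, by linarith⟩
  let f : ∀ k : Fin (p + 1), ContDiffBump (d k.succ) := fun k =>
    ⟨r' / 2, r', by linarith, by linarith⟩
  have hf₀ : ∀ x, r ≤ |x| → f₀ x = 0 := fun x hx =>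
    f₀.zero_of_le_dist (by simpa [Real.dist_eq] using hx)
  have hf₁ : ∀ x, r' ≤ |x| → f₁ x = 0 := fun x hx =>
    f₁.zero_of_le_dist (by simpa [Real.dist_eq] using hx)
  set η : Fin (p + 1) → ℝ → ℝ := fun k => (f k).normed volume with hη
  have hη0 : ∀ k x, r' ≤ |x - d k.succ| → η k x = 0 := by
    intro k x hx
    have : x ∉ Function.support (η k) := by
      rw [hη, ContDiffBump.support_normed_eq, Metric.mem_ball, Real.dist_eq, not_lt]
      exact hx
    exact Function.notMem_support.1 this
  have hηr : ∀ k x, r ≤ |x - c k.succ| → η k x = 0 := by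
    intro k x hx
    refine hη0 k x (not_lt.1 fun h => ?_)
    have h1 := hr't (WithLp.toLp 2 (Function.update d.ofLp k.succ x)) (fun j => ?_) ?_
    · have h2 := h1.2.2.2 k.succ
      rw [e.right_inv h1.1] at h2
      simp only [Function.update_self] at h2
      linarith
    · by_cases hj : j = k.succ
      · subst hj
        simpa using h.le
      · simp [hj, hr'.le]
    · rw [hRe]
      change 0 ≤ Function.update d.ofLp k.succ x 0
      rw [Function.update_of_ne (Fin.succ_ne_zero k).symm]
      exact hd₀.ge
  -- In the chart, `γ` is a bump of integral one in the tangential variables, cut off in the normal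
  -- variable.
  set F' : EuclideanSpace ℝ (Fin (p + 2)) → EuclideanSpace ℝ (Fin (p + 2)) [⋀^Fin (p + 1)]→L[ℝ] ℝ :=
    fun y => (f₁ (y 0) * ∏ k : Fin (p + 1), η k (y k.succ)) • tangentDet (p + 1) with hF'
  have hF's : ContDiff ℝ ∞ F' := by
    refine ContDiff.smul (ContDiff.mul (f₁.contDiff.comp (by fun_prop)) ?_) contDiff_const
    exact contDiff_prod fun k _ => (f k).contDiff_normed.comp (by fun_prop)
  have hF'K : ∀ y ∈ Set.range (𝓡∂ (p + 2)), y ∉ Q' → F' y = 0 := by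
    intro y hy hyQ
    have h1 : ∃ k, r' < |y k - d k| := by
      by_contra h
      push Not at h
      exact hyQ ⟨h, hy⟩
    obtain ⟨k, hk⟩ := h1
    have h2 : f₁ (y 0) * ∏ k : Fin (p + 1), η k (y k.succ) = 0 := by
      revert hk
      refine Fin.cases ?_ (fun k => ?_) k
      · intro hk
        rw [hd₀, sub_zero] at hk
        rw [hf₁ _ hk.le, zero_mul]
      · intro hk
        rw [Finset.prod_eq_zero (Finset.mem_univ k) (hη0 k _ hk.le), mul_zero]
    simp only [hF', h2, zero_smul]
  set γ : Form (𝓡∂ (p + 2)) M (p + 1) := Form.ofChart (𝓡∂ (p + 2)) (i b₀) F' with hγ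
  have hγs : γ.IsSmooth := Form.isSmooth_ofChart hF's.contDiffOn hQ'c hQ't hF'K
  have hγ0 : ∀ x ∉ W ∩ U, γ x = 0 := by
    intro x hx
    refine Form.ofChart_eq_zero hF'K ?_
    rintro ⟨y, hy, rfl⟩
    exact hx (hr't y hy.1 hy.2).2
  refine ⟨γ, hγs, fun x hx => hγ0 x fun h => hx h.1, fun α hα hαU => ?_⟩
  have hαC : ∀ x ∉ e.symm '' Q, α x = 0 := fun x hx => hαU x fun h => hx (hUC h)
  set h : EuclideanSpace ℝ (Fin (p + 1)) → ℝ := fun v =>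
    α.inChartExt (i b₀) (hyperplaneIncl (p + 1) v) (tangentFrame (p + 1)) with hh
  have hhs : ContDiff ℝ ∞ h := by
    have h1 := hα.contDiffOn_inChartExt hCc hCs hαC
    rw [← contDiffOn_univ]
    have h2 : ContDiffOn ℝ ∞ (fun v => α.inChartExt (i b₀) (hyperplaneIncl (p + 1) v)) Set.univ :=
      h1.comp (hyperplaneIncl (p + 1)).contDiff.contDiffOn fun v _ => by
        rw [hRe]
        exact le_refl (0 : ℝ)
    exact fun v hv => contDiffWithinAt_alternating_iff.1 (h2 v hv) _
  have hhr : ∀ (v : EuclideanSpace ℝ (Fin (p + 1))) (k : Fin (p + 1)),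
      r ≤ |v k - hyperplaneProj (p + 1) c k| → h v = 0 := by
    intro v k hk
    by_cases hv : hyperplaneIncl (p + 1) v ∈ e.target
    · simp only [hh]
      rw [Form.inChartExt_of_mem _ hv, Form.inChart_eq_zero]
      · rfl
      · refine hαU _ fun hvU => ?_
        have h2 := hvU.2 k.succ
        rw [e.right_inv hv] at h2
        exact absurd hk (not_le.2 h2)
    · simp only [hh, Form.inChartExt]
      rw [Set.indicator_of_notMem hv]
      rfl
  -- On the hyperplane, `α` is a multiple of `γ` up to the divergence of a compactly supported `q`.
  -- The form `β` with coefficients `± q k`, cut off in the normal variable, makes this divergence the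
  -- tangential coefficient of `dβ`.
  obtain ⟨C, q, hq, hqr, hqh⟩ := exists_eq_mul_prod_add_sum_fderiv hhs hhr
    (η := η) (fun k => (f k).contDiff_normed) (fun k x hx => hηr k x hx)
    (fun k => (f k).integral_normed)
  set F : EuclideanSpace ℝ (Fin (p + 2)) → EuclideanSpace ℝ (Fin (p + 2)) [⋀^Fin p]→L[ℝ] ℝ :=
    fun y => ∑ k : Fin (p + 1), (f₀ (y 0) * ((-1) ^ (k : ℕ) * q k (hyperplaneProj (p + 1) y))) •
      tangentDetRemove p k with hF
  have hFs : ContDiff ℝ ∞ F := ContDiff.sum fun k _ =>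
    ContDiff.smul (ContDiff.mul (f₀.contDiff.comp (by fun_prop))
      (contDiff_const.mul ((hq k).comp (hyperplaneProj (p + 1)).contDiff))) contDiff_const
  have hFK : ∀ y ∈ Set.range (𝓡∂ (p + 2)), y ∉ Q → F y = 0 := by
    intro y hy hyQ
    have h1 : ∃ k, r < |y k - c k| := by
      by_contra h
      push Not at h
      exact hyQ ⟨h, hy⟩
    obtain ⟨k, hk⟩ := h1
    refine Finset.sum_eq_zero fun j _ => ?_
    have h2 : f₀ (y 0) * ((-1) ^ (j : ℕ) * q j (hyperplaneProj (p + 1) y)) = 0 := by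
      revert hk
      refine Fin.cases ?_ (fun k => ?_) k
      · intro hk
        rw [hc₀, sub_zero] at hk
        rw [hf₀ _ hk.le, zero_mul]
      · intro hk
        rw [hqr j _ k hk.le, mul_zero, mul_zero]
    rw [h2, zero_smul]
  set β : Form (𝓡∂ (p + 2)) M p := Form.ofChart (𝓡∂ (p + 2)) (i b₀) F with hβ
  have hβs : β.IsSmooth := Form.isSmooth_ofChart hFs.contDiffOn hQc hQt hFK
  refine Submodule.mem_sup.2 ⟨α - C • γ, ⟨(smoothForms _ _ _).sub_mem hα
    ((smoothForms _ _ _).smul_mem C hγs), β, hβs, ?_⟩, C • γ,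
    Submodule.smul_mem _ _ (Submodule.mem_span_singleton_self γ), sub_add_cancel _ _⟩
  funext b'
  change Form.pullback _ _ _ b' = 0
  by_cases hb' : i b' ∈ e.source
  · have hyt : e (i b') ∈ e.target := e.map_source hb'
    have hy0 := hbd b' hb'
    rw [hi.pullback_apply_eq_zero_iff _ hb']
    have h1 : β.extD.inChart (i b₀) (e (i b')) (tangentFrame (p + 1)) =
        ∑ k, fderiv ℝ (q k) (hyperplaneProj (p + 1) (e (i b'))) (frame (p + 1) k) := by
      rw [← extDerivWithin_sum_tangentDetRemove hq f₀.contDiff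
        (f₀.one_of_mem_closedBall (Metric.mem_closedBall_self f₀.rIn_pos.le)) hy0,
        Form.inChart_extD hβs hyt]
      congr 1
      refine Filter.EventuallyEq.extDerivWithin_eq ?_ (Form.inChart_ofChart F hyt)
      filter_upwards [extChartAt_target_mem_nhdsWithin_of_mem hyt] with z hz
      exact Form.inChart_ofChart F hz
    have h2 : α.inChart (i b₀) (e (i b')) (tangentFrame (p + 1)) =
        h (hyperplaneProj (p + 1) (e (i b'))) := by
      simp only [hh]
      rw [hyperplaneIncl_proj hy0, Form.inChartExt_of_mem _ hyt]
    have h3 : γ.inChart (i b₀) (e (i b')) (tangentFrame (p + 1)) =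
        ∏ k, η k (hyperplaneProj (p + 1) (e (i b')) k) := by
      rw [hγ, Form.inChart_ofChart F' hyt]
      simp only [hF', ContinuousAlternatingMap.smul_apply, tangentDet_tangentFrame, smul_eq_mul,
        mul_one, hy0]
      rw [f₁.one_of_mem_closedBall (Metric.mem_closedBall_self f₁.rIn_pos.le), one_mul]
      rfl
    change α.inChart (i b₀) (e (i b')) (tangentFrame (p + 1)) -
      C * γ.inChart (i b₀) (e (i b')) (tangentFrame (p + 1)) -
      β.extD.inChart (i b₀) (e (i b')) (tangentFrame (p + 1)) = 0
    rw [h1, h2, h3, hqh]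
    ring
  · refine Form.pullback_apply_eq_zero ?_
    have hb'C : i b' ∉ e.symm '' Q := fun h => hb' (hCs h)
    have h1 : β.extD (i b') = 0 := Form.extD_eq_zero_of_notMem hCc.isClosed
      (fun x hx => Form.ofChart_eq_zero hFK hx) hb'C
    have h2 : γ (i b') = 0 := hγ0 _ fun h => hb' h.2.1
    change α (i b') - C • γ (i b') - β.extD (i b') = 0
    rw [h1, h2, hαC _ hb'C, smul_zero, sub_zero, sub_zero]

/-- Up to forms that are exact on the boundary, there is at most one form of degree `m` on a manifold
with connected boundary of dimension `m`. -/
theorem IsBoundaryInclusion.exists_generator [CompactSpace M] [ConnectedSpace B]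
    (hi : IsBoundaryInclusion (𝓡∂ (p + 2)) (𝓡 (p + 1)) i) :
    ∃ γ : Form (𝓡∂ (p + 2)) M (p + 1), γ.IsSmooth ∧
      ∀ α : Form (𝓡∂ (p + 2)) M (p + 1), α.IsSmooth →
        α ∈ exactOnBoundary (𝓡 (p + 1)) i ⊔ Submodule.span ℝ {γ} := by
  obtain ⟨b₀⟩ := (inferInstance : Nonempty B)
  obtain ⟨U, hU, hbU, hloc⟩ := hi.exists_local_generator b₀
  obtain ⟨γ, hγ, hγU, hγα⟩ := hloc b₀ hbU U hU hbU
  refine ⟨γ, hγ, ?_⟩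
  set S := exactOnBoundary (𝓡 (p + 1)) i ⊔ Submodule.span ℝ {γ} with hS
  have hic : Continuous i := hi.isSmoothEmbedding.contMDiff.continuous
  -- The boundary points near which all forms belong to `S` form an open and closed set.
  set A := {b : B | ∃ V : Set M, IsOpen V ∧ i b ∈ V ∧
    ∀ α : Form (𝓡∂ (p + 2)) M (p + 1), α.IsSmooth → (∀ x ∉ V, α x = 0) → α ∈ S} with hA
  have hAo : IsOpen A := by
    rw [isOpen_iff_mem_nhds]
    rintro b ⟨V, hV, hbV, h⟩
    filter_upwards [(hV.preimage hic).mem_nhds hbV] with b' hb'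
    exact ⟨V, hV, hb', h⟩
  have hAc : IsClosed A := by
    rw [← closure_subset_iff_isClosed]
    intro b hb
    obtain ⟨U', hU', hbU', hloc'⟩ := hi.exists_local_generator b
    obtain ⟨b', hb'U, V, hV, hb'V, hVS⟩ := mem_closure_iff.1 hb _ (hU'.preimage hic) hbU'
    obtain ⟨γ', hγ', hγ'V, hγ'α⟩ := hloc' b' hb'U V hV hb'V
    refine ⟨U', hU', hbU', fun α hα hαU => ?_⟩
    have h1 : exactOnBoundary (𝓡 (p + 1)) i ⊔ Submodule.span ℝ {γ'} ≤ S := by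
      refine sup_le le_sup_left ?_
      rw [Submodule.span_singleton_le_iff_mem]
      exact hVS γ' hγ' hγ'V
    exact h1 (hγ'α α hα hαU)
  have hAu : A = Set.univ := IsClopen.eq_univ ⟨hAc, hAo⟩ ⟨b₀, U, hU, hbU, hγα⟩
  intro α hα
  have hzero : ∀ (f : M → ℝ), ∀ x ∉ tsupport f, α.fmul f x = 0 := by
    intro f x hx
    rw [Form.fmul, image_eq_zero_of_notMem_tsupport hx]
    exact zero_smul ℝ (α x)
  refine Form.mem_of_forall_exists_isOpen S fun x => ?_
  by_cases hx : x ∈ (𝓡∂ (p + 2)).boundary M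
  · rw [← hi.range_eq] at hx
    obtain ⟨b, rfl⟩ := hx
    obtain ⟨V, hV, hbV, h⟩ : b ∈ A := hAu ▸ Set.mem_univ b
    exact ⟨V, hV, hbV, fun f hf hfV => h _ (Form.IsSmooth.fmul hf hα) fun x hx =>
      hzero f x fun h => hx (hfV h)⟩
  · refine ⟨((𝓡∂ (p + 2)).boundary M)ᶜ,
      ((𝓡∂ (p + 2)).isClosed_boundary (n := ∞) (by simp)).isOpen_compl, hx, fun f hf hfV => ?_⟩
    refine (le_sup_left : _ ≤ S) ⟨Form.IsSmooth.fmul hf hα, 0, (smoothForms _ _ _).zero_mem, ?_⟩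
    have h0 : (0 : Form (𝓡∂ (p + 2)) M p).extD = 0 := map_zero (extDₗ _ _ _)
    rw [h0, sub_zero]
    funext b
    refine Form.pullback_apply_eq_zero (hzero f _ fun h => ?_)
    exact hfV h (hi.range_eq ▸ Set.mem_range_self b)

/-- If the volume form is exact, the restriction to the boundary of any closed form of degree `m` is
exact: by Stokes' theorem, the integral of `dα` over `M` only depends on the class of `α`
modulo forms that are exact on the boundary, and it is not identically zero. -/
theorem IsVolumeForm.mem_exactOnBoundary [CompactSpace M] [Nonempty M] [ConnectedSpace B]
    [MeasurableSpace M] [BorelSpace M]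
    (hi : IsBoundaryInclusion (𝓡∂ (p + 2)) (𝓡 (p + 1)) i) {w : Form (𝓡∂ (p + 2)) M (p + 2)}
    (hw : IsVolumeForm w) {θ : Form (𝓡∂ (p + 2)) M (p + 1)} (hθ : θ.IsSmooth) (hθw : θ.extD = w)
    {α : Form (𝓡∂ (p + 2)) M (p + 1)} (hα : α.IsSmooth) (hα₀ : α.extD = 0) :
    α ∈ exactOnBoundary (𝓡 (p + 1)) i := by
  obtain ⟨γ, hγ, hgen⟩ := hi.exists_generator
  let L : smoothForms (𝓡∂ (p + 2)) M (p + 1) →ₗ[ℝ] ℝ := (formIntegralₗ hw).comp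
    ((extDₗ (𝓡∂ (p + 2)) M (p + 1)).codRestrict (smoothForms _ _ _) fun α => Form.IsSmooth.extD α.2)
  have hL : ∀ (ν : Form (𝓡∂ (p + 2)) M (p + 1)) (hν : ν ∈ exactOnBoundary (𝓡 (p + 1)) i),
      L ⟨ν, hν.1⟩ = 0 := by
    rintro ν ⟨hν, β, hβ, h⟩
    have h1 := hw.formIntegral_extD_eq_zero hi
      ⟨(smoothForms _ _ _).sub_mem hν hβ.extD, h⟩
    rw [Form.extD_sub hν hβ.extD, Form.extD_extD hβ, sub_zero] at h1
    exact h1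
  have hdecomp : ∀ (α : Form (𝓡∂ (p + 2)) M (p + 1)) (hα : α.IsSmooth),
      ∃ c : ℝ, L ⟨α, hα⟩ = c * L ⟨γ, hγ⟩ ∧ (c = 0 → α ∈ exactOnBoundary (𝓡 (p + 1)) i) := by
    intro α hα
    obtain ⟨ν, hν, _, hz, rfl⟩ := Submodule.mem_sup.1 (hgen α hα)
    obtain ⟨c, rfl⟩ := Submodule.mem_span_singleton.1 hz
    refine ⟨c, ?_, ?_⟩
    · have h1 : (⟨ν + c • γ, hα⟩ : smoothForms (𝓡∂ (p + 2)) M (p + 1)) =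
          ⟨ν, hν.1⟩ + c • ⟨γ, hγ⟩ := rfl
      rw [h1, map_add, map_smul, hL ν hν, zero_add, smul_eq_mul]
    · rintro rfl
      rwa [zero_smul, add_zero]
  obtain ⟨c, hc, -⟩ := hdecomp θ hθ
  obtain ⟨c', hc', h⟩ := hdecomp α hα
  have h1 : L ⟨θ, hθ⟩ ≠ 0 := by
    change formIntegral w θ.extD ≠ 0
    rw [hθw]
    exact hw.vol_ne_zero
  have h2 : L ⟨α, hα⟩ = 0 := by
    have : L ⟨α, hα⟩ = formIntegralₗ hw 0 := congrArg (formIntegralₗ hw) (Subtype.ext hα₀)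
    rw [this, map_zero]
  rw [hc] at h1
  rw [hc'] at h2
  exact h ((mul_eq_zero.1 h2).resolve_right (right_ne_zero_of_mul h1))

end Local

/-! ### The zigzag in the double complex -/

section Zigzag

theorem coboundary_degree_zero {G V : Type*} [Mul G] [AddCommGroup V] [Module ℝ V]
    (act : G → V → V) (v : V) (g : Fin 1 → G) :
    coboundary act (fun _ : Fin 0 → G => v) g = v - act (g (Fin.last 0)) v := by
  simp [coboundary, sub_eq_add_neg]

theorem FormCochain.toTotal_self {E H : Type*} [NormedAddCommGroup E] [NormedSpace ℝ E]
    [TopologicalSpace H] {I : ModelWithCorners ℝ E H} {M : Type*} [TopologicalSpace M]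
    [ChartedSpace H M] {G : Subgroup (Diff I M)} {k l : ℕ} (c : FormCochain G k l) :
    c.toTotal (k, l) = c :=
  Pi.single_eq_same (M := fun p : ℕ × ℕ => FormCochain G p.1 p.2) (k, l) c

theorem FormCochain.toTotal_of_ne {E H : Type*} [NormedAddCommGroup E] [NormedSpace ℝ E]
    [TopologicalSpace H] {I : ModelWithCorners ℝ E H} {M : Type*} [TopologicalSpace M]
    [ChartedSpace H M] {G : Subgroup (Diff I M)} {k l : ℕ} (c : FormCochain G k l) {q : ℕ × ℕ}
    (hq : q ≠ (k, l)) : c.toTotal q = 0 :=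
  Pi.single_eq_of_ne (M := fun p : ℕ × ℕ => FormCochain G p.1 p.2) hq c

theorem FormCochain.extD_eq_zero_of_dd {E H : Type*} [NormedAddCommGroup E] [NormedSpace ℝ E]
    [TopologicalSpace H] {I : ModelWithCorners ℝ E H} {M : Type*} [TopologicalSpace M]
    [ChartedSpace H M] {G : Subgroup (Diff I M)} {k l : ℕ} {c : FormCochain G k l}
    (hc : c.dd = 0) (g : Fin k → G) : (c g).extD = 0 := by
  have h : (-1 : ℝ) ^ k • (c g).extD = 0 := congrFun hc g
  exact (smul_eq_zero (M := Form I M (l + 1))).1 h |>.resolve_left (by simp)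

variable {p : ℕ} {M : Type*} [TopologicalSpace M] [ChartedSpace (EuclideanHalfSpace (p + 2)) M]
  [IsManifold (𝓡∂ (p + 2)) ∞ M] {B : Type*} [TopologicalSpace B]
  [ChartedSpace (EuclideanSpace ℝ (Fin (p + 1))) B] {i : B → M}
  {G : Subgroup (Diff (𝓡∂ (p + 2)) M)}

/-- Let `ψ` be a closed element of total degree `p + 1`, for a group of diffeomorphisms that fix the
boundary, with relative components in form degree at most `p`. If the relative cohomology
vanishes and closed forms of degree `p + 1` are exact on the boundary, then the component of `ψ` in
form degree zero is a `δ`-coboundary. -/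
theorem exists_eq_delta (hi : MDifferentiable (𝓡 (p + 1)) (𝓡∂ (p + 2)) i)
    (hG : ∀ g : G, ∀ b, (g : Diff (𝓡∂ (p + 2)) M) (i b) = i b)
    (hH : ∀ l < p + 2, RelCohomologyVanishes (𝓡∂ (p + 2)) (𝓡 (p + 1)) i l)
    (hN : ∀ α : Form (𝓡∂ (p + 2)) M (p + 1), α.IsSmooth → α.extD = 0 →
      α ∈ exactOnBoundary (𝓡 (p + 1)) i)
    {ψ : TotalCochain G} (hψ : ∀ q g, (ψ q g).IsSmooth)
    (hrel : ∀ k l : ℕ, k + l = p + 1 → l < p + 1 → ∀ g, (ψ (k, l) g).IsRelative (𝓡 (p + 1)) i)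
    (hd₀ : FormCochain.dd (ψ (0, p + 1)) = 0)
    (hd : ∀ k l : ℕ, k + l = p → FormCochain.delta (ψ (k, l + 1)) +
      FormCochain.dd (ψ (k + 1, l)) = 0) :
    ∃ η : FormCochain G p 0, (∀ g, (η g).IsSmooth) ∧ ψ (p + 1, 0) = η.delta := by
  have key : ∀ k l : ℕ, k + l = p → ∃ η : FormCochain G k l, (∀ g, (η g).IsSmooth) ∧
      (∀ g, Form.IsRelative (𝓡 (p + 1)) i ((ψ (k + 1, l) - η.delta : FormCochain G (k + 1) l) g)) ∧
      FormCochain.dd (ψ (k + 1, l) - η.delta : FormCochain G (k + 1) l) = 0 := by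
    intro k
    induction k with
    | zero =>
      rintro l hl
      obtain rfl : l = p := by omega
      have hα := FormCochain.extD_eq_zero_of_dd hd₀ ![]
      obtain ⟨-, β, hβ, hβα⟩ := hN _ (hψ _ _) hα
      have hαβ : (ψ (0, l + 1) ![] - β.extD : Form (𝓡∂ (l + 2)) M (l + 1)).IsRelative
          (𝓡 (l + 1)) i := ⟨(smoothForms _ _ _).sub_mem (hψ _ _) hβ.extD, hβα⟩
      obtain ⟨γ, hγ, hγα⟩ := hH (l + 1) (by omega) _ hαβ (by
        rw [Form.extD_sub (hψ _ _) hβ.extD, Form.extD_extD hβ, hα, sub_zero])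
      set η : FormCochain G 0 l := fun _ => β + γ with hη
      have hηs : ∀ g, (η g).IsSmooth := fun _ => (smoothForms _ _ _).add_mem hβ hγ.1
      have hηd : η.dd = ψ (0, l + 1) := by
        funext g
        obtain rfl : g = ![] := Subsingleton.elim _ _
        change (-1 : ℝ) ^ 0 • (β + γ).extD = _
        rw [Form.extD_add hβ hγ.1, hγα, pow_zero, one_smul, add_sub_cancel]
      have hδs := FormCochain.isSmooth_delta hηs
      refine ⟨η, hηs, fun g => ⟨(smoothForms _ _ _).sub_mem (hψ _ _) (hδs g), ?_⟩, ?_⟩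
      · change Form.pullback _ _ (ψ (0 + 1, l) g - η.delta g) = 0
        rw [Form.pullback_sub, (hrel (0 + 1) l (by omega) (by omega) g).2]
        have h1 : η.delta g = (β + γ) - (β + γ).pullback (𝓡∂ (l + 2))
            (g (Fin.last 0) : Diff (𝓡∂ (l + 2)) M) := coboundary_degree_zero _ _ g
        rw [h1, Form.pullback_sub, Form.pullback_pullback
          ((g (Fin.last 0) : Diff (𝓡∂ (l + 2)) M).mdifferentiable (by simp)) hi,
          show ((g (Fin.last 0) : Diff (𝓡∂ (l + 2)) M) : M → M) ∘ i = i from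
            funext (hG (g (Fin.last 0))), sub_self, sub_zero]
      · rw [FormCochain.dd_sub (hψ _) hδs, FormCochain.dd_delta hηs, hηd, sub_neg_eq_add]
        exact (add_comm _ _).trans (hd 0 l (by omega))
    | succ k ih =>
      rintro l hl
      obtain ⟨η, hη, hξ, hξd⟩ := ih (l + 1) (by omega)
      set ξ : FormCochain G (k + 1) (l + 1) := ψ (k + 1, l + 1) - η.delta with hξdef
      choose ζ hζ hζξ using fun g => hH (l + 1) (by omega) (ξ g) (hξ g)
        (FormCochain.extD_eq_zero_of_dd hξd g)
      set η' : FormCochain G (k + 1) l := fun g => (-1 : ℝ) ^ (k + 1) • ζ g with hη'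
      have hη'r : ∀ g, (η' g).IsRelative (𝓡 (p + 1)) i := fun g =>
        (relativeForms (𝓡∂ (p + 2)) (𝓡 (p + 1)) l i).smul_mem _ (hζ g)
      have hη's : ∀ g, (η' g).IsSmooth := fun g => (hη'r g).1
      have hη'd : η'.dd = ξ := by
        funext g
        change (-1 : ℝ) ^ (k + 1) • ((-1 : ℝ) ^ (k + 1) • ζ g).extD = _
        rw [Form.extD_smul, hζξ, smul_smul, ← pow_add, Even.neg_one_pow (Even.add_self _), one_smul]
      have hδr := FormCochain.isRelative_delta hi hG hη'r
      refine ⟨η', hη's, fun g => (relativeForms (𝓡∂ (p + 2)) (𝓡 (p + 1)) l i).sub_mem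
        (hrel _ _ (by omega) (by omega) g) (hδr g), ?_⟩
      rw [FormCochain.dd_sub (hψ _) (fun g => (hδr g).1), FormCochain.dd_delta hη's, hη'd, hξdef,
        FormCochain.delta_sub, FormCochain.delta_delta, sub_zero, sub_neg_eq_add]
      exact (add_comm _ _).trans (hd (k + 1) l (by omega))
  obtain ⟨η, hη, hξ, hξd⟩ := key p 0 rfl
  refine ⟨η, hη, ?_⟩
  funext g
  have h := hH 0 (by omega) _ (hξ g) (FormCochain.extD_eq_zero_of_dd hξd g)
  exact sub_eq_zero.1 h

end Zigzag

/-! ### The class `c(M)` -/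

section Class

variable {p : ℕ} {M : Type*} [TopologicalSpace M] [ChartedSpace (EuclideanHalfSpace (p + 2)) M]
  {w : Form (𝓡∂ (p + 2)) M (p + 2)}

theorem DiffVol.pullback_eq (g : DiffVol w) :
    w.pullback (𝓡∂ (p + 2)) (g : Diff (𝓡∂ (p + 2)) M) = w :=
  identityComponent_le _ g.2

theorem DiffVolRel.pullback_eq (g : DiffVolRel w) :
    w.pullback (𝓡∂ (p + 2)) (g : Diff (𝓡∂ (p + 2)) M) = w :=
  DiffVol.pullback_eq (diffVolIncl w g)

theorem DiffVolRel.apply_boundary (g : DiffVolRel w) {x : M}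
    (hx : x ∈ (𝓡∂ (p + 2)).boundary M) : (g : Diff (𝓡∂ (p + 2)) M) x = x :=
  (identityComponent_le _ g.2).2 x hx

/-- Restriction to a subgroup commutes with the total differential. -/
theorem TotalCochain.d_comp_hom {E H : Type*} [NormedAddCommGroup E] [NormedSpace ℝ E]
    [TopologicalSpace H] {I : ModelWithCorners ℝ E H} {M : Type*} [TopologicalSpace M]
    [ChartedSpace H M] {G G' : Subgroup (Diff I M)} (ρ : G' →* G)
    (hρ : ∀ g, (ρ g : Diff I M) = g) (φ : TotalCochain G) (q : ℕ × ℕ) (g : Fin q.1 → G') :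
    TotalCochain.d (fun q (g : Fin q.1 → G') => φ q fun a => ρ (g a)) q g =
      φ.d q fun a => ρ (g a) := by
  obtain ⟨k, l⟩ := q
  have h1 : TotalCochain.deltaPart (fun q (g : Fin q.1 → G') => φ q fun a => ρ (g a)) k l g =
      φ.deltaPart k l fun a => ρ (g a) := by
    cases k with
    | zero => rfl
    | succ k => exact (FormCochain.delta_comp_hom ρ hρ (φ (k, l)) g).symm
  have h2 : TotalCochain.ddPart (fun q (g : Fin q.1 → G') => φ q fun a => ρ (g a)) k l g =
      φ.ddPart k l fun a => ρ (g a) := by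
    cases l <;> rfl
  exact congrArg₂ (· + ·) h1 h2

variable {B : Type*} [TopologicalSpace B]
  [ChartedSpace (EuclideanSpace ℝ (Fin (p + 1))) B] {i : B → M}

theorem IsRelPrimitive.delta_add_dd {φ : TotalCochain (DiffVolRel w)}
    (hφ : IsRelPrimitive (𝓡 (p + 1)) i w φ) (k l : ℕ) :
    FormCochain.delta (φ (k, l + 1)) + FormCochain.dd (φ (k + 1, l)) = 0 := by
  have h := congrFun hφ.d_eq (k + 1, l + 1)
  rw [FormCochain.toTotal_of_ne _ (by simp)] at h
  exact h

theorem IsRelPrimitive.dd_eq {φ : TotalCochain (DiffVolRel w)}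
    (hφ : IsRelPrimitive (𝓡 (p + 1)) i w φ) :
    FormCochain.dd (φ (0, p + 1)) = FormCochain.ofForm (DiffVolRel w) w := by
  have h := congrFun hφ.d_eq (0, p + 2)
  rw [FormCochain.toTotal_self] at h
  rw [← h]
  exact (zero_add _).symm

theorem IsRelPrimitive.delta_eq_zero {φ : TotalCochain (DiffVolRel w)}
    (hφ : IsRelPrimitive (𝓡 (p + 1)) i w φ) : FormCochain.delta (φ (p + 1, 0)) = 0 := by
  have h := congrFun hφ.d_eq (p + 2, 0)
  rw [FormCochain.toTotal_of_ne _ (by simp)] at h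
  rw [← h]
  exact (add_zero _).symm

theorem zeroWedge_zero : (0 : Form (𝓡∂ (p + 2)) M 0).zeroWedge w = 0 := by
  funext x
  exact zero_smul ℝ (w x)

variable [IsManifold (𝓡∂ (p + 2)) ∞ M] [CompactSpace M] [MeasurableSpace M] [BorelSpace M]

theorem IsVolumeForm.formIntegral_zero (hw : IsVolumeForm w) : formIntegral w 0 = 0 :=
  map_zero (formIntegralₗ hw)

theorem IsRelPrimitive.secondaryCochain_mem_cocycles {φ : TotalCochain (DiffVolRel w)}
    (hφ : IsRelPrimitive (𝓡 (p + 1)) i w φ) (hw : IsVolumeForm w) :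
    secondaryCochain w φ ∈ cocycles (DiffVolRel w) (p + 1) := by
  have h := d_functionIntegral hw DiffVolRel.pullback_eq (c := φ (p + 1, 0))
    (hφ.hasDegree.isSmooth _)
  refine LinearMap.mem_ker.2 (h.trans ?_)
  rw [hφ.delta_eq_zero]
  funext g
  change formIntegral w ((0 : Form (𝓡∂ (p + 2)) M 0).zeroWedge w) = 0
  rw [zeroWedge_zero, hw.formIntegral_zero]

variable [T2Space M] [Nonempty M] [ConnectedSpace B] [IsManifold (𝓡 (p + 1)) ∞ B]

/-- The class of `∫_M φ^{(0)} ∧ w` does not depend on the choice of `φ`. -/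
theorem IsRelPrimitive.sub_mem_coboundaries {φ φ' : TotalCochain (DiffVolRel w)}
    (hφ : IsRelPrimitive (𝓡 (p + 1)) i w φ) (hφ' : IsRelPrimitive (𝓡 (p + 1)) i w φ')
    (hw : IsVolumeForm w) (hi : IsBoundaryInclusion (𝓡∂ (p + 2)) (𝓡 (p + 1)) i)
    (hH : ∀ l < p + 2, RelCohomologyVanishes (𝓡∂ (p + 2)) (𝓡 (p + 1)) i l) :
    secondaryCochain w φ - secondaryCochain w φ' ∈ coboundaries (DiffVolRel w) (p + 1) := by
  have hs := hφ.hasDegree.isSmooth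
  have hs' := hφ'.hasDegree.isSmooth
  have hθ : (φ (0, p + 1) ![]).extD = w := by
    have h := congrFun hφ.dd_eq ![]
    have h' : FormCochain.dd (φ (0, p + 1)) ![] = (-1 : ℝ) ^ 0 • (φ (0, p + 1) ![]).extD := rfl
    rw [h', pow_zero, one_smul] at h
    exact h
  obtain ⟨η, hη, hηψ⟩ := exists_eq_delta (ψ := φ - φ') hi.mdifferentiable
    (fun g b => DiffVolRel.apply_boundary g (hi.range_eq ▸ Set.mem_range_self b)) hH
    (fun α hα hα₀ => hw.mem_exactOnBoundary hi (hs _ _) hθ hα hα₀)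
    (fun q g => (smoothForms _ _ _).sub_mem (hs q g) (hs' q g))
    (fun k l h h' g => (relativeForms _ _ _ i).sub_mem (hφ.isRelative k l h h' g)
      (hφ'.isRelative k l h h' g)) (by
      change FormCochain.dd (φ (0, p + 1) - φ' (0, p + 1)) = 0
      rw [FormCochain.dd_sub (hs _) (hs' _), hφ.dd_eq, hφ'.dd_eq, sub_self]) (fun k l _ => by
      change FormCochain.delta (φ (k, l + 1) - φ' (k, l + 1)) +
        FormCochain.dd (φ (k + 1, l) - φ' (k + 1, l)) = 0
      rw [FormCochain.delta_sub, FormCochain.dd_sub (hs _) (hs' _), sub_add_sub_comm,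
        hφ.delta_add_dd, hφ'.delta_add_dd, sub_self])
  refine ⟨fun g => formIntegral w ((η g).zeroWedge w), ?_⟩
  rw [d_functionIntegral hw DiffVolRel.pullback_eq hη, ← hηψ]
  funext g
  change formIntegral w (Form.zeroWedge (φ (p + 1, 0) g - φ' (p + 1, 0) g) w) =
    formIntegral w ((φ (p + 1, 0) g).zeroWedge w) - formIntegral w ((φ' (p + 1, 0) g).zeroWedge w)
  simp only [hw.formIntegral_zeroWedge]
  exact map_sub (functionIntegralₗ hw) ⟨_, hs (p + 1, 0) g⟩ ⟨_, hs' (p + 1, 0) g⟩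

theorem IsRelPrimitive.represents {φ : TotalCochain (DiffVolRel w)}
    (hφ : IsRelPrimitive (𝓡 (p + 1)) i w φ)
    (hw : IsVolumeForm w) (hi : IsBoundaryInclusion (𝓡∂ (p + 2)) (𝓡 (p + 1)) i)
    (hH : ∀ l < p + 2, RelCohomologyVanishes (𝓡∂ (p + 2)) (𝓡 (p + 1)) i l) :
    Represents (secondaryCochain w φ) (secondaryClass (𝓡 (p + 1)) i w) := by
  have hz := hφ.secondaryCochain_mem_cocycles hw
  have hex : ∃ (x : Cohomology (DiffVolRel w) (p + 1)) (φ : TotalCochain (DiffVolRel w)),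
      IsRelPrimitive (𝓡 (p + 1)) i w φ ∧ Represents (secondaryCochain w φ) x :=
    ⟨_, φ, hφ, hz, rfl⟩
  obtain ⟨φ', hφ', hz', hx⟩ := hex.choose_spec
  refine ⟨hz, ?_⟩
  rw [secondaryClass, dif_pos hex, ← hx]
  exact (Submodule.Quotient.eq _).2 (hφ.sub_mem_coboundaries hφ' hw hi hH)

end Class

/-! ### The transgression formula -/

section Transgression

variable {p : ℕ} {M : Type*} [TopologicalSpace M]
  [ChartedSpace (EuclideanHalfSpace (p + 2)) M] [IsManifold (𝓡∂ (p + 2)) ∞ M]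
  {w : Form (𝓡∂ (p + 2)) M (p + 2)} {B : Type*} [TopologicalSpace B]
  [ChartedSpace (EuclideanSpace ℝ (Fin (p + 1))) B] {i : B → M}

/-- On elements that fix the boundary, `δφ^{(0)}` takes constant values, which are zero because they
vanish on the boundary. Hence `φ` restricts to an element that defines `c(M)`. -/
theorem IsAdaptedPrimitive.isRelPrimitive [Nonempty B] {φ : TotalCochain (DiffVol w)}
    (hφ : IsAdaptedPrimitive (𝓡 (p + 1)) i w φ)
    (hi : IsBoundaryInclusion (𝓡∂ (p + 2)) (𝓡 (p + 1)) i) {ψ : Cochain (DiffVol w) (p + 2)}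
    (hψ : FormCochain.ofReal ψ = FormCochain.delta (φ (p + 1, 0))) :
    IsRelPrimitive (𝓡 (p + 1)) i w fun q g => φ q fun a => diffVolIncl w (g a) where
  hasDegree := ⟨fun q g => hφ.hasDegree.isSmooth q _, fun q hq => by
    rw [hφ.hasDegree.eq_zero q hq]
    rfl⟩
  isRelative := hφ.isRelative
  d_eq := by
    have hδ : ∀ g : Fin (p + 2) → DiffVolRel w,
        FormCochain.delta (φ (p + 1, 0)) (fun a => diffVolIncl w (g a)) = 0 := by
      intro g
      have h1 := FormCochain.isRelative_delta (G := DiffVolRel w) hi.mdifferentiable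
        (fun g b => DiffVolRel.apply_boundary g (hi.range_eq ▸ Set.mem_range_self b))
        (hφ.isRelative (p + 1) 0 rfl (by omega)) g
      rw [← FormCochain.delta_comp_hom (diffVolIncl w) (fun _ => rfl), ← hψ] at h1
      obtain ⟨b⟩ := (inferInstance : Nonempty B)
      have h2 : ψ (fun a => diffVolIncl w (g a)) = 0 :=
        congrArg (fun α : Form (𝓡 (p + 1)) B 0 => α b ![]) h1.2
      rw [← hψ]
      change Form.const (ψ fun a => diffVolIncl w (g a)) = 0
      rw [h2]
      rfl
    funext q g
    rw [TotalCochain.d_comp_hom (diffVolIncl w) (fun _ => rfl), hφ.d_eq]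
    change FormCochain.toTotal (FormCochain.ofForm (DiffVol w) w) q _ +
      FormCochain.toTotal (FormCochain.delta (φ (p + 1, 0))) q _ = _
    have h3 : FormCochain.toTotal (FormCochain.delta (φ (p + 1, 0))) q
        (fun a => diffVolIncl w (g a)) = 0 := by
      by_cases hq : q = (p + 2, 0)
      · subst hq
        rw [FormCochain.toTotal_self]
        exact hδ g
      · rw [FormCochain.toTotal_of_ne _ hq]
        rfl
    rw [h3, add_zero]
    by_cases hq : q = (0, p + 2)
    · subst hq
      rw [FormCochain.toTotal_self, FormCochain.toTotal_self]
      rfl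
    · rw [FormCochain.toTotal_of_ne _ hq, FormCochain.toTotal_of_ne _ hq]
      rfl

/-- Integration over `M` commutes with `δ`, and turns the constant `ψ` into `vol(M) · ψ`. -/
theorem IsAdaptedPrimitive.d_secondaryCochain [CompactSpace M] [MeasurableSpace M]
    [BorelSpace M] {φ : TotalCochain (DiffVol w)}
    (hφ : IsAdaptedPrimitive (𝓡 (p + 1)) i w φ) (hw : IsVolumeForm w)
    {ψ : Cochain (DiffVol w) (p + 2)}
    (hψ : FormCochain.ofReal ψ = FormCochain.delta (φ (p + 1, 0))) :
    Cochain.d (DiffVol w) (p + 1) (secondaryCochain w φ) = vol w • ψ := by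
  refine (d_functionIntegral hw DiffVol.pullback_eq (c := φ (p + 1, 0))
    (hφ.hasDegree.isSmooth _)).trans ?_
  rw [← hψ]
  funext g
  have h : formIntegral w (ψ g • w) = ψ g * vol w :=
    map_smul (formIntegralₗ hw) (ψ g) ⟨w, hw.isSmooth⟩
  rw [Pi.smul_apply, smul_eq_mul, mul_comm, ← h]
  rfl

theorem connectedSpace_of_diffeomorph_sphere
    (e : B ≃ₘ⟮𝓡 (p + 1), 𝓡 (p + 1)⟯ (Metric.sphere (0 : EuclideanSpace ℝ (Fin (p + 2))) 1)) :
    ConnectedSpace B := by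
  have h : 1 < Module.rank ℝ (EuclideanSpace ℝ (Fin (p + 2))) := by
    rw [← Module.finrank_eq_rank, finrank_euclideanSpace_fin]
    exact_mod_cast (by omega : 1 < p + 2)
  have := isConnected_iff_connectedSpace.1
    (isConnected_sphere h (0 : EuclideanSpace ℝ (Fin (p + 2))) zero_le_one)
  exact e.symm.toHomeomorph.surjective.connectedSpace e.symm.continuous

end Transgression

end

end VolDiff

open VolDiff in
theorem theorem4p4 {m : ℕ} (hm : 1 ≤ m)
    {M : Type*} [TopologicalSpace M] [T2Space M] [CompactSpace M] [ConnectedSpace M]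
    [ChartedSpace (EuclideanHalfSpace (m + 1)) M] [IsManifold (𝓡∂ (m + 1)) ∞ M]
    [MeasurableSpace M] [BorelSpace M]
    {B : Type*} [TopologicalSpace B] [ChartedSpace (EuclideanSpace ℝ (Fin m)) B]
    [IsManifold (𝓡 m) ∞ B]
    {i : B → M} (hi : IsBoundaryInclusion (𝓡∂ (m + 1)) (𝓡 m) i)
    (hB : Nonempty (B ≃ₘ⟮𝓡 m, 𝓡 m⟯ (Metric.sphere (0 : EuclideanSpace ℝ (Fin (m + 1))) 1)))
    (hH : ∀ l < m + 1, RelCohomologyVanishes (𝓡∂ (m + 1)) (𝓡 m) i l)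
    (w : Form (𝓡∂ (m + 1)) M (m + 1)) (hw : IsVolumeForm w)
    (φ : TotalCochain (DiffVol w)) (hφ : IsAdaptedPrimitive (𝓡 m) i w φ)
    (χ : cocycles (DiffZero (𝓡 m) B) (m + 1))
    (hχ : FormCochain.ofReal ((χ : Cochain (DiffZero (𝓡 m) B) (m + 1)).comap
      (hi.volRestrict w)) = (φ (m, 0)).delta) :
    Represents ((secondaryCochain w φ).comap (diffVolIncl w)) (secondaryClass (𝓡 m) i w) ∧
    Cochain.d (DiffVol w) m (secondaryCochain w φ)
      = vol w • (χ : Cochain (DiffZero (𝓡 m) B) (m + 1)).comap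
          (hi.volRestrict w) ∧
    Transgresses (diffVolIncl w) (hi.volRestrict w)
      (secondaryClass (𝓡 m) i w) (vol w • Cohomology.mk χ) := by
  obtain ⟨p, rfl⟩ : ∃ p, m = p + 1 := ⟨m - 1, by omega⟩
  obtain ⟨e⟩ := hB
  have := connectedSpace_of_diffeomorph_sphere e
  have h1 := (hφ.isRelPrimitive hi hχ).represents hw hi hH
  have h2 := hφ.d_secondaryCochain hw hχ
  exact ⟨h1, h2, secondaryCochain w φ, vol w • χ.1,
    ⟨(cocycles _ _).smul_mem _ χ.2, rfl⟩, h2, h1⟩
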